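/- Let $N\ge 2$, $q\ge p\ge 2$, $s_1\in(0,1)$, $s_p\in\left(\frac{p-1}{p},1\right)$, and let $\alpha\in\left(0,\frac{s_pp-(p-1)}{q}\right)$. Then there is a constant $C=C(N,p,q,s_1,s_p,\alpha)>0$ such that the following holds for every bounded domain $\Omega\subset\mathbb R^N$. Let $u\in W^{1,q}_{\rm loc}(\Omega)$ be a locally bounded weak solution of $(-\Delta_1)^{s_1}u+(-\Delta_p)^{s_p}u=0$ in $\Omega$, i.e. $u\in L^\infty_{\rm loc}(\Omega)\cap W^{s_1,1}_{\rm loc}(\Omega)\cap W^{s_p,p}_{\rm loc}(\Omega)$, $u\in L^{p-1}_{\rm loc}(\mathbb R^N)$ with $\int_{\mathbb R^N}\frac{|u(x)|^{p-1}}{(1+|x|)^{N+s_pp}}\,dx<\infty$, and there is $Z\in L^\infty(\mathbb R^N\times\mathbb R^N)$ with $Z(x,y)\in\operatorname{sgn}(u(x)-u(y))$ for a.e. $(x,y)$, where $\operatorname{sgn}(0)=[-1,1]$, such that $$\int_{\mathbb R^N}\!\int_{\mathbb R^N}Z(x,y)\frac{\varphi(x)-\varphi(y)}{|x-y|^{N+s_1}}\,dx\,dy+\int_{\mathbb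 R^N}\!\int_{\mathbb R^N}\frac{|u(x)-u(y)|^{p-2}(u(x)-u(y))(\varphi(x)-\varphi(y))}{|x-y|^{N+s_pp}}\,dx\,dy=0$$ for every $\varphi\in W^{s_1,1}(\mathbb R^N)\cap W^{s_p,p}(\mathbb R^N)$ with compact support in $\Omega$. Then $\nabla u\in W^{\alpha,q}_{\rm loc}(\Omega)$, i.e. $u\in W^{1+\alpha,q}_{\rm loc}(\Omega)$. Moreover, for all balls $B_r=B_r(x_0)$, $B_R=B_R(x_0)$ with $0<r<R<1$ and $\overline{B_R}\subset\Omega$, $$[\nabla u]^q_{W^{\alpha,q}(B_r)}=\int_{B_r}\!\int_{B_r}\frac{|\nabla u(x)-\nabla u(y)|^q}{|x-y|^{N+\alpha q}}\,dx\,dy\le\frac{C\left(\mathcal T+\|\nabla u\|_{L^q(B_R)}+1\right)^q}{(R-r)^{N+2q+2}},$$ where $$\mathcal T=\|u\|_{L^\infty(B_R)}+\left(R^{s_pp}\int_{\mathbb R^N\setminus B_R}\frac{|u(x)|^{p-1}}{|x-x_0|^{N+s_pp}}\,dx\right)^{\frac1{p-1}}.$$ -/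

import Mathlib

open MeasureTheory Metric Set
open scoped ENNReal

namespace NonlocalOneP

noncomputable section

/-- The Euclidean space `ℝ^N`. -/
abbrev E (N : ℕ) : Type := EuclideanSpace ℝ (Fin N)

/-- `V ⊂⊂ Ω` for open sets `V`: the closure of `V` is compact and contained in `Ω`. -/
def CompactlyInside {N : ℕ} (V Ω : Set (E N)) : Prop :=
  IsOpen V ∧ IsCompact (closure V) ∧ closure V ⊆ Ω

/-- The `q`-th power `[f]^q_{W^{γ,q}(V)}` of the Gagliardo seminorm, for scalar or
vector valued `f`, as an element of `[0,∞]`. -/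
def gagliardoPow {N : ℕ} {F : Type*} [NormedAddCommGroup F]
    (γ q : ℝ) (V : Set (E N)) (f : E N → F) : ℝ≥0∞ :=
  ∫⁻ x in V, ∫⁻ y in V, ‖f x - f y‖ₑ ^ q / ‖x - y‖ₑ ^ ((N : ℝ) + γ * q)

/-- `f ∈ L^q(V)`. -/
def MemLq {N : ℕ} {F : Type*} [NormedAddCommGroup F]
    (q : ℝ) (V : Set (E N)) (f : E N → F) : Prop :=
  MemLp f (ENNReal.ofReal q) (volume.restrict V)

/-- `f ∈ W^{γ,q}(V)`, for `0 < γ < 1` and `1 ≤ q < ∞`. -/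
def MemFracSobolev {N : ℕ} {F : Type*} [NormedAddCommGroup F]
    (γ q : ℝ) (V : Set (E N)) (f : E N → F) : Prop :=
  MemLq q V f ∧ gagliardoPow γ q V f < ∞

/-- `f ∈ W^{γ,q}_loc(Ω)`, for `0 < γ < 1` and `1 ≤ q < ∞`. -/
def MemFracSobolevLoc {N : ℕ} {F : Type*} [NormedAddCommGroup F]
    (γ q : ℝ) (Ω : Set (E N)) (f : E N → F) : Prop :=
  ∀ V : Set (E N), CompactlyInside V Ω → MemFracSobolev γ q V f

/-- `G` is the weak (distributional) gradient of `u` in the open set `Ω`. -/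
def IsWeakGradient {N : ℕ} (Ω : Set (E N)) (u : E N → ℝ) (G : E N → E N) : Prop :=
  LocallyIntegrableOn u Ω ∧ LocallyIntegrableOn G Ω ∧
  ∀ φ : E N → ℝ, ContDiff ℝ (⊤ : ℕ∞) φ → HasCompactSupport φ → tsupport φ ⊆ Ω →
    ∀ v : E N, ∫ x, u x * fderiv ℝ φ x v = - ∫ x, inner ℝ (G x) v * φ x

/-- `u ∈ W^{1,q}_loc(Ω)`: `u` has a weak gradient in `Ω`, and both are in `L^q_loc(Ω)`. -/
def MemSobolevOneLoc {N : ℕ} (q : ℝ) (Ω : Set (E N)) (u : E N → ℝ) : Prop :=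
  ∃ G : E N → E N, IsWeakGradient Ω u G ∧
    ∀ V : Set (E N), CompactlyInside V Ω → MemLq q V u ∧ MemLq q V G

/-- `u ∈ W^{1+α,q}_loc(Ω)`, `0 < α < 1`: `u ∈ L^q_loc(Ω)` has a weak gradient in `Ω`
that belongs to `W^{α,q}_loc(Ω)`. -/
def MemSobolevOneAddLoc {N : ℕ} (α q : ℝ) (Ω : Set (E N)) (u : E N → ℝ) : Prop :=
  ∃ G : E N → E N, IsWeakGradient Ω u G ∧
    (∀ V : Set (E N), CompactlyInside V Ω → MemLq q V u) ∧ MemFracSobolevLoc α q Ω G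

/-- The tail space `L^q_γ(ℝ^N)`. -/
def MemTailSpace {N : ℕ} (q γ : ℝ) (w : E N → ℝ) : Prop :=
  (∀ K : Set (E N), IsCompact K → MemLq q K w) ∧
  ∫⁻ x, ‖w x‖ₑ ^ q / ENNReal.ofReal ((1 + ‖x‖) ^ ((N : ℝ) + γ)) < ∞

/-- `Tail(u; x₀, R)`, formed with the exponents `s = s_p` and `p`. -/
def tail {N : ℕ} (s p : ℝ) (u : E N → ℝ) (x₀ : E N) (R : ℝ) : ℝ≥0∞ :=
  (ENNReal.ofReal (R ^ (s * p)) *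
    ∫⁻ x in (ball x₀ R)ᶜ, ‖u x‖ₑ ^ (p - 1) / ‖x - x₀‖ₑ ^ ((N : ℝ) + s * p)) ^ (1 / (p - 1))

/-- `T = ‖u‖_{L^∞(B_R(x₀))} + Tail(u; x₀, R)`. -/
def bigT {N : ℕ} (s p : ℝ) (u : E N → ℝ) (x₀ : E N) (R : ℝ) : ℝ≥0∞ :=
  eLpNorm u ∞ (volume.restrict (ball x₀ R)) + tail s p u x₀ R

/-- `u` is locally bounded in `Ω`, i.e. `u ∈ L^∞_loc(Ω)`. -/
def LocallyBounded {N : ℕ} (Ω : Set (E N)) (u : E N → ℝ) : Prop :=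
  ∀ V : Set (E N), CompactlyInside V Ω → eLpNorm u ∞ (volume.restrict V) < ∞

/-- The set-valued sign, with `sgn(0) = [-1,1]`. -/
def sgnSet (t : ℝ) : Set ℝ :=
  {z | (0 < t → z = 1) ∧ (t < 0 → z = -1) ∧ (t = 0 → z ∈ Icc (-1 : ℝ) 1)}

/-- Test functions: functions of `W^{s₁,1}(ℝ^N) ∩ W^{s_p,p}(ℝ^N)` with compact support in `Ω`. -/
def IsTestFunction {N : ℕ} (s₁ sp p : ℝ) (Ω : Set (E N)) (φ : E N → ℝ) : Prop :=
  MemFracSobolev s₁ 1 univ φ ∧ MemFracSobolev sp p univ φ ∧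
    HasCompactSupport φ ∧ tsupport φ ⊆ Ω

/-- Weak solutions of `(-Δ_1)^{s₁} u + (-Δ_p)^{s_p} u = 0` in `Ω`.

The test functions are the elements of `W^{s₁,1}_0(Ω) ∩ W^{s_p,p}_0(Ω)` with compact support
in `Ω`. For these both double integrals converge absolutely for every `u` in the function
spaces required below, which are only local in `Ω`. Testing with fewer functions makes the notion
weaker, so every solution in the sense of a larger test class is a solution here. -/
structure IsWeakSolution {N : ℕ} (s₁ sp p : ℝ) (Ω : Set (E N)) (u : E N → ℝ) : Prop where
  mem_one : MemFracSobolevLoc s₁ 1 Ω u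
  mem_p : MemFracSobolevLoc sp p Ω u
  mem_tail : MemTailSpace (p - 1) (sp * p) u
  weak_eq : ∃ Z : E N × E N → ℝ, MemLp Z ∞ volume ∧
    (∀ᵐ z : E N × E N, Z z ∈ sgnSet (u z.1 - u z.2)) ∧
    ∀ φ : E N → ℝ, IsTestFunction s₁ sp p Ω φ →
      (∫ z : E N × E N, Z z * (φ z.1 - φ z.2) / ‖z.1 - z.2‖ ^ ((N : ℝ) + s₁)) +
      (∫ z : E N × E N, |u z.1 - u z.2| ^ (p - 2) * (u z.1 - u z.2) * (φ z.1 - φ z.2) /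
        ‖z.1 - z.2‖ ^ ((N : ℝ) + sp * p)) = 0

end

end NonlocalOneP

open NonlocalOneP

namespace NonlocalOneP

open Filter Topology
open scoped Convolution

/-! ### Signed powers -/

/-! Write `p = n + 1`, `q = n + m` (so `m ≥ 1` because `q ≥ p`), `s = s_p p`, and `τ_h u(x) = u(x +
h) - u(x)`.

The kernels depend only on `x - y`, so the equation may be subtracted from its translate by `h`. The
difference is tested with a cutoff times the signed power `|τ_h u|^{m-1} τ_h u`. The multivalued
sign is monotone and the signed power is increasing, so the `1`-Laplacian part has a favourable sign
and is dropped; no regularity is extracted from it. The `p`-Laplacian part is coercive and controls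
the double integral of `|τ_h u(x) - τ_h u(y)|^q |x - y|^{-N-s}` (`coercivity_le`, `energy_le_err`).
The errors caused by the cutoff all carry a factor `|τ_h u|^m`. Near the diagonal the Lipschitz
cutoff supplies one power of `|x - y|`: this makes the first kernel integrable because `s₁ < 1`, and
the second because `s < p`, once `n` more powers have been spent on difference quotients of `u`. Far
from the diagonal the errors are bounded by the nonlocal tail. Since `u` has a weak gradient in
`L^q`, Young's inequality bounds all errors by a multiple of `|h|^m` (`energy_le`).

The energy is a fractional seminorm of `τ_h u`, so a further increment gains `|k|^s`: the `q`-th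
power of the `L^q` norm of `τ_k τ_h u` is at most a constant times `|k|^s |h|^m`
(`lintegral_increment_le_gagliardo`). For `|k| = |h|` the total exponent is `s + m = q + σ` with `σ
= s - (p - 1)`, and the lower bound on `s_p` says exactly that `σ > 0`. Second differences are
therefore of order `|h|^{1 + σ/q}` in `L^q`. A dyadic telescoping sum turns this into the same bound
for the first order Taylor remainder (`eLpNorm_taylor_le`). Comparing the expansions at `x` and `x +
k` yields increments of `∇u` of order `|k|^{σ/q}` (`eLpNorm_gradient_increment_le`,
`lintegral_weakGradient_increment_le`). Integrating their `q`-th power against `|k|^{-N-αq}`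
converges because `αq < σ` (`gagliardoPow_le_of_increment`).

Pointwise derivatives are only used for mollifications; all bounds are uniform in the mollification
scale and pass to the limit by Fatou's lemma. -/

/-- The signed power `|t|^{m-1} t`. -/
noncomputable def signedPow (m t : ℝ) : ℝ := |t| ^ (m - 1) * t

lemma signedPow_of_nonneg {m t : ℝ} (hm : 0 < m) (ht : 0 ≤ t) : signedPow m t = t ^ m := by
  rcases ht.eq_or_lt with rfl | ht'
  · simp [signedPow, Real.zero_rpow hm.ne']
  · rw [signedPow, abs_of_pos ht', Real.rpow_sub_one ht'.ne', div_mul_cancel₀ _ ht'.ne']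

lemma signedPow_neg (m t : ℝ) : signedPow m (-t) = -signedPow m t := by
  simp [signedPow]

lemma abs_signedPow {m : ℝ} (hm : 0 < m) (t : ℝ) : |signedPow m t| = |t| ^ m := by
  rcases le_total 0 t with h | h
  · rw [signedPow_of_nonneg hm h, abs_of_nonneg h, abs_of_nonneg (by positivity)]
  · have h' : 0 ≤ -t := by linarith
    rw [← neg_neg t, signedPow_neg, abs_neg, signedPow_of_nonneg hm h', abs_neg,
      abs_of_nonneg h', abs_of_nonneg (by positivity)]

lemma measurable_signedPow (m : ℝ) : Measurable (signedPow m) := by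
  unfold signedPow
  fun_prop

lemma rpow_add_le_two_mul {m a b : ℝ} (hm : 1 ≤ m) (ha : 0 ≤ a) (hb : 0 ≤ b) :
    (a + b) ^ m ≤ 2 ^ (m - 1) * (a ^ m + b ^ m) := by
  lift a to NNReal using ha
  lift b to NNReal using hb
  exact_mod_cast NNReal.rpow_add_le_mul_rpow_add_rpow a b hm

/-- For arguments of the same sign, superadditivity of `t ^ m` gives the bound even with constant
`1`. For opposite signs the difference is a sum of two powers, and convexity produces the factor `2
^ (1 - m)`. -/
lemma signedPow_sub_ge {m a b : ℝ} (hm : 1 ≤ m) (hab : b ≤ a) :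
    2 ^ (1 - m) * (a - b) ^ m ≤ signedPow m a - signedPow m b := by
  have hm0 : 0 < m := by linarith
  have h2 : (2 : ℝ) ^ (1 - m) ≤ 1 := Real.rpow_le_one_of_one_le_of_nonpos (by norm_num) (by linarith)
  have hpos : 0 ≤ a - b := by linarith
  have key : ∀ x y : ℝ, 0 ≤ y → y ≤ x → (x - y) ^ m ≤ x ^ m - y ^ m := by
    intro x y hy hxy
    have := Real.add_rpow_le_rpow_add (p := m) (a := x - y) (b := y) (by linarith) hy hm
    simp only [sub_add_cancel] at this
    linarith
  have hle : ∀ {c : ℝ}, (a - b) ^ m ≤ c → 2 ^ (1 - m) * (a - b) ^ m ≤ c := fun hc =>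
    (mul_le_of_le_one_left (by positivity) h2).trans hc
  rcases le_total 0 b with hb | hb
  · rw [signedPow_of_nonneg hm0 hb, signedPow_of_nonneg hm0 (hb.trans hab)]
    exact hle (key a b hb hab)
  · have hb' : 0 ≤ -b := by linarith
    have e : signedPow m b = -(-b) ^ m := by
      rw [← signedPow_of_nonneg hm0 hb', signedPow_neg, neg_neg]
    rcases le_total 0 a with ha | ha
    · rw [signedPow_of_nonneg hm0 ha, e, sub_neg_eq_add, sub_eq_add_neg]
      have := rpow_add_le_two_mul hm ha hb'
      calc 2 ^ (1 - m) * (a + -b) ^ m ≤ 2 ^ (1 - m) * (2 ^ (m - 1) * (a ^ m + (-b) ^ m)) := by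
            gcongr
        _ = a ^ m + (-b) ^ m := by
            rw [← mul_assoc, ← Real.rpow_add (by norm_num)]; simp
    · have ha' : 0 ≤ -a := by linarith
      have e' : signedPow m a = -(-a) ^ m := by
        rw [← signedPow_of_nonneg hm0 ha', signedPow_neg, neg_neg]
      rw [e, e']
      refine hle ?_
      have := key (-b) (-a) ha' (by linarith)
      rw [show -b - -a = a - b by ring] at this
      linarith

lemma signedPow_mono {m : ℝ} (hm : 1 ≤ m) : Monotone (signedPow m) := by
  intro b a hab
  have := signedPow_sub_ge hm hab
  have h0 : 0 ≤ 2 ^ (1 - m) * (a - b) ^ m :=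
    mul_nonneg (by positivity) (Real.rpow_nonneg (by linarith) _)
  linarith

/-- Coercivity of the product of increments of two signed powers with the same increment. -/
lemma signedPow_mul_signedPow_ge {m n a b A B : ℝ} (hm : 1 ≤ m) (hn : 1 ≤ n)
    (h : a - b = A - B) :
    2 ^ (2 - (m + n)) * |A - B| ^ (m + n) ≤
      (signedPow m a - signedPow m b) * (signedPow n A - signedPow n B) := by
  have main : ∀ a b A B : ℝ, a - b = A - B → B ≤ A →
      2 ^ (2 - (m + n)) * |A - B| ^ (m + n) ≤
      (signedPow m a - signedPow m b) * (signedPow n A - signedPow n B) := by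
    intro a b A B h hAB
    have h1 := signedPow_sub_ge hm (a := a) (b := b) (by linarith)
    have h2 := signedPow_sub_ge hn hAB
    have hp : 0 ≤ A - B := by linarith
    rw [h] at h1
    calc 2 ^ (2 - (m + n)) * |A - B| ^ (m + n)
        = (2 ^ (1 - m) * (A - B) ^ m) * (2 ^ (1 - n) * (A - B) ^ n) := by
          rw [abs_of_nonneg hp, Real.rpow_add_of_nonneg hp (by linarith) (by linarith),
            show 2 - (m + n) = (1 - m) + (1 - n) by ring, Real.rpow_add (by norm_num)]
          ring
      _ ≤ _ := mul_le_mul h1 h2 (by positivity) (le_trans (by positivity) h1)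
  rcases le_total B A with hAB | hAB
  · exact main a b A B h hAB
  · have := main b a B A (by linarith) hAB
    rw [abs_sub_comm] at this
    linarith

/-- The mean value theorem covers arguments of the same sign. For opposite signs both `|a|` and
`|b|` are at most `|a - b|`, which costs the factor `2`. The bound lets the test function inherit
the fractional regularity of `u`. -/
lemma abs_signedPow_sub_le {m M a b : ℝ} (hm : 1 ≤ m) (ha : |a| ≤ M) (hb : |b| ≤ M) :
    |signedPow m a - signedPow m b| ≤ 2 * m * M ^ (m - 1) * |a - b| := by
  have hm0 : 0 < m := by linarith
  have hM : 0 ≤ M := (abs_nonneg a).trans ha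
  have hL : 0 ≤ M ^ (m - 1) := by positivity
  -- the nonnegative case, by the mean value theorem
  have key : ∀ x y : ℝ, 0 ≤ y → y ≤ x → x ≤ M → x ^ m - y ^ m ≤ m * M ^ (m - 1) * (x - y) := by
    intro x y hy hxy hxM
    have := Convex.image_sub_le_mul_sub_of_deriv_le (f := fun t : ℝ => t ^ m) (D := Icc 0 M)
      (convex_Icc 0 M) (Real.continuous_rpow_const hm0.le).continuousOn
      (fun t ht => by
        rw [interior_Icc] at ht
        exact ((Real.hasDerivAt_rpow_const (Or.inl ht.1.ne')).differentiableAt).differentiableWithinAt)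
      (C := m * M ^ (m - 1))
      (fun t ht => by
        rw [interior_Icc] at ht
        rw [(Real.hasDerivAt_rpow_const (Or.inl ht.1.ne')).deriv]
        have : t ^ (m - 1) ≤ M ^ (m - 1) :=
          Real.rpow_le_rpow ht.1.le ht.2.le (by linarith)
        gcongr)
      y ⟨hy, hxy.trans hxM⟩ x ⟨hy.trans hxy, hxM⟩ hxy
    simpa using this
  have pos : ∀ x y : ℝ, 0 ≤ x → 0 ≤ y → |x| ≤ M → |y| ≤ M →
      |signedPow m x - signedPow m y| ≤ m * M ^ (m - 1) * |x - y| := by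
    intro x y hx hy hxM hyM
    rw [abs_of_nonneg hx] at hxM
    rw [abs_of_nonneg hy] at hyM
    rw [signedPow_of_nonneg hm0 hx, signedPow_of_nonneg hm0 hy]
    rcases le_total y x with h | h
    · rw [abs_of_nonneg (sub_nonneg.2 (Real.rpow_le_rpow hy h hm0.le)), abs_of_nonneg (by linarith)]
      exact key x y hy h hxM
    · rw [abs_sub_comm, abs_sub_comm x,
        abs_of_nonneg (sub_nonneg.2 (Real.rpow_le_rpow hx h hm0.le)), abs_of_nonneg (by linarith)]
      exact key y x hx h hyM
  have single : ∀ x : ℝ, |x| ≤ M → |signedPow m x| ≤ m * M ^ (m - 1) * |x| := by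
    intro x hx
    rw [abs_signedPow hm0]
    rcases (abs_nonneg x).eq_or_lt with h0 | h0
    · rw [← h0, Real.zero_rpow hm0.ne']; simp
    · have : |x| ^ (m - 1) ≤ M ^ (m - 1) := Real.rpow_le_rpow h0.le hx (by linarith)
      calc |x| ^ m = |x| ^ (m - 1) * |x| := by
            rw [Real.rpow_sub_one h0.ne', div_mul_cancel₀ _ h0.ne']
        _ ≤ (m * M ^ (m - 1)) * |x| := by
            gcongr
            nlinarith
  have hpos' : 0 ≤ m * M ^ (m - 1) * |a - b| := by positivity
  have mixed : ∀ x y : ℝ, |x| ≤ M → |y| ≤ M → |x| ≤ |x - y| → |y| ≤ |x - y| →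
      |signedPow m x - signedPow m y| ≤ 2 * m * M ^ (m - 1) * |x - y| := by
    intro x y hx hy h1 h2
    have hc : 0 ≤ m * M ^ (m - 1) := by positivity
    have := abs_sub (signedPow m x) (signedPow m y)
    nlinarith [single x hx, single y hy, mul_le_mul_of_nonneg_left h1 hc,
      mul_le_mul_of_nonneg_left h2 hc]
  rcases le_total 0 a with h1 | h1 <;> rcases le_total 0 b with h2 | h2
  · linarith [pos a b h1 h2 ha hb]
  · refine mixed a b ha hb ?_ ?_ <;>
    rw [abs_of_nonneg (show 0 ≤ a - b by linarith)]
    · rw [abs_of_nonneg h1]; linarith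
    · rw [abs_of_nonpos h2]; linarith
  · refine mixed a b ha hb ?_ ?_ <;>
    rw [abs_of_nonpos (show a - b ≤ 0 by linarith)]
    · rw [abs_of_nonpos h1]; linarith
    · rw [abs_of_nonneg h2]; linarith
  · have := pos (-a) (-b) (by linarith) (by linarith) (by simpa using ha) (by simpa using hb)
    rw [signedPow_neg, signedPow_neg, show -signedPow m a - -signedPow m b =
      -(signedPow m a - signedPow m b) by ring, abs_neg, show -a - -b = -(a - b) by ring,
      abs_neg] at this
    linarith

/-- A crude form of Young's inequality. -/
lemma rpow_mul_rpow_le_add {X Y m n : ℝ} (hX : 0 ≤ X) (hY : 0 ≤ Y) (hm : 0 ≤ m) (hn : 0 ≤ n) :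
    X ^ m * Y ^ n ≤ X ^ (m + n) + Y ^ (m + n) := by
  have hXp : 0 ≤ X ^ (m + n) := by positivity
  have hYp : 0 ≤ Y ^ (m + n) := by positivity
  rcases le_total X Y with h | h
  · calc X ^ m * Y ^ n ≤ Y ^ m * Y ^ n := by gcongr
      _ = Y ^ (m + n) := (Real.rpow_add_of_nonneg hY hm hn).symm
      _ ≤ _ := by linarith
  · calc X ^ m * Y ^ n ≤ X ^ m * X ^ n := by gcongr
      _ = X ^ (m + n) := (Real.rpow_add_of_nonneg hX hm hn).symm
      _ ≤ _ := by linarith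

lemma abs_sub_rpow_le {m a b : ℝ} (hm : 1 ≤ m) :
    |a - b| ^ m ≤ 2 ^ (m - 1) * (|a| ^ m + |b| ^ m) :=
  (Real.rpow_le_rpow (abs_nonneg _) (abs_sub a b) (by linarith)).trans
    (rpow_add_le_two_mul hm (abs_nonneg _) (abs_nonneg _))

/-! ### The kernels -/

/-- The kernel `|z|^{-N-s}`, with value `0` at the origin. -/
noncomputable def kern {N : ℕ} (s : ℝ) (z : E N) : ℝ := ‖z‖ ^ (-((N : ℝ) + s))

lemma kern_nonneg {N : ℕ} (s : ℝ) (z : E N) : 0 ≤ kern s z := by unfold kern; positivity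

lemma kern_neg {N : ℕ} (s : ℝ) (z : E N) : kern s (-z) = kern s z := by simp [kern]

lemma kern_sub_comm {N : ℕ} (s : ℝ) (x y : E N) : kern s (x - y) = kern s (y - x) := by
  rw [← kern_neg, neg_sub]

@[fun_prop]
lemma measurable_kern {N : ℕ} (s : ℝ) : Measurable (kern (N := N) s) := by
  unfold kern
  fun_prop

lemma rpow_mul_kern {N : ℕ} (s κ : ℝ) {z : E N} (hz : z ≠ 0) :
    ‖z‖ ^ κ * kern s z = kern (s - κ) z := by
  unfold kern
  rw [← Real.rpow_add (norm_pos_iff.2 hz)]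
  congr 1; ring

/-- `∫_{B_2} |z|^{κ - N} dz`. -/
noncomputable def nearConst (N : ℕ) (κ : ℝ) : ℝ≥0∞ :=
  ∫⁻ z in ball (0 : E N) 2, ENNReal.ofReal (kern (-κ) z)

/-- Polar coordinates reduce the integral to that of `t ^ (κ - 1)` over `(0, 2)`. -/
lemma nearConst_ne_top {N : ℕ} (hN : 1 ≤ N) {κ : ℝ} (hκ : 0 < κ) : nearConst N κ ≠ ∞ := by
  have : Nonempty (Fin N) := ⟨⟨0, hN⟩⟩
  have h : IntegrableOn (fun z : E N => ‖z‖ ^ (-((N : ℝ) + -κ))) (ball 0 2) := by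
    rw [integrableOn_fun_norm_addHaar (μ := (volume : Measure (E N)))
      (f := fun t : ℝ => t ^ (-((N : ℝ) + -κ)))]
    have h1 : IntegrableOn (fun t : ℝ => t ^ (κ - 1)) (Ioo 0 2) := by
      have := intervalIntegral.intervalIntegrable_rpow' (a := 0) (b := 2) (r := κ - 1) (by linarith)
      rw [intervalIntegrable_iff_integrableOn_Ioo_of_le (by norm_num)] at this
      exact this
    refine h1.congr_fun (fun t ht => ?_) measurableSet_Ioo
    have ht0 : 0 < t := ht.1
    simp only [finrank_euclideanSpace, Fintype.card_fin, smul_eq_mul]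
    rw [← Real.rpow_natCast, ← Real.rpow_add ht0]
    congr 1
    push_cast [Nat.cast_sub hN]
    ring
  have h2 := h.lintegral_lt_top
  exact h2.ne

/-- `∫ (1+|z|)^{-N-s} dz`. -/
noncomputable def farConst (N : ℕ) (s : ℝ) : ℝ≥0∞ :=
  ∫⁻ z : E N, ENNReal.ofReal ((1 + ‖z‖) ^ (-((N : ℝ) + s)))

lemma farConst_ne_top {N : ℕ} {s : ℝ} (hs : 0 < s) : farConst N s ≠ ∞ := by
  have := finite_integral_one_add_norm (E := E N) (μ := volume) (r := (N : ℝ) + s)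
    (by simp [hs])
  exact this.ne

/-- If `|z| ≥ δ` and `δ ≤ 1`, then `(δ / 2) (1 + |z|) ≤ |z|`, so the kernel is dominated by an
integrable power of `1 + |z|`. -/
lemma lintegral_kern_far_le {N : ℕ} {s δ : ℝ} (hs : 0 < s) (hδ : 0 < δ) (hδ1 : δ ≤ 1) :
    ∫⁻ z in {z : E N | δ ≤ ‖z‖}, ENNReal.ofReal (kern s z) ≤
      ENNReal.ofReal ((δ / 2) ^ (-((N : ℝ) + s))) * farConst N s := by
  rw [farConst, ← lintegral_const_mul' _ _ ENNReal.ofReal_ne_top]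
  refine (setLIntegral_mono' (measurableSet_le measurable_const measurable_norm) ?_).trans
    (setLIntegral_le_lintegral _ _)
  intro z hz
  have hz' : δ ≤ ‖z‖ := hz
  rw [← ENNReal.ofReal_mul (by positivity), ← Real.mul_rpow (by positivity) (by positivity)]
  apply ENNReal.ofReal_le_ofReal
  unfold kern
  apply Real.rpow_le_rpow_of_nonpos (by positivity)
  · nlinarith [norm_nonneg z]
  · have : (0 : ℝ) ≤ N := Nat.cast_nonneg N
    linarith

/-! ### Mollification -/

/-- Jensen's inequality, read off from the monotonicity of `L^q` norms in the exponent on a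
probability space. -/
lemma rpow_lintegral_le {X : Type*} [MeasurableSpace X] {ν : Measure X} [IsProbabilityMeasure ν]
    {f : X → ℝ≥0∞} (hf : AEMeasurable f ν) {q : ℝ} (hq : 1 ≤ q) :
    (∫⁻ x, f x ∂ν) ^ q ≤ ∫⁻ x, f x ^ q ∂ν := by
  have h := ENNReal.rpow_le_rpow
    (eLpNorm'_le_eLpNorm'_of_exponent_le one_pos hq ν hf.aestronglyMeasurable)
    (show 0 ≤ q by linarith)
  simpa [eLpNorm', ← ENNReal.rpow_mul, inv_mul_cancel₀ (show q ≠ 0 by linarith)] using h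

lemma setLIntegral_comp_add_right_le {N : ℕ} {S S' : Set (E N)} (hS : MeasurableSet S)
    (hS' : MeasurableSet S') {k : E N} (h : ∀ x ∈ S, x + k ∈ S') (f : E N → ℝ≥0∞) :
    ∫⁻ x in S, f (x + k) ≤ ∫⁻ x in S', f x := by
  rw [← lintegral_indicator hS, ← lintegral_indicator hS',
    ← lintegral_add_right_eq_self (S'.indicator f) k]
  refine lintegral_mono fun x => ?_
  by_cases hx : x ∈ S
  · simp [hx, h x hx]
  · simp [hx]

lemma aestronglyMeasurable_comp_const_sub {N : ℕ} {F : Type*} [TopologicalSpace F] {f : E N → F}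
    (hf : AEStronglyMeasurable f) (x : E N) : AEStronglyMeasurable (fun t => f (x - t)) :=
  hf.comp_quasiMeasurePreserving (quasiMeasurePreserving_sub_left volume x)

section Moll

variable {N : ℕ} {F : Type*} [NormedAddCommGroup F] [NormedSpace ℝ F]

/-- Mollification by a normalized smooth bump function. -/
noncomputable def moll (φ : ContDiffBump (0 : E N)) (f : E N → F) (x : E N) : F :=
  ∫ t, φ.normed volume t • f (x - t)

lemma moll_eq_convolution (φ : ContDiffBump (0 : E N)) (f : E N → F) :
    moll φ f = (φ.normed volume ⋆[ContinuousLinearMap.lsmul ℝ ℝ, volume] f) := rfl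

lemma lintegral_normed (φ : ContDiffBump (0 : E N)) :
    ∫⁻ t, ENNReal.ofReal (φ.normed volume t) = 1 := by
  rw [← ofReal_integral_eq_lintegral_ofReal φ.integrable_normed
    (Eventually.of_forall fun _ => φ.nonneg_normed _), φ.integral_normed, ENNReal.ofReal_one]

lemma measurable_normed (φ : ContDiffBump (0 : E N)) :
    Measurable fun t => ENNReal.ofReal (φ.normed volume t) :=
  (φ.continuous_normed (μ := volume)).measurable.ennreal_ofReal

/-- Jensen's inequality for the probability measure whose density is the normalized bump. -/
lemma enorm_moll_rpow_le (φ : ContDiffBump (0 : E N)) {f : E N → F}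
    (hf : AEStronglyMeasurable f) {q : ℝ} (hq : 1 ≤ q) (x : E N) :
    ‖moll φ f x‖ₑ ^ q ≤ ∫⁻ t, ENNReal.ofReal (φ.normed volume t) * ‖f (x - t)‖ₑ ^ q := by
  set ν : Measure (E N) := volume.withDensity fun t => ENNReal.ofReal (φ.normed volume t) with hν
  have : IsProbabilityMeasure ν := ⟨by
    rw [hν, withDensity_apply _ MeasurableSet.univ, Measure.restrict_univ, lintegral_normed]⟩
  have hm := measurable_normed φ
  have hlt : ∀ᵐ t : E N, ENNReal.ofReal (φ.normed volume t) < ∞ :=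
    Eventually.of_forall fun _ => ENNReal.ofReal_lt_top
  have hf' := aestronglyMeasurable_comp_const_sub hf x
  calc ‖moll φ f x‖ₑ ^ q ≤ (∫⁻ t, ‖φ.normed volume t • f (x - t)‖ₑ) ^ q := by
        gcongr; exact enorm_integral_le_lintegral_enorm _
    _ = (∫⁻ t, ‖f (x - t)‖ₑ ∂ν) ^ q := by
        rw [hν, lintegral_withDensity_eq_lintegral_mul_non_measurable _ hm hlt]
        simp only [enorm_smul, Pi.mul_apply, Real.enorm_of_nonneg (φ.nonneg_normed _)]
    _ ≤ ∫⁻ t, ‖f (x - t)‖ₑ ^ q ∂ν :=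
        rpow_lintegral_le (hf'.enorm.mono_ac (withDensity_absolutelyContinuous _ _)) hq
    _ = _ := by
        rw [hν, lintegral_withDensity_eq_lintegral_mul_non_measurable _ hm hlt]
        rfl

/-- By Jensen and Tonelli the left side is at most an average of integrals over translates of `S` by
vectors shorter than the outer radius, and each of these translates lies in `S'`. -/
lemma lintegral_moll_rpow_le (φ : ContDiffBump (0 : E N)) {f : E N → F}
    (hf : AEStronglyMeasurable f) {q : ℝ} (hq : 1 ≤ q) {S S' : Set (E N)}
    (hS : MeasurableSet S) (hS' : MeasurableSet S')
    (h : ∀ x ∈ S, ∀ t, ‖t‖ < φ.rOut → x - t ∈ S') :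
    ∫⁻ x in S, ‖moll φ f x‖ₑ ^ q ≤ ∫⁻ x in S', ‖f x‖ₑ ^ q := by
  have hm := measurable_normed φ
  calc ∫⁻ x in S, ‖moll φ f x‖ₑ ^ q
      ≤ ∫⁻ x in S, ∫⁻ t, ENNReal.ofReal (φ.normed volume t) * ‖f (x - t)‖ₑ ^ q :=
        lintegral_mono fun x => enorm_moll_rpow_le φ hf hq x
    _ = ∫⁻ t, ∫⁻ x in S, ENNReal.ofReal (φ.normed volume t) * ‖f (x - t)‖ₑ ^ q := by
        apply lintegral_lintegral_swap
        have h1 : AEStronglyMeasurable (fun z : E N × E N => f (z.1 - z.2))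
            ((volume.restrict S).prod volume) :=
          (hf.comp_quasiMeasurePreserving (quasiMeasurePreserving_sub volume volume)).mono_ac
            (Measure.AbsolutelyContinuous.prod Measure.restrict_le_self.absolutelyContinuous
              Measure.AbsolutelyContinuous.rfl)
        exact (hm.comp measurable_snd).aemeasurable.mul (h1.enorm.pow_const q)
    _ ≤ ∫⁻ t, ENNReal.ofReal (φ.normed volume t) * ∫⁻ x in S', ‖f x‖ₑ ^ q := by
        apply lintegral_mono
        intro t
        dsimp only
        rw [lintegral_const_mul' _ _ ENNReal.ofReal_ne_top]
        rcases lt_or_ge ‖t‖ φ.rOut with ht | ht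
        · gcongr ENNReal.ofReal _ * ?_
          simp_rw [sub_eq_add_neg]
          exact setLIntegral_comp_add_right_le hS hS' (fun x hx => by
            simpa [sub_eq_add_neg] using h x hx t ht) (fun x => ‖f x‖ₑ ^ q)
        · have : φ.normed volume t = 0 := by
            rw [← Function.notMem_support, φ.support_normed_eq]
            simpa using ht
          simp [this]
    _ = _ := by
        rw [lintegral_mul_const _ hm, lintegral_normed, one_mul]

/-- Lebesgue differentiation for an approximate identity; it needs the inner and outer radii to stay
comparable, hence the fixed ratio `2`. -/
lemma tendsto_moll (φ : ℕ → ContDiffBump (0 : E N)) (hφ : Tendsto (fun n => (φ n).rOut) atTop (𝓝 0))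
    (hφ' : ∀ n, (φ n).rOut = 2 * (φ n).rIn) {f : E N → F} [CompleteSpace F]
    (hf : LocallyIntegrable f) :
    ∀ᵐ x, Tendsto (fun n => moll (φ n) f x) atTop (𝓝 (f x)) :=
  ContDiffBump.ae_convolution_tendsto_right_of_locallyIntegrable (K := 2) hφ
    (Eventually.of_forall fun n => (hφ' n).le) hf

lemma integrable_normed_smul (φ : ContDiffBump (0 : E N)) {f : E N → F}
    (hf : LocallyIntegrable f) (x : E N) :
    Integrable fun t => φ.normed volume t • f (x - t) :=
  φ.hasCompactSupport_normed.convolutionExists_left (ContinuousLinearMap.lsmul ℝ ℝ)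
    φ.continuous_normed hf x

lemma continuous_moll (φ : ContDiffBump (0 : E N)) {f : E N → F}
    (hf : LocallyIntegrable f) : Continuous (moll φ f) := by
  rw [moll_eq_convolution]
  exact φ.hasCompactSupport_normed.continuous_convolution_left _ φ.continuous_normed hf

end Moll

/-! ### Weak gradients and translation estimates -/

section Gradient

variable {N : ℕ}

/-- The gradient of a mollification is the mollification of the weak gradient. -/
lemma hasFDerivAt_moll {Ω : Set (E N)} {u : E N → ℝ} {G : E N → E N} (hu : LocallyIntegrable u)
    (hG : IsWeakGradient Ω u G) {K : Set (E N)} (hK : IsCompact K) (hKΩ : K ⊆ Ω)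
    (φ : ContDiffBump (0 : E N)) {x : E N} (hx : closedBall x φ.rOut ⊆ K) :
    HasFDerivAt (moll φ u) (innerSL ℝ (moll φ (K.indicator G) x)) x := by
  have hGK : Integrable (K.indicator G) :=
    (hG.2.1.integrableOn_compact_subset hKΩ hK).integrable_indicator hK.measurableSet
  have hρ : ContDiff ℝ (⊤ : ℕ∞) (φ.normed volume) := φ.contDiff_normed
  have h1 := φ.hasCompactSupport_normed.hasFDerivAt_convolution_left (μ := volume)
    (ContinuousLinearMap.lsmul ℝ ℝ) (hρ.of_le (by norm_cast)) hu x
  rw [← moll_eq_convolution] at h1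
  refine h1.congr_fderiv (ContinuousLinearMap.ext fun v => ?_)
  -- The reflected bump centred at `x` is smooth and supported in `K`, so it may be used as a test
  -- function; the definition of the weak gradient then moves the derivative from the bump to `u`.
  set ψ : E N → ℝ := fun y => φ.normed volume (x - y) with hψ
  have hψs : ContDiff ℝ (⊤ : ℕ∞) ψ := hρ.comp (contDiff_const.sub contDiff_id)
  have hsupp : Function.support ψ ⊆ closedBall x φ.rOut := by
    intro y hy
    have : x - y ∈ Function.support (φ.normed volume) := hy
    rw [φ.support_normed_eq] at this
    rw [mem_closedBall, dist_comm, dist_eq_norm]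
    simpa using (mem_ball_zero_iff.1 this).le
  have htsupp : tsupport ψ ⊆ closedBall x φ.rOut := closure_minimal hsupp isClosed_closedBall
  have hcs : HasCompactSupport ψ :=
    (isCompact_closedBall x φ.rOut).of_isClosed_subset (isClosed_tsupport _) htsupp
  have key := hG.2.2 ψ hψs hcs (htsupp.trans (hx.trans hKΩ)) v
  have hder : ∀ y, fderiv ℝ ψ y v = -fderiv ℝ (φ.normed volume) (x - y) v := by
    intro y
    have hd : HasFDerivAt ψ ((fderiv ℝ (φ.normed volume) (x - y)).comp
        (-ContinuousLinearMap.id ℝ (E N))) y :=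
      ((hρ.differentiable (by simp)) (x - y)).hasFDerivAt.comp y
        ((hasFDerivAt_id y).const_sub x)
    rw [hd.fderiv]
    simp
  have hconv : ConvolutionExistsAt (fderiv ℝ (φ.normed volume)) u x
      ((ContinuousLinearMap.lsmul ℝ ℝ).precompL (E N)) volume :=
    (φ.hasCompactSupport_normed.fderiv ℝ).convolutionExists_left _
      (hρ.continuous_fderiv (by simp)) hu x
  have e1 : ((fderiv ℝ (φ.normed volume) ⋆[(ContinuousLinearMap.lsmul ℝ ℝ).precompL (E N),
      volume] u) x) v = -∫ y, u y * fderiv ℝ ψ y v := by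
    rw [convolution_def, ContinuousLinearMap.integral_apply hconv,
      ← integral_sub_left_eq_self _ volume x, ← integral_neg]
    congr 1 with y
    rw [hder]
    simp [ContinuousLinearMap.precompL_apply, mul_comm]
  refine e1.trans ?_
  rw [key, neg_neg]
  -- Restricting `G` to `K` changes nothing here because `ψ` vanishes off `K`; it only makes the
  -- field globally integrable.
  have e2 : moll φ (K.indicator G) x = ∫ y, ψ y • G y := by
    rw [moll, ← integral_sub_left_eq_self _ volume x]
    congr 1 with y
    simp only [sub_sub_cancel, hψ]
    by_cases hy : y ∈ K
    · rw [indicator_of_mem hy]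
    · have : φ.normed volume (x - y) = 0 := by
        by_contra hne
        exact hy (hx (hsupp hne))
      rw [this, zero_smul, zero_smul]
  have hint : Integrable fun y => ψ y • G y := by
    have := (integrable_normed_smul φ hGK.locallyIntegrable x).comp_sub_left x
    refine this.congr (Eventually.of_forall fun y => ?_)
    simp only [sub_sub_cancel, hψ]
    by_cases hy : y ∈ K
    · rw [indicator_of_mem hy]
    · have : φ.normed volume (x - y) = 0 := by
        by_contra hne
        exact hy (hx (hsupp hne))
      rw [this, zero_smul, zero_smul]
  rw [e2, innerSL_apply_apply, ← real_inner_comm, ← integral_inner hint]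
  congr 1 with y
  rw [real_inner_smul_right, real_inner_comm, mul_comm]

/-- The translation estimate for a differentiable function. -/
lemma lintegral_translate_le_of_hasFDerivAt {U : E N → ℝ} {H : E N → E N} (hH : Continuous H)
    {B : Set (E N)} (hB : MeasurableSet B) (hconv : Convex ℝ B)
    (hU : ∀ x ∈ B, HasFDerivAt U (innerSL ℝ (H x)) x) {q : ℝ} (hq : 1 ≤ q) (k : E N) :
    ∫⁻ x in B ∩ {x | x + k ∈ B}, ‖U (x + k) - U x‖ₑ ^ q ≤
      ‖k‖ₑ ^ q * ∫⁻ x in B, ‖H x‖ₑ ^ q := by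
  have hS : MeasurableSet (B ∩ {x | x + k ∈ B}) := hB.inter (measurable_add_const k hB)
  have hmem : ∀ x ∈ B ∩ {x | x + k ∈ B}, ∀ t ∈ Icc (0 : ℝ) 1, x + t • k ∈ B := by
    intro x hx t ht
    have := hconv.add_smul_sub_mem hx.1 hx.2 ht
    simpa using this
  have hprob : IsProbabilityMeasure (volume.restrict (Ioc (0 : ℝ) 1)) := ⟨by simp⟩
  have hpt : ∀ x ∈ B ∩ {x | x + k ∈ B}, ‖U (x + k) - U x‖ₑ ^ q ≤
      ‖k‖ₑ ^ q * ∫⁻ t in Ioc (0 : ℝ) 1, ‖H (x + t • k)‖ₑ ^ q := by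
    intro x hx
    have hd : ∀ t ∈ uIcc (0 : ℝ) 1, HasDerivAt (fun t : ℝ => U (x + t • k))
        (inner ℝ (H (x + t • k)) k) t := by
      intro t ht
      rw [uIcc_of_le zero_le_one] at ht
      have h1 : HasDerivAt (fun t : ℝ => x + t • k) k t := by
        simpa using ((hasDerivAt_id t).smul_const k).const_add x
      have h2 := (hU _ (hmem x hx t ht)).comp_hasDerivAt t h1
      rw [innerSL_apply_apply] at h2
      exact h2
    have hc : Continuous fun t : ℝ => inner ℝ (H (x + t • k)) k := by fun_prop
    have hint := intervalIntegral.integral_eq_sub_of_hasDerivAt hd (hc.intervalIntegrable _ _)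
    simp only [one_smul, zero_smul, add_zero] at hint
    rw [← hint, intervalIntegral.integral_of_le zero_le_one]
    have hHm : AEMeasurable (fun t : ℝ => ‖H (x + t • k)‖ₑ) (volume.restrict (Ioc (0 : ℝ) 1)) := by
      have : Continuous fun t : ℝ => H (x + t • k) := by fun_prop
      exact this.enorm.measurable.aemeasurable
    calc ‖∫ t in Ioc (0 : ℝ) 1, inner ℝ (H (x + t • k)) k‖ₑ ^ q
        ≤ (∫⁻ t in Ioc (0 : ℝ) 1, ‖k‖ₑ * ‖H (x + t • k)‖ₑ) ^ q := by
          gcongr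
          refine (enorm_integral_le_lintegral_enorm _).trans (lintegral_mono fun t => ?_)
          rw [mul_comm, ← enorm_norm k, ← enorm_norm (H _), ← enorm_mul]
          simp only [← ofReal_norm]
          apply ENNReal.ofReal_le_ofReal
          simpa using abs_real_inner_le_norm (H (x + t • k)) k
      _ = ‖k‖ₑ ^ q * (∫⁻ t in Ioc (0 : ℝ) 1, ‖H (x + t • k)‖ₑ) ^ q := by
          rw [lintegral_const_mul' _ _ enorm_ne_top, ENNReal.mul_rpow_of_nonneg _ _ (by linarith)]
      _ ≤ _ := by
          gcongr
          exact rpow_lintegral_le hHm hq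
  calc ∫⁻ x in B ∩ {x | x + k ∈ B}, ‖U (x + k) - U x‖ₑ ^ q
      ≤ ∫⁻ x in B ∩ {x | x + k ∈ B}, ‖k‖ₑ ^ q *
          ∫⁻ t in Ioc (0 : ℝ) 1, ‖H (x + t • k)‖ₑ ^ q := setLIntegral_mono' hS hpt
    _ = ‖k‖ₑ ^ q * ∫⁻ t in Ioc (0 : ℝ) 1, ∫⁻ x in B ∩ {x | x + k ∈ B},
          ‖H (x + t • k)‖ₑ ^ q := by
        rw [lintegral_const_mul' _ _ (ENNReal.rpow_ne_top_of_nonneg (by linarith) enorm_ne_top),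
          lintegral_lintegral_swap]
        have : Continuous fun z : E N × ℝ => H (z.1 + z.2 • k) := by fun_prop
        exact (this.enorm.measurable.pow_const q).aemeasurable
    _ ≤ ‖k‖ₑ ^ q * ∫⁻ t in Ioc (0 : ℝ) 1, ∫⁻ x in B, ‖H x‖ₑ ^ q := by
        gcongr ‖k‖ₑ ^ q * ?_
        refine setLIntegral_mono' measurableSet_Ioc fun t ht => ?_
        exact setLIntegral_comp_add_right_le hS hB
          (fun x hx => hmem x hx t ⟨ht.1.le, ht.2⟩) (fun x => ‖H x‖ₑ ^ q)
    _ = _ := by simp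

/-- A sequence of bump functions shrinking to the origin. -/
noncomputable def bumpSeq (N : ℕ) (ε : ℝ) (hε : 0 < ε) (n : ℕ) : ContDiffBump (0 : E N) where
  rIn := ε / (2 * (n + 1))
  rOut := ε / (n + 1)
  rIn_pos := by positivity
  rIn_lt_rOut := by
    apply div_lt_div_of_pos_left hε (by positivity)
    linarith [Nat.cast_nonneg (α := ℝ) n]

lemma bumpSeq_rOut_le {ε : ℝ} (hε : 0 < ε) (n : ℕ) : (bumpSeq N ε hε n).rOut ≤ ε :=
  div_le_self hε.le (by linarith [Nat.cast_nonneg (α := ℝ) n])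

lemma tendsto_moll_bumpSeq {F : Type*} [NormedAddCommGroup F] [NormedSpace ℝ F] [CompleteSpace F]
    {ε : ℝ} (hε : 0 < ε) {f : E N → F} (hf : LocallyIntegrable f) :
    ∀ᵐ x, Tendsto (fun n => moll (bumpSeq N ε hε n) f x) atTop (𝓝 (f x)) := by
  apply tendsto_moll _ _ _ hf
  · have := tendsto_one_div_add_atTop_nhds_zero_nat.const_mul ε
    simp only [mul_zero] at this
    refine this.congr fun n => ?_
    simp [bumpSeq, div_eq_mul_inv]
  · intro n
    simp only [bumpSeq]
    field_simp

/-- The translation estimate for a function with a weak gradient. -/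
lemma lintegral_translate_le {Ω : Set (E N)} {u : E N → ℝ} {G : E N → E N}
    (hu : LocallyIntegrable u) (hG : IsWeakGradient Ω u G) {x₀ : E N} {ρ R : ℝ} (hρ : ρ < R)
    (hR : closedBall x₀ R ⊆ Ω) {q : ℝ} (hq : 1 ≤ q) (k : E N) :
    ∫⁻ x in ball x₀ ρ ∩ {x | x + k ∈ ball x₀ ρ}, ‖u (x + k) - u x‖ₑ ^ q ≤
      ‖k‖ₑ ^ q * ∫⁻ x in ball x₀ R, ‖G x‖ₑ ^ q := by
  have hε : 0 < R - ρ := by linarith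
  set K := closedBall x₀ R
  have hK : IsCompact K := isCompact_closedBall x₀ R
  have hGK : LocallyIntegrable (K.indicator G) :=
    ((hG.2.1.integrableOn_compact_subset hR hK).integrable_indicator
      hK.measurableSet).locallyIntegrable
  set φ := bumpSeq N (R - ρ) hε
  have hφ : ∀ n, (φ n).rOut ≤ R - ρ := bumpSeq_rOut_le hε
  have hn : ∀ n, ∫⁻ x in ball x₀ ρ ∩ {x | x + k ∈ ball x₀ ρ},
      ‖moll (φ n) u (x + k) - moll (φ n) u x‖ₑ ^ q ≤
      ‖k‖ₑ ^ q * ∫⁻ x in ball x₀ R, ‖G x‖ₑ ^ q := by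
    intro n
    refine (lintegral_translate_le_of_hasFDerivAt (continuous_moll (φ n) hGK) measurableSet_ball
      (convex_ball x₀ ρ) (fun x hx => hasFDerivAt_moll hu hG hK hR (φ n) ?_) hq k).trans ?_
    · apply closedBall_subset_closedBall'
      linarith [hφ n, mem_ball.1 hx]
    · gcongr ‖k‖ₑ ^ q * ?_
      refine (lintegral_moll_rpow_le (φ n) hGK.aestronglyMeasurable hq measurableSet_ball
        (measurableSet_ball (x := x₀) (ε := R)) ?_).trans_eq ?_
      · intro x hx t ht
        rw [mem_ball, dist_eq_norm] at hx ⊢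
        calc ‖x - t - x₀‖ = ‖(x - x₀) - t‖ := by congr 1; abel
          _ ≤ ‖x - x₀‖ + ‖t‖ := norm_sub_le _ _
          _ < R := by linarith [hφ n]
      · refine setLIntegral_congr_fun measurableSet_ball fun x hx => ?_
        rw [indicator_of_mem (ball_subset_closedBall hx)]
  have hlim := tendsto_moll_bumpSeq hε hu
  have hlimk : ∀ᵐ x, Tendsto (fun n => moll (φ n) u (x + k)) atTop (𝓝 (u (x + k))) :=
    (measurePreserving_add_right volume k).quasiMeasurePreserving.ae hlim
  -- Fatou's lemma along the mollifications, which converge almost everywhere at `x` and at `x + k`.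
  calc ∫⁻ x in ball x₀ ρ ∩ {x | x + k ∈ ball x₀ ρ}, ‖u (x + k) - u x‖ₑ ^ q
      ≤ ∫⁻ x in ball x₀ ρ ∩ {x | x + k ∈ ball x₀ ρ},
        liminf (fun n => ‖moll (φ n) u (x + k) - moll (φ n) u x‖ₑ ^ q) atTop := by
        apply lintegral_mono_ae
        filter_upwards [ae_restrict_of_ae hlim, ae_restrict_of_ae hlimk] with x h1 h2
        exact ((h2.sub h1).enorm.ennrpow_const q).liminf_eq.ge
    _ ≤ liminf (fun n => ∫⁻ x in ball x₀ ρ ∩ {x | x + k ∈ ball x₀ ρ},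
          ‖moll (φ n) u (x + k) - moll (φ n) u x‖ₑ ^ q) atTop := by
        apply lintegral_liminf_le
        intro n
        have := continuous_moll (φ n) hu
        have h3 : Continuous fun x => moll (φ n) u (x + k) - moll (φ n) u x := by fun_prop
        exact h3.enorm.measurable.pow_const q
    _ ≤ _ := (liminf_le_liminf (Eventually.of_forall hn)).trans_eq (liminf_const _)

end Gradient

/-! ### Double integrals -/

section Double

variable {N : ℕ}

/-- Tonelli: by invariance under `y ↦ x - y`, the inner integral does not depend on `x`. -/
lemma lintegral_mul_comp_sub_le (f : E N → ℝ≥0∞) {c : E N → ℝ≥0∞} (hc : Measurable c)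
    (hc' : ∫⁻ z, c z ≠ ∞) :
    ∫⁻ z : E N × E N, f z.1 * c (z.1 - z.2) ≤ (∫⁻ x, f x) * ∫⁻ z, c z := by
  rw [Measure.volume_eq_prod]
  refine (lintegral_prod_le _).trans ?_
  rw [← lintegral_mul_const' _ _ hc']
  refine lintegral_mono fun x => ?_
  simp only
  rw [lintegral_const_mul _ (by fun_prop), lintegral_sub_left_eq_self c x]

/-- Two points of a ball of radius at most `1` differ by a vector of length less than `2`, which is
why `nearConst` integrates over the ball of radius `2`. -/
lemma setLIntegral_prod_mul_kern_near_le (hN : 1 ≤ N) {κ : ℝ} (hκ : 0 < κ) {x₀ : E N} {ρ : ℝ}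
    (hρ : ρ ≤ 1) (f : E N → ℝ≥0∞) :
    ∫⁻ z in ball x₀ ρ ×ˢ ball x₀ ρ, f z.1 * ENNReal.ofReal (kern (-κ) (z.1 - z.2)) ≤
      nearConst N κ * ∫⁻ x in ball x₀ ρ, f x := by
  have hB : MeasurableSet (ball x₀ ρ) := measurableSet_ball
  have hB2 : MeasurableSet (ball (0 : E N) 2) := measurableSet_ball
  have hc : ∫⁻ z, (ball (0 : E N) 2).indicator (fun z => ENNReal.ofReal (kern (-κ) z)) z =
      nearConst N κ := lintegral_indicator hB2 _
  rw [← lintegral_indicator (hB.prod hB), mul_comm, ← lintegral_indicator hB, ← hc]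
  refine (lintegral_mono fun z => ?_).trans (lintegral_mul_comp_sub_le
    ((ball x₀ ρ).indicator f)
    ((measurable_kern (-κ)).ennreal_ofReal.indicator hB2)
    (hc ▸ nearConst_ne_top hN hκ))
  by_cases hz : z ∈ ball x₀ ρ ×ˢ ball x₀ ρ
  · have h2 : z.1 - z.2 ∈ ball (0 : E N) 2 := by
      rw [mem_ball_zero_iff, ← dist_eq_norm]
      have := dist_triangle_right z.1 z.2 x₀
      linarith [mem_ball.1 hz.1, mem_ball.1 hz.2]
    rw [indicator_of_mem hz, indicator_of_mem hz.1, indicator_of_mem h2]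
  · rw [indicator_of_notMem hz]; exact zero_le

lemma measurableSet_far (δ : ℝ) : MeasurableSet {z : E N × E N | δ ≤ ‖z.1 - z.2‖} :=
  measurableSet_le measurable_const (by fun_prop)

lemma setLIntegral_mul_kern_far_le {s δ : ℝ} (hs : 0 < s) (hδ : 0 < δ) (hδ1 : δ ≤ 1)
    (f : E N → ℝ≥0∞) :
    ∫⁻ z in {z : E N × E N | δ ≤ ‖z.1 - z.2‖},
        f z.1 * ENNReal.ofReal (kern s (z.1 - z.2)) ≤
      ENNReal.ofReal ((δ / 2) ^ (-((N : ℝ) + s))) * farConst N s * ∫⁻ x, f x := by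
  have hm : MeasurableSet {z : E N | δ ≤ ‖z‖} := measurableSet_le measurable_const measurable_norm
  have hc := lintegral_kern_far_le (N := N) hs hδ hδ1
  rw [← lintegral_indicator hm] at hc
  have hc' := hc.trans_lt (ENNReal.mul_lt_top ENNReal.ofReal_lt_top
    (farConst_ne_top (N := N) hs).lt_top)
  rw [← lintegral_indicator (measurableSet_far δ), mul_comm]
  refine (lintegral_mono fun z => ?_).trans ((lintegral_mul_comp_sub_le f
    ((measurable_kern s).ennreal_ofReal.indicator hm) hc'.ne).trans (by gcongr))
  by_cases hz : δ ≤ ‖z.1 - z.2‖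
  · rw [indicator_of_mem (by exact hz), indicator_of_mem (by exact hz)]
  · rw [indicator_of_notMem (by exact hz)]; exact zero_le

/-- Integration over pairs of points in terms of their difference. -/
lemma lintegral_prod_eq_lintegral_translate {f : E N × E N → ℝ≥0∞} (hf : AEMeasurable f) :
    ∫⁻ z, f z = ∫⁻ k, ∫⁻ x, f (x, x + k) := by
  have hmp : MeasurePreserving (fun z : E N × E N => (z.1, z.1 + z.2)) volume volume :=
    measurePreserving_prod_add volume volume
  have hemb : MeasurableEmbedding (fun z : E N × E N => (z.1, z.1 + z.2)) :=
    (MeasurableEquiv.shearAddRight (E N)).measurableEmbedding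
  rw [← hmp.lintegral_comp_emb hemb, Measure.volume_eq_prod]
  exact lintegral_prod_symm _ (hf.comp_quasiMeasurePreserving hmp.quasiMeasurePreserving)

lemma setLIntegral_prod_eq_lintegral_translate {B : Set (E N)} (hB : MeasurableSet B)
    {f : E N × E N → ℝ≥0∞} (hf : AEMeasurable f (volume.restrict (B ×ˢ B))) :
    ∫⁻ z in B ×ˢ B, f z = ∫⁻ k, ∫⁻ x in B ∩ {x | x + k ∈ B}, f (x, x + k) := by
  rw [← lintegral_indicator (hB.prod hB), lintegral_prod_eq_lintegral_translate
    ((aemeasurable_indicator_iff (hB.prod hB)).2 hf)]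
  refine lintegral_congr fun k => ?_
  have hm : MeasurableSet (B ∩ {x | x + k ∈ B}) := hB.inter (measurable_add_const k hB)
  rw [← lintegral_indicator hm]
  rfl

/-- Integrals over pairs of points at controlled distance. -/
lemma setLIntegral_prod_le_nearConst_mul {κ : ℝ} {x₀ : E N} {ρ : ℝ}
    (hρ : ρ ≤ 1) {f : E N × E N → ℝ≥0∞}
    (hf : AEMeasurable f (volume.restrict (ball x₀ ρ ×ˢ ball x₀ ρ))) {D : ℝ≥0∞}
    (h : ∀ k, ‖k‖ < 2 → ∫⁻ x in ball x₀ ρ ∩ {x | x + k ∈ ball x₀ ρ}, f (x, x + k) ≤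
      ENNReal.ofReal (kern (-κ) k) * D) :
    ∫⁻ z in ball x₀ ρ ×ˢ ball x₀ ρ, f z ≤ nearConst N κ * D := by
  rw [setLIntegral_prod_eq_lintegral_translate measurableSet_ball hf, nearConst,
    ← lintegral_mul_const _ (measurable_kern _).ennreal_ofReal,
    ← lintegral_indicator measurableSet_ball]
  refine lintegral_mono fun k => ?_
  by_cases hk : ‖k‖ < 2
  · rw [indicator_of_mem (by simpa using hk)]
    exact h k hk
  · have : ball x₀ ρ ∩ {x | x + k ∈ ball x₀ ρ} = ∅ := by
      rw [eq_empty_iff_forall_notMem]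
      rintro x ⟨h1, h2⟩
      apply hk
      have h3 := dist_triangle_right (x + k) x x₀
      rw [dist_eq_norm, add_sub_cancel_left] at h3
      have h2' : dist (x + k) x₀ < ρ := h2
      linarith [mem_ball.1 h1]
    simp only [this, Measure.restrict_empty, lintegral_zero_measure]
    exact zero_le

lemma setLIntegral_prod_swap {B : Set (E N)} (f : E N × E N → ℝ≥0∞) :
    ∫⁻ z in B ×ˢ B, f (Prod.swap z) = ∫⁻ z in B ×ˢ B, f z := by
  have h := (Measure.measurePreserving_swap (μ := (volume : Measure (E N)))
    (ν := (volume : Measure (E N)))).setLIntegral_comp_preimage_emb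
    MeasurableEquiv.prodComm.measurableEmbedding f (B ×ˢ B)
  rw [preimage_swap_prod] at h
  exact h

lemma lintegral_swap (f : E N × E N → ℝ≥0∞) : ∫⁻ z : E N × E N, f z.swap = ∫⁻ z, f z := by
  simpa using setLIntegral_prod_swap (B := univ) f

lemma measurePreserving_prod_translate (h : E N) :
    MeasurePreserving (fun z : E N × E N => (z.1 + h, z.2 + h)) volume volume :=
  (measurePreserving_add_right volume h).prod (measurePreserving_add_right volume h)

lemma measurableEmbedding_prod_translate (h : E N) :
    MeasurableEmbedding (fun z : E N × E N => (z.1 + h, z.2 + h)) :=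
  ((MeasurableEquiv.addRight h).prodCongr (MeasurableEquiv.addRight h)).measurableEmbedding

lemma setLIntegral_prod_translate_le {B B' : Set (E N)} (hB : MeasurableSet B)
    (hB' : MeasurableSet B') {h : E N} (hBB : ∀ x ∈ B, x + h ∈ B') (f : E N × E N → ℝ≥0∞) :
    ∫⁻ z in B ×ˢ B, f (z.1 + h, z.2 + h) ≤ ∫⁻ z in B' ×ˢ B', f z := by
  rw [← lintegral_indicator (hB.prod hB), ← lintegral_indicator (hB'.prod hB'),
    ← (measurePreserving_prod_translate h).lintegral_comp_emb
      (measurableEmbedding_prod_translate h) ((B' ×ˢ B').indicator f)]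
  refine lintegral_mono fun z => ?_
  by_cases hz : z ∈ B ×ˢ B
  · rw [indicator_of_mem hz, indicator_of_mem (by exact ⟨hBB _ hz.1, hBB _ hz.2⟩)]
  · rw [indicator_of_notMem hz]; exact zero_le

lemma aestronglyMeasurable_fst {F : Type*} [TopologicalSpace F] {f : E N → F}
    (hf : AEStronglyMeasurable f) : AEStronglyMeasurable (fun z : E N × E N => f z.1) :=
  hf.comp_quasiMeasurePreserving Measure.quasiMeasurePreserving_fst

lemma aestronglyMeasurable_snd {F : Type*} [TopologicalSpace F] {f : E N → F}
    (hf : AEStronglyMeasurable f) : AEStronglyMeasurable (fun z : E N × E N => f z.2) :=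
  hf.comp_quasiMeasurePreserving Measure.quasiMeasurePreserving_snd

lemma aestronglyMeasurable_diff {F : Type*} [NormedAddCommGroup F] {f : E N → F}
    (hf : AEStronglyMeasurable f) :
    AEStronglyMeasurable (fun z : E N × E N => f z.1 - f z.2) :=
  (aestronglyMeasurable_fst hf).sub (aestronglyMeasurable_snd hf)

/-- On the diagonal both sides vanish: the left one is `0 / 0 = 0` in `ℝ≥0∞`, and on the right `0 ^
q = 0` since `q > 0`. -/
lemma enorm_rpow_div_eq {F : Type*} [NormedAddCommGroup F] {q a : ℝ} (hq : 0 < q)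
    (ha : 0 < (N : ℝ) + a) {f : E N → F} (x y : E N) :
    ‖f x - f y‖ₑ ^ q / ‖x - y‖ₑ ^ ((N : ℝ) + a) =
      ENNReal.ofReal (‖f x - f y‖ ^ q * kern a (x - y)) := by
  rcases eq_or_ne x y with rfl | hxy
  · simp [hq, Real.zero_rpow hq.ne']
  · have h0 : 0 < ‖x - y‖ := norm_pos_iff.2 (sub_ne_zero.2 hxy)
    rw [kern, Real.rpow_neg h0.le, ← div_eq_mul_inv, ENNReal.ofReal_div_of_pos (by positivity),
      ← ENNReal.ofReal_rpow_of_nonneg (norm_nonneg _) hq.le,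
      ← ENNReal.ofReal_rpow_of_nonneg (norm_nonneg _) ha.le, ofReal_norm, ofReal_norm]

lemma gagliardoPow_eq {F : Type*} [NormedAddCommGroup F] {γ q : ℝ} (hq : 0 < q)
    (hγ : 0 < γ) {V : Set (E N)} {f : E N → F} (hf : AEStronglyMeasurable f) :
    gagliardoPow γ q V f = ∫⁻ z in V ×ˢ V,
      ENNReal.ofReal (‖f z.1 - f z.2‖ ^ q * kern (γ * q) (z.1 - z.2)) := by
  have hN : (0 : ℝ) ≤ N := Nat.cast_nonneg N
  simp_rw [gagliardoPow, enorm_rpow_div_eq hq (show 0 < (N : ℝ) + γ * q by positivity)]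
  rw [Measure.volume_eq_prod, ← Measure.prod_restrict, lintegral_prod]
  rw [Measure.prod_restrict]
  apply AEMeasurable.restrict
  exact ((((aestronglyMeasurable_diff hf).norm.aemeasurable.pow_const q).mul
    (by fun_prop)).ennreal_ofReal)

end Double

/-! ### The nonlocal tail -/

section Tail

variable {N : ℕ}

/-- `∫_{ℝ^N ∖ B_R(x₀)} |u|^n / |x - x₀|^{N+s} dx`. -/
noncomputable def tailInt (s n : ℝ) (u : E N → ℝ) (x₀ : E N) (R : ℝ) : ℝ≥0∞ :=
  ∫⁻ x in (ball x₀ R)ᶜ, ‖u x‖ₑ ^ n / ‖x - x₀‖ₑ ^ ((N : ℝ) + s)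

lemma tailInt_ne_top {s n : ℝ} (hs : 0 < s) {u : E N → ℝ} {x₀ : E N} {R : ℝ} (hR : 0 < R)
    (hu : ∫⁻ x, ‖u x‖ₑ ^ n / ENNReal.ofReal ((1 + ‖x‖) ^ ((N : ℝ) + s)) < ∞) :
    tailInt s n u x₀ R ≠ ∞ := by
  have hN : (0 : ℝ) ≤ N := Nat.cast_nonneg N
  set a := (N : ℝ) + s with ha
  have ha0 : 0 < a := by positivity
  -- Chosen so that `1 + |x| ≤ c |x - x₀|` outside the ball; the weight of the tail is then at most
  -- `c ^ a` times the global weight.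
  set c := 1 + (1 + ‖x₀‖) / R with hc
  have hc0 : 0 < c := by positivity
  have hle : tailInt s n u x₀ R ≤ ∫⁻ x, ENNReal.ofReal (c ^ a) *
      (‖u x‖ₑ ^ n / ENNReal.ofReal ((1 + ‖x‖) ^ a)) := by
    refine (setLIntegral_mono' measurableSet_ball.compl fun x hx => ?_).trans
      (setLIntegral_le_lintegral _ _)
    have hx' : R ≤ ‖x - x₀‖ := by simpa [dist_eq_norm] using hx
    have h1 : 1 + ‖x‖ ≤ c * ‖x - x₀‖ := by
      have h2 : 1 + ‖x₀‖ ≤ (1 + ‖x₀‖) / R * ‖x - x₀‖ := by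
        rw [div_mul_eq_mul_div, le_div_iff₀ hR]
        gcongr
      have h3 : ‖x‖ ≤ ‖x - x₀‖ + ‖x₀‖ := by simpa using norm_add_le (x - x₀) x₀
      rw [hc, add_mul]
      linarith
    have h0 : 0 < ‖x - x₀‖ := hR.trans_le hx'
    have h4 : (1 + ‖x‖) ^ a ≤ c ^ a * ‖x - x₀‖ ^ a := by
      rw [← Real.mul_rpow hc0.le h0.le]
      exact Real.rpow_le_rpow (by positivity) h1 ha0.le
    rw [← ofReal_norm (x - x₀), ENNReal.ofReal_rpow_of_nonneg h0.le ha0.le, mul_comm,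
      ENNReal.div_eq_inv_mul, ENNReal.div_eq_inv_mul, mul_right_comm, mul_comm (_⁻¹ * _) (_ ^ _),
      mul_comm _ (_ ^ n)]
    gcongr
    rw [← ENNReal.ofReal_inv_of_pos (by positivity), ← ENNReal.ofReal_inv_of_pos (by positivity),
      ← ENNReal.ofReal_mul (by positivity)]
    apply ENNReal.ofReal_le_ofReal
    rw [inv_mul_eq_div, le_div_iff₀ (by positivity), inv_mul_le_iff₀ (by positivity), mul_comm]
    exact h4
  refine (hle.trans_lt ?_).ne
  rw [lintegral_const_mul' _ _ ENNReal.ofReal_ne_top]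
  exact ENNReal.mul_lt_top ENNReal.ofReal_lt_top hu

/-- The constant in the bound for the nonlocal part of the operator. -/
noncomputable def tailConst (N : ℕ) (s n : ℝ) : ℝ≥0∞ :=
  ENNReal.ofReal (2 ^ n) * (ENNReal.ofReal (2 ^ ((N : ℝ) + s)) * farConst N s + 1)

lemma tailConst_ne_top {s : ℝ} (n : ℝ) (hs : 0 < s) : tailConst N s n ≠ ∞ := by
  have := farConst_ne_top (N := N) hs
  unfold tailConst
  finiteness

/-- The bound for the nonlocal part of the operator. -/
noncomputable def tailBound (s n δ M : ℝ) (u : E N → ℝ) (x₀ : E N) (R : ℝ) : ℝ≥0∞ :=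
  ENNReal.ofReal (δ ^ (-((N : ℝ) + s))) * tailConst N s n *
    (ENNReal.ofReal (M ^ n) + tailInt s n u x₀ R)

lemma half_rpow_kern_exponent {δ : ℝ} (hδ : 0 < δ) (a : ℝ) :
    (δ / 2) ^ (-a) = 2 ^ a * δ ^ (-a) := by
  rw [Real.div_rpow hδ.le (by norm_num), Real.rpow_neg (by norm_num : (0 : ℝ) ≤ 2), div_inv_eq_mul,
    mul_comm]

/-- Points `y` in `B_R` are handled by `|u| ≤ M` and the integrability of the kernel away from the
origin. For `y` outside `B_R` one has `|x - y| ≥ δ |y - x₀|`, because `|x - x₀| < ρ ≤ R - δ ≤ (1 -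
δ) |y - x₀|` when `R ≤ 1`; this recentres the kernel at `x₀` and produces the tail. -/
lemma setLIntegral_far_le_tailBound {s n δ M ρ R : ℝ} (hs : 0 < s) (hn : 1 ≤ n) (hδ : 0 < δ)
    (hM : 0 ≤ M) (hρ : 0 ≤ ρ) (hρR : ρ + δ ≤ R) (hR : R ≤ 1) {u : E N → ℝ} {x₀ : E N}
    (hu : ∀ᵐ y, y ∈ ball x₀ R → |u y| ≤ M) {x : E N} (hx : x ∈ ball x₀ ρ) {w : ℝ} (hw : |w| ≤ M) :
    ∫⁻ y in {y | δ ≤ ‖x - y‖}, ENNReal.ofReal (|w - u y| ^ n * kern s (x - y)) ≤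
      tailBound s n δ M u x₀ R := by
  have hN : (0 : ℝ) ≤ N := Nat.cast_nonneg N
  have hn0 : 0 ≤ n := by linarith
  have hm : MeasurableSet {z : E N | δ ≤ ‖z‖} := measurableSet_le measurable_const measurable_norm
  have hm' : MeasurableSet {y : E N | δ ≤ ‖x - y‖} :=
    measurableSet_le measurable_const (by fun_prop)
  set a := (N : ℝ) + s with ha
  have ha0 : 0 < a := by positivity
  set c₁ := ENNReal.ofReal (2 ^ n * M ^ n) with hc₁
  set c₂ := ENNReal.ofReal (2 ^ n * δ ^ (-a)) with hc₂
  set f₁ : E N → ℝ≥0∞ := {z : E N | δ ≤ ‖z‖}.indicator fun z => ENNReal.ofReal (kern s z) with hf₁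
  set f₂ : E N → ℝ≥0∞ := (ball x₀ R)ᶜ.indicator fun y => ‖u y‖ₑ ^ n / ‖y - x₀‖ₑ ^ a with hf₂
  have hf₁m : Measurable f₁ := (measurable_kern s).ennreal_ofReal.indicator hm
  have hpt : ∀ᵐ y, {y | δ ≤ ‖x - y‖}.indicator
      (fun y => ENNReal.ofReal (|w - u y| ^ n * kern s (x - y))) y ≤
      c₁ * f₁ (x - y) + c₂ * f₂ y := by
    filter_upwards [hu] with y hy
    by_cases hyδ : δ ≤ ‖x - y‖
    swap
    · rw [indicator_of_notMem (by exact hyδ)]; exact zero_le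
    rw [indicator_of_mem (by exact hyδ), hf₁, indicator_of_mem (by exact hyδ)]
    have h2 : |w - u y| ^ n ≤ 2 ^ (n - 1) * (M ^ n + |u y| ^ n) :=
      (abs_sub_rpow_le hn).trans (by gcongr)
    have h22 : (2 : ℝ) ^ n = 2 * 2 ^ (n - 1) := by
      rw [Real.rpow_sub_one (by norm_num)]; ring
    have hp : (0 : ℝ) < 2 ^ (n - 1) := by positivity
    have hk := kern_nonneg s (x - y)
    have hMn : 0 ≤ M ^ n := by positivity
    by_cases hyR : y ∈ ball x₀ R
    · refine le_trans ?_ le_self_add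
      rw [hc₁, ← ENNReal.ofReal_mul (by positivity)]
      apply ENNReal.ofReal_le_ofReal
      gcongr
      have : |u y| ^ n ≤ M ^ n := Real.rpow_le_rpow (abs_nonneg _) (hy hyR) hn0
      nlinarith
    · rw [hf₂, indicator_of_mem (by exact hyR)]
      have hy1 : R ≤ ‖y - x₀‖ := by simpa [dist_eq_norm] using hyR
      have hR0 : 0 < R := by linarith
      have hy0 : 0 < ‖y - x₀‖ := by linarith
      have hdist : δ * ‖y - x₀‖ ≤ ‖x - y‖ := by
        have h3 : ‖y - x₀‖ ≤ ‖x - y‖ + ‖x - x₀‖ := by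
          rw [← norm_neg (x - y)]
          simpa using norm_add_le (-(x - y)) (x - x₀)
        have hxρ : ‖x - x₀‖ < ρ := by simpa [dist_eq_norm] using hx
        have h4 : ‖x - x₀‖ ≤ (1 - δ) * ‖y - x₀‖ := by
          nlinarith
        linarith
      have hkle : kern s (x - y) ≤ δ ^ (-a) * ‖y - x₀‖ ^ (-a) := by
        rw [kern, ← Real.mul_rpow hδ.le hy0.le]
        exact Real.rpow_le_rpow_of_nonpos (by positivity) hdist (by linarith)
      have e : ‖u y‖ₑ ^ n / ‖y - x₀‖ₑ ^ a =
          ENNReal.ofReal (|u y| ^ n * ‖y - x₀‖ ^ (-a)) := by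
        rw [Real.rpow_neg hy0.le, ← div_eq_mul_inv, ENNReal.ofReal_div_of_pos (by positivity),
          ← ENNReal.ofReal_rpow_of_nonneg (abs_nonneg _) hn0,
          ← ENNReal.ofReal_rpow_of_nonneg (norm_nonneg _) ha0.le, ofReal_norm,
          ← Real.norm_eq_abs, ofReal_norm]
      rw [e, hc₁, hc₂, ← ENNReal.ofReal_mul (by positivity), ← ENNReal.ofReal_mul (by positivity),
        ← ENNReal.ofReal_add (by positivity) (by positivity)]
      apply ENNReal.ofReal_le_ofReal
      have hun : 0 ≤ |u y| ^ n := by positivity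
      calc |w - u y| ^ n * kern s (x - y)
          ≤ (2 ^ (n - 1) * (M ^ n + |u y| ^ n)) * kern s (x - y) := by gcongr
        _ = 2 ^ (n - 1) * M ^ n * kern s (x - y) + 2 ^ (n - 1) * |u y| ^ n * kern s (x - y) := by
          ring
        _ ≤ 2 ^ n * M ^ n * kern s (x - y) +
            2 ^ n * |u y| ^ n * (δ ^ (-a) * ‖y - x₀‖ ^ (-a)) := by
          gcongr <;> linarith
        _ = _ := by ring
  rw [← lintegral_indicator hm']
  refine (lintegral_mono_ae hpt).trans ?_
  rw [lintegral_add_left (by fun_prop), lintegral_const_mul' _ _ ENNReal.ofReal_ne_top,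
    lintegral_const_mul' _ _ ENNReal.ofReal_ne_top, lintegral_sub_left_eq_self f₁ x,
    lintegral_indicator hm, lintegral_indicator measurableSet_ball.compl]
  have hδ1 : δ ≤ 1 := by linarith
  have h1 := lintegral_kern_far_le (N := N) hs hδ hδ1
  rw [half_rpow_kern_exponent hδ] at h1
  rw [tailBound, tailConst, ← ha]
  calc _ ≤ c₁ * (ENNReal.ofReal (2 ^ a * δ ^ (-a)) * farConst N s) + c₂ * tailInt s n u x₀ R := by
        gcongr
        · exact le_rfl
    -- The two cross terms are added so that the sum factors as the product in `tailBound`.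
    _ ≤ c₁ * (ENNReal.ofReal (2 ^ a * δ ^ (-a)) * farConst N s) + c₂ * tailInt s n u x₀ R +
        (c₁ * ENNReal.ofReal (δ ^ (-a)) + c₂ * ENNReal.ofReal (2 ^ a) * farConst N s *
          tailInt s n u x₀ R) := le_self_add
    _ = _ := by
        rw [hc₁, hc₂, ENNReal.ofReal_mul (by positivity), ENNReal.ofReal_mul (by positivity),
          ENNReal.ofReal_mul (by positivity)]
        ring

end Tail

/-! ### Admissibility of the test functions and convergence of the double integrals -/

section TestFunctions

variable {N : ℕ}

/-- Allows pairs to be discussed up to exchanging their two points; the mirrored contribution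
accounts for the factor `2`. -/
lemma lintegral_le_two_mul_of_le_add_swap {F P : E N × E N → ℝ≥0∞} (hP : AEMeasurable P)
    (h : ∀ᵐ z, F z ≤ P z + P z.swap) : ∫⁻ z, F z ≤ 2 * ∫⁻ z, P z := by
  refine (lintegral_mono_ae h).trans ?_
  rw [lintegral_add_left' hP, lintegral_swap, two_mul]

lemma rpow_mul_kern_le (s κ : ℝ) (z : E N) : ‖z‖ ^ κ * kern s z ≤ kern (s - κ) z := by
  rcases eq_or_ne z 0 with rfl | hz
  · rcases eq_or_ne κ 0 with rfl | hκ
    · simp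
    · simp [Real.zero_rpow hκ, kern_nonneg]
  · exact (rpow_mul_kern s κ hz).le

lemma add_add_rpow_le {a b c t : ℝ} (ha : 0 ≤ a) (hb : 0 ≤ b) (hc : 0 ≤ c) (ht : 0 ≤ t) :
    (a + b + c) ^ t ≤ 3 ^ t * (a ^ t + b ^ t + c ^ t) := by
  have h : a + b + c ≤ 3 * max (max a b) c := by
    have h1 := le_max_left (max a b) c
    have h2 := le_max_right (max a b) c
    have h3 := le_max_left a b
    have h4 := le_max_right a b
    linarith
  have h0 : 0 ≤ max (max a b) c := le_max_of_le_right hc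
  have ha' : 0 ≤ a ^ t := by positivity
  have hb' : 0 ≤ b ^ t := by positivity
  have hc' : 0 ≤ c ^ t := by positivity
  refine (Real.rpow_le_rpow (by positivity) h ht).trans ?_
  rw [Real.mul_rpow (by norm_num) h0]
  gcongr
  rcases max_choice (max a b) c with e | e <;> rw [e]
  · rcases max_choice a b with e | e <;> rw [e] <;> linarith
  · linarith

lemma aemeasurable_diff_rpow_kern {u : E N → ℝ} (hu : AEStronglyMeasurable u) (c n s : ℝ) (h : E N) :
    AEMeasurable fun z : E N × E N =>
      ENNReal.ofReal (c * |u (z.1 + h) - u (z.2 + h)| ^ n * kern s (z.1 - z.2)) := by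
  have h1 : AEMeasurable fun z : E N × E N => u (z.1 + h) - u (z.2 + h) :=
    ((aestronglyMeasurable_diff hu).comp_measurePreserving
      (measurePreserving_prod_translate h)).aemeasurable
  have h2 : AEMeasurable fun z : E N × E N => |u (z.1 + h) - u (z.2 + h)| :=
    measurable_norm.comp_aemeasurable h1
  exact (((h2.pow_const n).const_mul c).mul (by fun_prop)).ennreal_ofReal

/-- For fixed `x`, the shift `y ↦ y + h` turns the inner integral into the far integral centred at
`x + h`, a point of `B_ρ` whenever `f x ≠ 0`. So `setLIntegral_far_le_tailBound` applies with a
bound independent of `x`. -/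
lemma lintegral_far_diff_le {s n δ M ρ R : ℝ} (hs : 0 < s) (hn : 1 ≤ n) (hδ : 0 < δ)
    (hM : 0 ≤ M) (hρ : 0 ≤ ρ) (hρR : ρ + δ ≤ R) (hR : R ≤ 1) {u : E N → ℝ}
    (hum : AEStronglyMeasurable u) {x₀ : E N} (hu : ∀ᵐ y, y ∈ ball x₀ R → |u y| ≤ M) (h : E N)
    {f : E N → ℝ≥0∞} (hf : AEMeasurable f) (hfρ : ∀ x, f x ≠ 0 → x + h ∈ ball x₀ ρ) :
    ∫⁻ z, {z : E N × E N | δ ≤ ‖z.1 - z.2‖}.indicator (fun z => f z.1 *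
      ENNReal.ofReal (|u (z.1 + h) - u (z.2 + h)| ^ n * kern s (z.1 - z.2))) z ≤
      tailBound s n δ M u x₀ R * ∫⁻ x, f x := by
  rw [Measure.volume_eq_prod]
  refine (lintegral_prod_le _).trans ?_
  rw [mul_comm, ← lintegral_mul_const'' _ hf]
  apply lintegral_mono_ae
  have huh : ∀ᵐ x, x + h ∈ ball x₀ R → |u (x + h)| ≤ M :=
    (measurePreserving_add_right volume h).quasiMeasurePreserving.ae hu
  filter_upwards [huh] with x hx
  have e : ∀ y, {z : E N × E N | δ ≤ ‖z.1 - z.2‖}.indicator (fun z => f z.1 *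
      ENNReal.ofReal (|u (z.1 + h) - u (z.2 + h)| ^ n * kern s (z.1 - z.2))) (x, y) =
      f x * {y | δ ≤ ‖(x + h) - y‖}.indicator (fun y =>
      ENNReal.ofReal (|u (x + h) - u y| ^ n * kern s ((x + h) - y))) (y + h) := by
    intro y
    by_cases hy : δ ≤ ‖x - y‖
    · rw [indicator_of_mem (by exact hy), indicator_of_mem (by simpa using hy)]
      simp
    · rw [indicator_of_notMem (by exact hy), indicator_of_notMem (by simpa using hy), mul_zero]
  simp_rw [e]
  have hms : MeasurableSet {y | δ ≤ ‖(x + h) - y‖} :=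
    measurableSet_le measurable_const (by fun_prop)
  have hmeas : AEMeasurable ({y | δ ≤ ‖(x + h) - y‖}.indicator (fun y =>
      ENNReal.ofReal (|u (x + h) - u y| ^ n * kern s ((x + h) - y)))) := by
    refine AEMeasurable.indicator ?_ hms
    have h1 : AEMeasurable fun y => |u (x + h) - u y| :=
      measurable_norm.comp_aemeasurable (aemeasurable_const.sub hum.aemeasurable)
    exact ((h1.pow_const n).mul (by fun_prop)).ennreal_ofReal
  have hmeas' : AEMeasurable fun y => ({y | δ ≤ ‖(x + h) - y‖}.indicator (fun y =>
      ENNReal.ofReal (|u (x + h) - u y| ^ n * kern s ((x + h) - y)))) (y + h) :=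
    hmeas.comp_quasiMeasurePreserving (measurePreserving_add_right volume h).quasiMeasurePreserving
  rw [lintegral_const_mul'' _ hmeas']
  by_cases hfx : f x = 0
  · simp [hfx]
  gcongr
  have hxρ := hfρ x hfx
  rw [lintegral_add_right_eq_self _ h, lintegral_indicator hms]
  exact setLIntegral_far_le_tailBound hs hn hδ hM hρ hρR hR hu hxρ
    (hx (ball_subset_ball (by linarith) hxρ))

/-- A Lipschitz cutoff function, equal to `1` in `B_{ρ-δ}` and to `0` outside of `B_ρ`. -/
noncomputable def cutoff (x₀ : E N) (ρ δ : ℝ) (x : E N) : ℝ :=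
  max 0 (min 1 ((ρ - dist x x₀) / δ))

lemma cutoff_nonneg (x₀ : E N) (ρ δ : ℝ) (x : E N) : 0 ≤ cutoff x₀ ρ δ x := le_max_left _ _

lemma cutoff_le_one (x₀ : E N) (ρ δ : ℝ) (x : E N) : cutoff x₀ ρ δ x ≤ 1 :=
  max_le zero_le_one (min_le_left _ _)

lemma cutoff_eq_one {x₀ : E N} {ρ δ : ℝ} (hδ : 0 < δ) {x : E N} (hx : x ∈ ball x₀ (ρ - δ)) :
    cutoff x₀ ρ δ x = 1 := by
  have : 1 ≤ (ρ - dist x x₀) / δ := by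
    rw [le_div_iff₀ hδ]
    linarith [mem_ball.1 hx]
  simp [cutoff, min_eq_left this]

lemma cutoff_eq_zero {x₀ : E N} {ρ δ : ℝ} (hδ : 0 < δ) {x : E N} (hx : x ∉ ball x₀ ρ) :
    cutoff x₀ ρ δ x = 0 := by
  have h1 : (ρ - dist x x₀) / δ ≤ 0 := by
    apply div_nonpos_of_nonpos_of_nonneg _ hδ.le
    have : ρ ≤ dist x x₀ := by simpa using hx
    linarith
  exact max_eq_left ((min_le_right _ _).trans h1)

lemma abs_cutoff_sub_le {x₀ : E N} {ρ δ : ℝ} (hδ : 0 < δ) (x y : E N) :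
    |cutoff x₀ ρ δ x - cutoff x₀ ρ δ y| ≤ ‖x - y‖ / δ := by
  unfold cutoff
  refine (abs_max_sub_max_le_max _ _ _ _).trans ?_
  rw [sub_self, abs_zero]
  refine max_le (by positivity) ((abs_min_sub_min_le_max _ _ _ _).trans ?_)
  rw [sub_self, abs_zero]
  refine max_le (by positivity) ?_
  rw [div_sub_div_same, abs_div, abs_of_pos hδ, sub_sub_sub_cancel_left, ← dist_eq_norm]
  gcongr
  rw [dist_comm x y]
  exact abs_dist_sub_le y x x₀

@[fun_prop]
lemma measurable_cutoff (x₀ : E N) (ρ δ : ℝ) : Measurable (cutoff x₀ ρ δ) := by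
  unfold cutoff
  fun_prop

/-- This makes the cutoff power of the increment an admissible test function. In the ball of radius
`ρ + δ` the product rule splits the difference into differences of `u`, of its translate, and of the
Lipschitz cutoff; the last is integrable since `γ < 1` makes `t - γ t` positive. If one point leaves
that ball, either both values vanish or the points are at least `δ` apart, and boundedness suffices.
-/
lemma gagliardoPow_mul_lt_top (hN : 1 ≤ N) {γ t : ℝ} (ht : 1 ≤ t) (hγ : 0 < γ) (hγ1 : γ < 1)
    {u : E N → ℝ} (hum : AEStronglyMeasurable u) {x₀ : E N} {ρ δ R : ℝ} (hδ : 0 < δ) (hρ : 0 < ρ)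
    (hρR : ρ + 2 * δ ≤ R) (hR : R ≤ 1) (hu : gagliardoPow γ t (ball x₀ R) u < ∞)
    {h : E N} (hh : ‖h‖ ≤ δ) {θ : E N → ℝ} (hθm : AEStronglyMeasurable θ) {A L : ℝ}
    (hL : 0 ≤ L) (hA : ∀ x, |θ x| ≤ A)
    (hθ : ∀ x y, |θ x - θ y| ≤ L * (|u (x + h) - u (y + h)| + |u x - u y|)) :
    gagliardoPow γ t univ (fun x => cutoff x₀ ρ δ x * θ x) < ∞ := by
  have ht0 : 0 < t := by linarith
  have hA0 : 0 ≤ A := (abs_nonneg _).trans (hA 0)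
  have hηm := measurable_cutoff x₀ ρ δ
  set φ : E N → ℝ := fun x => cutoff x₀ ρ δ x * θ x with hφ
  have hφm : AEStronglyMeasurable φ := hηm.aestronglyMeasurable.mul hθm
  rw [gagliardoPow_eq ht0 hγ hφm, univ_prod_univ, Measure.restrict_univ]
  rw [gagliardoPow_eq ht0 hγ hum] at hu
  set B := ball x₀ (ρ + δ) with hB
  have hBm : MeasurableSet B := measurableSet_ball
  set s := γ * t with hs
  have hs0 : 0 < s := by positivity
  set κ := t - γ * t with hκ
  have hκ0 : 0 < κ := by rw [hκ]; nlinarith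
  set g : E N → E N × E N → ℝ≥0∞ := fun h z =>
    ENNReal.ofReal ((3 * L) ^ t * |u (z.1 + h) - u (z.2 + h)| ^ t * kern s (z.1 - z.2)) with hg
  have hgm : ∀ h, AEMeasurable (g h) := fun h => aemeasurable_diff_rpow_kern hum _ _ _ _
  set g₃ : E N × E N → ℝ≥0∞ := fun z =>
    ENNReal.ofReal ((3 * (A / δ)) ^ t) * ENNReal.ofReal (kern (-κ) (z.1 - z.2)) with hg₃
  set D := {z : E N × E N | δ ≤ ‖z.1 - z.2‖} with hD
  have hDm : MeasurableSet D := measurableSet_far δ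
  set f : E N → ℝ≥0∞ := B.indicator fun _ => ENNReal.ofReal (A ^ t) with hf
  set g₄ : E N × E N → ℝ≥0∞ := fun z => f z.1 * ENNReal.ofReal (kern s (z.1 - z.2)) with hg₄
  have hfm : Measurable f := measurable_const.indicator hBm
  have hg₄m : Measurable g₄ := by
    apply Measurable.mul (hfm.comp measurable_fst)
    fun_prop
  have hg₃m : Measurable g₃ := by fun_prop
  set P : E N × E N → ℝ≥0∞ := fun z =>
    (B ×ˢ B).indicator (fun z => g h z + (g 0 z + g₃ z)) z + D.indicator g₄ z with hP
  have hPm : AEMeasurable P :=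
    ((((hgm h).add ((hgm 0).add hg₃m.aemeasurable))).indicator (hBm.prod hBm)).add
      (hg₄m.indicator hDm).aemeasurable
  have hout : ∀ x ∉ ball x₀ ρ, φ x = 0 := fun x hx => by
    simp only [hφ, cutoff_eq_zero hδ hx, zero_mul]
  have hφA : ∀ x, |φ x| ≤ A := fun x => by
    rw [hφ, abs_mul, abs_of_nonneg (cutoff_nonneg _ _ _ _)]
    exact (mul_le_of_le_one_left (abs_nonneg _) (cutoff_le_one _ _ _ _)).trans (hA x)
  -- a pair of points one of which is outside of `B`
  have hfar : ∀ x y, y ∉ B → ENNReal.ofReal (‖φ x - φ y‖ ^ t * kern s (x - y)) ≤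
      D.indicator g₄ (x, y) := by
    intro x y hy
    have hy0 : φ y = 0 := hout y fun h' => hy (ball_subset_ball (by linarith) h')
    by_cases hx : x ∈ ball x₀ ρ
    · have hxy : δ ≤ ‖x - y‖ := by
        have h1 : ρ + δ ≤ dist y x₀ := by simpa [hB] using hy
        have h2 := dist_triangle_left y x₀ x
        rw [dist_eq_norm x y] at h2
        linarith [mem_ball.1 hx]
      rw [indicator_of_mem (by exact hxy), hg₄, hf]
      simp only
      rw [indicator_of_mem (ball_subset_ball (by linarith) hx), ← ENNReal.ofReal_mul (by positivity),
        hy0, sub_zero]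
      apply ENNReal.ofReal_le_ofReal
      have := kern_nonneg s (x - y)
      gcongr
      exact hφA x
    · rw [hout x hx, hy0]
      simp [Real.zero_rpow ht0.ne']
  have hle : ∀ z, ENNReal.ofReal (‖φ z.1 - φ z.2‖ ^ t * kern s (z.1 - z.2)) ≤ P z + P z.swap := by
    rintro ⟨x, y⟩
    by_cases hx : x ∈ B
    swap
    · have h1 := hfar y x hx
      rw [norm_sub_rev, kern_sub_comm] at h1
      exact h1.trans (le_add_self.trans le_add_self)
    by_cases hy : y ∈ B
    swap
    · exact (hfar x y hy).trans (le_add_self.trans le_self_add)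
    refine le_trans ?_ (le_self_add.trans le_self_add)
    rw [indicator_of_mem (by exact ⟨hx, hy⟩), hg, hg₃]
    have hk := kern_nonneg s (x - y)
    have hk' := kern_nonneg (-κ) (x - y)
    simp only [add_zero]
    rw [← ENNReal.ofReal_mul (by positivity), ← ENNReal.ofReal_add (by positivity) (by positivity),
      ← ENNReal.ofReal_add (by positivity) (by positivity)]
    apply ENNReal.ofReal_le_ofReal
    have h1 : ‖φ x - φ y‖ ≤ L * |u (x + h) - u (y + h)| + L * |u x - u y| +
        A / δ * ‖x - y‖ := by
      have e : φ x - φ y = cutoff x₀ ρ δ x * (θ x - θ y) +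
          θ y * (cutoff x₀ ρ δ x - cutoff x₀ ρ δ y) := by simp only [hφ]; ring
      rw [e, Real.norm_eq_abs]
      refine (abs_add_le _ _).trans ?_
      rw [abs_mul, abs_mul, abs_of_nonneg (cutoff_nonneg _ _ _ _), ← mul_add]
      refine add_le_add ?_ ?_
      · exact (mul_le_of_le_one_left (abs_nonneg _) (cutoff_le_one _ _ _ _)).trans (hθ x y)
      · rw [div_mul_eq_mul_div, ← mul_div_assoc']
        exact mul_le_mul (hA y) (abs_cutoff_sub_le hδ x y) (abs_nonneg _) hA0
    have h2 : ‖φ x - φ y‖ ^ t ≤ (3 * L) ^ t * |u (x + h) - u (y + h)| ^ t +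
        ((3 * L) ^ t * |u x - u y| ^ t + (3 * (A / δ)) ^ t * ‖x - y‖ ^ t) := by
      refine (Real.rpow_le_rpow (norm_nonneg _) h1 ht0.le).trans
        ((add_add_rpow_le (by positivity) (by positivity) (by positivity) ht0.le).trans_eq ?_)
      rw [Real.mul_rpow hL (by positivity), Real.mul_rpow hL (by positivity),
        Real.mul_rpow (by positivity) (by positivity), Real.mul_rpow (by positivity) hL,
        Real.mul_rpow (by positivity) (by positivity)]
      ring
    have h3 := rpow_mul_kern_le s t (x - y)
    rw [show s - t = -κ by rw [hκ, hs]; ring] at h3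
    calc ‖φ x - φ y‖ ^ t * kern s (x - y) ≤ ((3 * L) ^ t * |u (x + h) - u (y + h)| ^ t +
        ((3 * L) ^ t * |u x - u y| ^ t + (3 * (A / δ)) ^ t * ‖x - y‖ ^ t)) * kern s (x - y) := by
          gcongr
      _ = (3 * L) ^ t * |u (x + h) - u (y + h)| ^ t * kern s (x - y) +
        ((3 * L) ^ t * |u x - u y| ^ t * kern s (x - y) +
          (3 * (A / δ)) ^ t * (‖x - y‖ ^ t * kern s (x - y))) := by ring
      _ ≤ _ := by gcongr
  refine (lintegral_le_two_mul_of_le_add_swap hPm (Filter.Eventually.of_forall hle)).trans_lt ?_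
  refine ENNReal.mul_lt_top (by simp) ?_
  have hgfin : ∀ k : E N, ‖k‖ ≤ δ → ∫⁻ z in B ×ˢ B, g k z < ∞ := by
    intro k hk
    have h1 := setLIntegral_prod_translate_le hBm (measurableSet_ball (x := x₀) (ε := R)) (h := k)
      (fun x hx => by
        rw [mem_ball, dist_eq_norm] at hx ⊢
        calc ‖x + k - x₀‖ = ‖(x - x₀) + k‖ := by congr 1; abel
          _ ≤ ‖x - x₀‖ + ‖k‖ := norm_add_le _ _
          _ < R := by linarith)
      (fun z => ENNReal.ofReal ((3 * L) ^ t) *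
        ENNReal.ofReal (‖u z.1 - u z.2‖ ^ t * kern s (z.1 - z.2)))
    refine lt_of_le_of_lt (le_of_eq_of_le ?_ h1) ?_
    swap
    · rw [lintegral_const_mul' _ _ ENNReal.ofReal_ne_top]
      exact ENNReal.mul_lt_top ENNReal.ofReal_lt_top hu
    refine lintegral_congr fun z => ?_
    simp only [hg]
    rw [← ENNReal.ofReal_mul (by positivity), mul_assoc, add_sub_add_right_eq_sub,
      Real.norm_eq_abs]
  rw [lintegral_add_right' _ (hg₄m.indicator hDm).aemeasurable, lintegral_indicator (hBm.prod hBm),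
    lintegral_indicator hDm, lintegral_add_left' (hgm h).restrict,
    lintegral_add_left' (hgm 0).restrict]
  refine ENNReal.add_lt_top.2 ⟨ENNReal.add_lt_top.2 ⟨hgfin h hh, ENNReal.add_lt_top.2
    ⟨hgfin 0 (by simp [hδ.le]), ?_⟩⟩, ?_⟩
  · refine (setLIntegral_prod_mul_kern_near_le hN hκ0 (by linarith)
      (fun _ => ENNReal.ofReal ((3 * (A / δ)) ^ t))).trans_lt ?_
    refine ENNReal.mul_lt_top (nearConst_ne_top hN hκ0).lt_top ?_
    rw [setLIntegral_const]
    exact ENNReal.mul_lt_top ENNReal.ofReal_lt_top measure_ball_lt_top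
  · refine (setLIntegral_mul_kern_far_le hs0 hδ (by linarith) f).trans_lt ?_
    refine ENNReal.mul_lt_top (ENNReal.mul_lt_top ENNReal.ofReal_lt_top
      (farConst_ne_top hs0).lt_top) ?_
    rw [hf, lintegral_indicator hBm, setLIntegral_const]
    exact ENNReal.mul_lt_top ENNReal.ofReal_lt_top measure_ball_lt_top

lemma memLq_of_bounded {t : ℝ} {φ : E N → ℝ} (hφm : AEStronglyMeasurable φ) {A : ℝ}
    (hA : ∀ x, |φ x| ≤ A) {x₀ : E N} {ρ : ℝ} (hout : ∀ x ∉ ball x₀ ρ, φ x = 0) :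
    MemLq t univ φ := by
  have e : φ = (ball x₀ ρ).indicator φ := by
    ext x
    by_cases hx : x ∈ ball x₀ ρ
    · rw [indicator_of_mem hx]
    · rw [indicator_of_notMem hx, hout x hx]
  have : IsFiniteMeasure (volume.restrict (ball x₀ ρ)) :=
    ⟨by rw [Measure.restrict_apply_univ]; exact measure_ball_lt_top⟩
  rw [MemLq, Measure.restrict_univ, e, memLp_indicator_iff_restrict measurableSet_ball]
  exact MemLp.of_bound hφm.restrict A (Filter.Eventually.of_forall hA)

lemma gagliardoPow_translate {γ t : ℝ} (φ : E N → ℝ) (h : E N) :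
    gagliardoPow γ t univ (fun x => φ (x + h)) = gagliardoPow γ t univ φ := by
  simp only [gagliardoPow, Measure.restrict_univ]
  rw [← lintegral_add_right_eq_self
    (fun x => ∫⁻ y, ‖φ x - φ y‖ₑ ^ t / ‖x - y‖ₑ ^ ((N : ℝ) + γ * t)) h]
  refine lintegral_congr fun x => ?_
  rw [← lintegral_add_right_eq_self
    (fun y => ‖φ (x + h) - φ y‖ₑ ^ t / ‖x + h - y‖ₑ ^ ((N : ℝ) + γ * t)) h]
  simp

lemma isTestFunction_of_bounded {s₁ sp p : ℝ} {Ω : Set (E N)} {φ : E N → ℝ}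
    (hφm : AEStronglyMeasurable φ) {A : ℝ}
    (hA : ∀ x, |φ x| ≤ A) {x₀ : E N} {ρ : ℝ} (hout : ∀ x ∉ ball x₀ ρ, φ x = 0)
    (hΩ : closedBall x₀ ρ ⊆ Ω) (h1 : gagliardoPow s₁ 1 univ φ < ∞)
    (hp : gagliardoPow sp p univ φ < ∞) : IsTestFunction s₁ sp p Ω φ := by
  have hts : tsupport φ ⊆ closedBall x₀ ρ := by
    refine closure_minimal (fun x hx => ?_) isClosed_closedBall
    by_contra hx'
    exact hx (hout x fun h' => hx' (ball_subset_closedBall h'))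
  exact ⟨⟨memLq_of_bounded hφm hA hout, h1⟩, ⟨memLq_of_bounded hφm hA hout, hp⟩,
    (isCompact_closedBall x₀ ρ).of_isClosed_subset (isClosed_tsupport _) hts, hts.trans hΩ⟩

lemma integrable_sign_term {s₁ : ℝ} (hs₁ : 0 < s₁) {φ : E N → ℝ} (hφm : AEStronglyMeasurable φ)
    (hφ : gagliardoPow s₁ 1 univ φ < ∞) {Z : E N × E N → ℝ} (hZ : AEStronglyMeasurable Z)
    (hZ1 : ∀ᵐ z, |Z z| ≤ 1) :
    Integrable fun z : E N × E N => Z z * (φ z.1 - φ z.2) * kern s₁ (z.1 - z.2) := by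
  rw [gagliardoPow_eq one_pos hs₁ hφm, univ_prod_univ, Measure.restrict_univ] at hφ
  refine ⟨(hZ.mul (aestronglyMeasurable_diff hφm)).mul
    (Measurable.aestronglyMeasurable (by fun_prop)), lt_of_le_of_lt ?_ hφ⟩
  apply lintegral_mono_ae
  filter_upwards [hZ1] with z hz
  rw [← ofReal_norm]
  apply ENNReal.ofReal_le_ofReal
  have := kern_nonneg s₁ (z.1 - z.2)
  rw [norm_mul, norm_mul, Real.rpow_one, Real.norm_of_nonneg this, mul_one]
  gcongr
  exact mul_le_of_le_one_left (norm_nonneg _) hz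

/-- Here `n + 1` plays the role of `p`. On `B_R × B_R` Young's inequality separates the differences
of `u` from those of `φ`, both of finite seminorm. If one point is outside `B_R`, only `φ` at the
other point survives, and the integral is controlled by the tail of `u`. -/
lemma integrable_power_term {sp n δ M ρ R A : ℝ} (hs : 0 < sp) (hn : 1 ≤ n) (hδ : 0 < δ)
    (hM : 0 ≤ M) (hρ : 0 ≤ ρ) (hρR : ρ + δ ≤ R) (hR : R ≤ 1) {u : E N → ℝ}
    (hum : AEStronglyMeasurable u) {x₀ : E N} (hu : ∀ᵐ y, y ∈ ball x₀ R → |u y| ≤ M)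
    (hug : gagliardoPow sp (n + 1) (ball x₀ R) u < ∞)
    (htail : tailInt (sp * (n + 1)) n u x₀ R ≠ ∞) {φ : E N → ℝ} (hφm : AEStronglyMeasurable φ)
    (hA : ∀ x, |φ x| ≤ A) (hout : ∀ x ∉ ball x₀ ρ, φ x = 0)
    (hφ : gagliardoPow sp (n + 1) univ φ < ∞) :
    Integrable fun z : E N × E N => signedPow n (u z.1 - u z.2) * (φ z.1 - φ z.2) *
      kern (sp * (n + 1)) (z.1 - z.2) := by
  have hn0 : 0 < n := by linarith
  have hA0 : 0 ≤ A := (abs_nonneg _).trans (hA 0)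
  rw [gagliardoPow_eq (by linarith) hs hφm, univ_prod_univ, Measure.restrict_univ] at hφ
  rw [gagliardoPow_eq (by linarith) hs hum] at hug
  set s := sp * (n + 1) with hsdef
  have hs0 : 0 < s := by positivity
  refine ⟨(((measurable_signedPow n).comp_aemeasurable
    (aestronglyMeasurable_diff hum).aemeasurable).aestronglyMeasurable.mul
    (aestronglyMeasurable_diff hφm)).mul (Measurable.aestronglyMeasurable (by fun_prop)), ?_⟩
  set B := ball x₀ R
  have hBm : MeasurableSet B := measurableSet_ball
  set D := {z : E N × E N | δ ≤ ‖z.1 - z.2‖} with hD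
  have hDm : MeasurableSet D := measurableSet_far δ
  set g₁ : E N × E N → ℝ≥0∞ := fun z => ENNReal.ofReal (‖u z.1 - u z.2‖ ^ (n + 1) *
    kern s (z.1 - z.2))
  set g₂ : E N × E N → ℝ≥0∞ := fun z => ENNReal.ofReal (‖φ z.1 - φ z.2‖ ^ (n + 1) *
    kern s (z.1 - z.2))
  set f : E N → ℝ≥0∞ := (ball x₀ ρ).indicator fun _ => ENNReal.ofReal A with hf
  have hfm : Measurable f := measurable_const.indicator measurableSet_ball
  set g₃ : E N × E N → ℝ≥0∞ := fun z => f z.1 *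
    ENNReal.ofReal (|u (z.1 + 0) - u (z.2 + 0)| ^ n * kern s (z.1 - z.2)) with hg₃
  have hg₁m : AEMeasurable g₁ := by
    simpa [g₁] using aemeasurable_diff_rpow_kern hum 1 (n + 1) s 0
  have hg₂m : AEMeasurable g₂ := by
    simpa [g₂] using aemeasurable_diff_rpow_kern hφm 1 (n + 1) s 0
  have hg₃m : AEMeasurable g₃ := by
    refine (hfm.comp measurable_fst).aemeasurable.mul ?_
    simpa using aemeasurable_diff_rpow_kern hum 1 n s 0
  set P : E N × E N → ℝ≥0∞ := fun z => (B ×ˢ B).indicator g₁ z + (g₂ z + D.indicator g₃ z)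
  have hPm : AEMeasurable P :=
    (hg₁m.indicator (hBm.prod hBm)).add (hg₂m.add (hg₃m.indicator hDm))
  have hfar : ∀ x y, y ∉ B → ‖signedPow n (u x - u y) * (φ x - φ y) * kern s (x - y)‖ₑ ≤
      D.indicator g₃ (x, y) := by
    intro x y hy
    have hy0 : φ y = 0 := hout y fun h' => hy (ball_subset_ball (by linarith) h')
    by_cases hx : x ∈ ball x₀ ρ
    · have hxy : δ ≤ ‖x - y‖ := by
        have h1 : R ≤ dist y x₀ := by simpa [B] using hy
        have h2 := dist_triangle_left y x₀ x
        rw [dist_eq_norm x y] at h2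
        linarith [mem_ball.1 hx]
      rw [indicator_of_mem (by exact hxy), hg₃, hf]
      simp only [add_zero]
      rw [indicator_of_mem hx, ← ENNReal.ofReal_mul hA0, hy0, sub_zero, ← ofReal_norm]
      apply ENNReal.ofReal_le_ofReal
      have := kern_nonneg s (x - y)
      rw [norm_mul, norm_mul, Real.norm_eq_abs, abs_signedPow hn0, Real.norm_of_nonneg this,
        mul_comm (_ ^ _), mul_assoc]
      gcongr
      exact hA x
    · rw [hout x hx, hy0]
      simp
  refine (lintegral_le_two_mul_of_le_add_swap hPm (Filter.Eventually.of_forall ?_)).trans_lt ?_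
  · rintro ⟨x, y⟩
    by_cases hx : x ∈ B
    swap
    · have h1 := hfar y x hx
      have e : ‖signedPow n (u y - u x) * (φ y - φ x) * kern s (y - x)‖ₑ =
          ‖signedPow n (u x - u y) * (φ x - φ y) * kern s (x - y)‖ₑ := by
        rw [← neg_sub (u x), signedPow_neg, ← neg_sub (φ x), kern_sub_comm, neg_mul_neg]
      rw [e] at h1
      exact h1.trans (le_add_self.trans (le_add_self.trans le_add_self))
    by_cases hy : y ∈ B
    swap
    · exact (hfar x y hy).trans ((le_add_self.trans le_add_self).trans le_self_add)
    have h3 : ‖signedPow n (u x - u y) * (φ x - φ y) * kern s (x - y)‖ₑ ≤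
        g₁ (x, y) + g₂ (x, y) := by
      have hk := kern_nonneg s (x - y)
      rw [← ofReal_norm, ← ENNReal.ofReal_add (by positivity) (by positivity)]
      apply ENNReal.ofReal_le_ofReal
      rw [norm_mul, norm_mul, Real.norm_eq_abs, abs_signedPow hn0, Real.norm_of_nonneg hk,
        ← add_mul]
      gcongr
      simpa using rpow_mul_rpow_le_add (abs_nonneg (u x - u y)) (norm_nonneg (φ x - φ y)) hn0.le
        zero_le_one
    refine h3.trans (le_trans ?_ le_self_add)
    simp only [P]
    rw [indicator_of_mem (by exact ⟨hx, hy⟩)]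
    gcongr
    exact le_self_add
  · refine ENNReal.mul_lt_top (by simp) ?_
    rw [lintegral_add_left' (hg₁m.indicator (hBm.prod hBm)), lintegral_indicator (hBm.prod hBm),
      lintegral_add_left' hg₂m]
    refine ENNReal.add_lt_top.2 ⟨hug, ENNReal.add_lt_top.2 ⟨hφ, ?_⟩⟩
    refine (lintegral_far_diff_le hs0 hn hδ hM hρ hρR hR hum hu 0 hfm.aemeasurable
      (fun x hx => ?_)).trans_lt ?_
    · rw [add_zero]
      by_contra h'
      exact hx (indicator_of_notMem h' _)
    · rw [hf, lintegral_indicator measurableSet_ball, setLIntegral_const]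
      have h1 : volume (ball x₀ ρ) ≠ ∞ := measure_ball_lt_top.ne
      have h2 := tailConst_ne_top (N := N) n hs0
      unfold tailBound
      finiteness

end TestFunctions

/-! ### The translated equation and its coercivity -/

section DifferenceEquation

variable {N : ℕ}

/-- Neither `L` nor `D` is known to be integrable, so integrals cannot simply be subtracted. Instead
`L + F⁻ ≤ D + F⁺` is integrated in `ℝ≥0∞`, and the equal, finite integrals of `F⁺` and `F⁻` cancel.
-/
lemma lintegral_ofReal_le_of_le_add {X : Type*} [MeasurableSpace X] {μ : Measure X}
    {L F D : X → ℝ} (hF : Integrable F μ) (hF0 : ∫ x, F x ∂μ = 0) (hL : ∀ x, 0 ≤ L x)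
    (h : ∀ᵐ x ∂μ, L x ≤ F x + D x) :
    ∫⁻ x, ENNReal.ofReal (L x) ∂μ ≤ ∫⁻ x, ENNReal.ofReal (D x) ∂μ := by
  have hFm : AEMeasurable (fun x => ENNReal.ofReal (F x)) μ := hF.aemeasurable.ennreal_ofReal
  have hFm' : AEMeasurable (fun x => ENNReal.ofReal (-F x)) μ := hF.aemeasurable.neg.ennreal_ofReal
  have hfin : ∫⁻ x, ENNReal.ofReal (F x) ∂μ ≠ ∞ := hF.lintegral_lt_top.ne
  have hfin' : ∫⁻ x, ENNReal.ofReal (-F x) ∂μ ≠ ∞ := hF.neg.lintegral_lt_top.ne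
  have heq : ∫⁻ x, ENNReal.ofReal (F x) ∂μ = ∫⁻ x, ENNReal.ofReal (-F x) ∂μ := by
    rw [integral_eq_lintegral_pos_part_sub_lintegral_neg_part hF, sub_eq_zero] at hF0
    exact (ENNReal.toReal_eq_toReal_iff' hfin hfin').1 hF0
  have key : ∫⁻ x, (ENNReal.ofReal (L x) + ENNReal.ofReal (-F x)) ∂μ ≤
      ∫⁻ x, (ENNReal.ofReal (D x) + ENNReal.ofReal (F x)) ∂μ := by
    apply lintegral_mono_ae
    filter_upwards [h] with x hx
    rcases le_total 0 (F x) with h0 | h0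
    · rw [ENNReal.ofReal_of_nonpos (neg_nonpos.2 h0), add_zero, add_comm]
      exact (ENNReal.ofReal_le_ofReal hx).trans ENNReal.ofReal_add_le
    · rw [ENNReal.ofReal_of_nonpos h0, add_zero, ← ENNReal.ofReal_add (hL x) (by linarith)]
      exact ENNReal.ofReal_le_ofReal (by linarith)
  rw [lintegral_add_right' _ hFm', lintegral_add_right' _ hFm, heq] at key
  exact (ENNReal.add_le_add_iff_right hfin').1 key

lemma abs_le_one_of_mem_sgnSet {t z : ℝ} (h : z ∈ sgnSet t) : |z| ≤ 1 := by
  obtain ⟨h1, h2, h3⟩ := h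
  rcases lt_trichotomy t 0 with ht | ht | ht
  · simp [h2 ht]
  · exact abs_le.2 ⟨(h3 ht).1, (h3 ht).2⟩
  · simp [h1 ht]

/-- Monotonicity of the multivalued graph. Together with measurability and `|Z| ≤ 1` this is all
that the estimate uses about `Z`. Strict inequality is needed, since at equal arguments two
selections may be ordered either way. -/
lemma sgnSet_mono {b a z z' : ℝ} (h : b < a) (hz : z ∈ sgnSet b) (hz' : z' ∈ sgnSet a) :
    z ≤ z' := by
  have h1 := abs_le.1 (abs_le_one_of_mem_sgnSet hz)
  have h2 := abs_le.1 (abs_le_one_of_mem_sgnSet hz')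
  rcases le_or_gt b 0 with hb | hb
  · rcases hb.lt_or_eq with hb | rfl
    · rw [hz.2.1 hb]; exact h2.1
    · rw [hz'.1 h]; exact h1.2
  · rw [hz'.1 (hb.trans h)]; exact h1.2

/-- The weight that controls the difference of the operator at two points. -/
noncomputable def weight (s₁ s n : ℝ) (u : E N → ℝ) (h : E N) (z : E N × E N) : ℝ :=
  2 * kern s₁ (z.1 - z.2) +
    (|u (z.1 + h) - u (z.2 + h)| ^ n + |u z.1 - u z.2| ^ n) * kern s (z.1 - z.2)

lemma weight_nonneg (s₁ s n : ℝ) (u : E N → ℝ) (h : E N) (z : E N × E N) :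
    0 ≤ weight s₁ s n u h z := by
  have h1 := kern_nonneg s₁ (z.1 - z.2)
  have h2 := kern_nonneg s (z.1 - z.2)
  unfold weight
  positivity

lemma weight_swap (s₁ s n : ℝ) (u : E N → ℝ) (h : E N) (x y : E N) :
    weight s₁ s n u h (y, x) = weight s₁ s n u h (x, y) := by
  simp only [weight]
  rw [kern_sub_comm, kern_sub_comm s, abs_sub_comm, abs_sub_comm (u y)]

lemma aemeasurable_weight (s₁ s n : ℝ) {u : E N → ℝ} (hu : AEStronglyMeasurable u) (h : E N) :
    AEMeasurable (weight s₁ s n u h) := by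
  have h1 : AEMeasurable fun z : E N × E N => |u z.1 - u z.2| :=
    measurable_norm.comp_aemeasurable (aestronglyMeasurable_diff hu).aemeasurable
  have h2 : AEMeasurable fun z : E N × E N => |u (z.1 + h) - u (z.2 + h)| :=
    h1.comp_quasiMeasurePreserving (measurePreserving_prod_translate h).quasiMeasurePreserving
  unfold weight
  exact ((measurable_kern s₁).comp (measurable_fst.sub measurable_snd)).const_mul 2
    |>.aemeasurable.add (((h2.pow_const n).add (h1.pow_const n)).mul
      ((measurable_kern s).comp (measurable_fst.sub measurable_snd)).aemeasurable)

/-- The error due to the cutoff at points that are both near `x₀`. -/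
noncomputable def errNear (s₁ s n m δ : ℝ) (u : E N → ℝ) (h : E N) (B : Set (E N)) :
    E N × E N → ℝ :=
  (B ×ˢ B).indicator fun z =>
    weight s₁ s n u h z * |u (z.1 + h) - u z.1| ^ m * (‖z.1 - z.2‖ / δ)

/-- The error due to the interaction with far away points. -/
noncomputable def errFar (s₁ s n m δ : ℝ) (u : E N → ℝ) (h : E N) (B : Set (E N)) :
    E N × E N → ℝ :=
  {z : E N × E N | δ ≤ ‖z.1 - z.2‖}.indicator fun z =>
    B.indicator (fun x => |u (x + h) - u x| ^ m) z.1 * weight s₁ s n u h z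

lemma errNear_nonneg {s₁ s n m δ : ℝ} (hδ : 0 < δ) (u : E N → ℝ) (h : E N) (B : Set (E N))
    (z : E N × E N) : 0 ≤ errNear s₁ s n m δ u h B z := by
  have := weight_nonneg s₁ s n u h z
  exact indicator_nonneg (fun z _ => by have := weight_nonneg s₁ s n u h z; positivity) z

lemma errFar_nonneg {s₁ s n m δ : ℝ} (u : E N → ℝ) (h : E N) (B : Set (E N))
    (z : E N × E N) : 0 ≤ errFar s₁ s n m δ u h B z :=
  indicator_nonneg (fun z _ => mul_nonneg (indicator_nonneg (fun _ _ => by positivity) _)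
    (weight_nonneg s₁ s n u h z)) z

lemma aemeasurable_increment {u : E N → ℝ} (hu : AEStronglyMeasurable u) (h : E N) :
    AEMeasurable fun x => u (x + h) - u x :=
  (hu.aemeasurable.comp_quasiMeasurePreserving
    (measurePreserving_add_right volume h).quasiMeasurePreserving).sub hu.aemeasurable

lemma aemeasurable_abs_increment {u : E N → ℝ} (hu : AEStronglyMeasurable u) (h : E N) (m : ℝ) :
    AEMeasurable fun x => |u (x + h) - u x| ^ m :=
  (measurable_norm.comp_aemeasurable (aemeasurable_increment hu h)).pow_const m

lemma aemeasurable_errNear (s₁ s n m δ : ℝ) {u : E N → ℝ} (hu : AEStronglyMeasurable u) (h : E N)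
    {B : Set (E N)} (hB : MeasurableSet B) : AEMeasurable (errNear s₁ s n m δ u h B) := by
  refine AEMeasurable.indicator ?_ (hB.prod hB)
  refine ((aemeasurable_weight s₁ s n hu h).mul ?_).mul (by fun_prop)
  exact (aemeasurable_abs_increment hu h m).comp_quasiMeasurePreserving
    Measure.quasiMeasurePreserving_fst

lemma aemeasurable_errFar (s₁ s n m δ : ℝ) {u : E N → ℝ} (hu : AEStronglyMeasurable u) (h : E N)
    {B : Set (E N)} (hB : MeasurableSet B) : AEMeasurable (errFar s₁ s n m δ u h B) := by
  refine AEMeasurable.indicator ?_ (measurableSet_far δ)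
  refine AEMeasurable.mul ?_ (aemeasurable_weight s₁ s n hu h)
  exact ((aemeasurable_abs_increment hu h m).indicator hB).comp_quasiMeasurePreserving
    Measure.quasiMeasurePreserving_fst

/-- The increment of the operator kernel under a translation by `h`. -/
noncomputable def opIncr (s₁ s n : ℝ) (Z : E N × E N → ℝ) (u : E N → ℝ) (h : E N)
    (z : E N × E N) : ℝ :=
  (Z (z.1 + h, z.2 + h) - Z z) * kern s₁ (z.1 - z.2) +
    (signedPow n (u (z.1 + h) - u (z.2 + h)) - signedPow n (u z.1 - u z.2)) * kern s (z.1 - z.2)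

lemma abs_opIncr_le {s₁ s n : ℝ} (hn : 0 < n) {Z : E N × E N → ℝ} {u : E N → ℝ} {h : E N}
    {z : E N × E N} (h1 : |Z z| ≤ 1) (h2 : |Z (z.1 + h, z.2 + h)| ≤ 1) :
    |opIncr s₁ s n Z u h z| ≤ weight s₁ s n u h z := by
  have k1 := kern_nonneg s₁ (z.1 - z.2)
  have k2 := kern_nonneg s (z.1 - z.2)
  unfold opIncr weight
  refine (abs_add_le _ _).trans ?_
  rw [abs_mul, abs_mul, abs_of_nonneg k1, abs_of_nonneg k2]
  gcongr
  · linarith [abs_sub (Z (z.1 + h, z.2 + h)) (Z z)]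
  · refine (abs_sub _ _).trans ?_
    rw [abs_signedPow hn, abs_signedPow hn]

/-- Testing the equation with a test function and its translate. -/
lemma integral_opIncr_mul_eq_zero {s₁ sp n : ℝ} {Ω : Set (E N)} {u : E N → ℝ}
    {Z : E N × E N → ℝ} {h : E N} {φ : E N → ℝ}
    (heq : ∀ φ : E N → ℝ, IsTestFunction s₁ sp (n + 1) Ω φ →
      (∫ z : E N × E N, Z z * (φ z.1 - φ z.2) / ‖z.1 - z.2‖ ^ ((N : ℝ) + s₁)) +
      (∫ z : E N × E N, |u z.1 - u z.2| ^ (n + 1 - 2) * (u z.1 - u z.2) * (φ z.1 - φ z.2) /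
        ‖z.1 - z.2‖ ^ ((N : ℝ) + sp * (n + 1))) = 0)
    (hφ : IsTestFunction s₁ sp (n + 1) Ω φ)
    (hφ' : IsTestFunction s₁ sp (n + 1) Ω fun x => φ (x + -h))
    (hZi : ∀ ψ : E N → ℝ, ψ = φ ∨ ψ = (fun x => φ (x + -h)) →
      Integrable fun z : E N × E N => Z z * (ψ z.1 - ψ z.2) * kern s₁ (z.1 - z.2))
    (hui : ∀ ψ : E N → ℝ, ψ = φ ∨ ψ = (fun x => φ (x + -h)) →
      Integrable fun z : E N × E N => signedPow n (u z.1 - u z.2) * (ψ z.1 - ψ z.2) *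
        kern (sp * (n + 1)) (z.1 - z.2)) :
    Integrable (fun z => opIncr s₁ (sp * (n + 1)) n Z u h z * (φ z.1 - φ z.2)) ∧
      ∫ z, opIncr s₁ (sp * (n + 1)) n Z u h z * (φ z.1 - φ z.2) = 0 := by
  set s := sp * (n + 1) with hs
  have heq' : ∀ ψ : E N → ℝ, IsTestFunction s₁ sp (n + 1) Ω ψ →
      (∫ z : E N × E N, Z z * (ψ z.1 - ψ z.2) * kern s₁ (z.1 - z.2)) +
      (∫ z : E N × E N, signedPow n (u z.1 - u z.2) * (ψ z.1 - ψ z.2) * kern s (z.1 - z.2)) = 0 := by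
    intro ψ hψ
    have := heq ψ hψ
    simpa only [kern, signedPow, Real.rpow_neg (norm_nonneg _), div_eq_mul_inv,
      show n + 1 - 2 = n - 1 by ring] using this
  set F₁ : (E N → ℝ) → E N × E N → ℝ := fun ψ z =>
    Z z * (ψ z.1 - ψ z.2) * kern s₁ (z.1 - z.2) with hF₁
  set F₂ : (E N → ℝ) → E N × E N → ℝ := fun ψ z =>
    signedPow n (u z.1 - u z.2) * (ψ z.1 - ψ z.2) * kern s (z.1 - z.2) with hF₂
  set T : E N × E N → E N × E N := fun z => (z.1 + h, z.2 + h) with hT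
  set ψ : E N → ℝ := fun x => φ (x + -h) with hψ
  have hTm := measurePreserving_prod_translate h
  have hTe := measurableEmbedding_prod_translate h
  have i1 : Integrable (fun z => F₁ φ z) := hZi φ (Or.inl rfl)
  have i2 : Integrable (fun z => F₂ φ z) := hui φ (Or.inl rfl)
  have i3 : Integrable (fun z => F₁ ψ (T z)) :=
    (hTm.integrable_comp_emb hTe).2 (hZi ψ (Or.inr rfl))
  have i4 : Integrable (fun z => F₂ ψ (T z)) :=
    (hTm.integrable_comp_emb hTe).2 (hui ψ (Or.inr rfl))
  -- The test with `φ(· - h)`, after translating both variables by `h`, sees `Z` and `u` at the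
  -- shifted points while the test function becomes `φ` again; the kernels are unchanged.
  have e : (fun z => opIncr s₁ s n Z u h z * (φ z.1 - φ z.2)) =
      fun z => (F₁ ψ (T z) + F₂ ψ (T z)) - (F₁ φ z + F₂ φ z) := by
    ext z
    simp only [opIncr, hF₁, hF₂, hT, hψ, add_neg_cancel_right, add_sub_add_right_eq_sub]
    ring
  rw [e]
  have i12 : Integrable (fun z => F₁ φ z + F₂ φ z) := i1.add i2
  have i34 : Integrable (fun z => F₁ ψ (T z) + F₂ ψ (T z)) := i3.add i4
  refine ⟨i34.sub i12, ?_⟩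
  rw [integral_sub i34 i12, integral_add i3 i4, integral_add i1 i2,
    hTm.integral_comp hTe (F₁ ψ), hTm.integral_comp hTe (F₂ ψ), heq' φ hφ, heq' ψ hφ', sub_zero]

/-- Truncation at height `K`. -/
noncomputable def clip (K t : ℝ) : ℝ := max (-K) (min K t)

lemma abs_clip_le {K : ℝ} (hK : 0 ≤ K) (t : ℝ) : |clip K t| ≤ K := by
  rw [abs_le]
  exact ⟨le_max_left _ _, max_le (by linarith) (min_le_left _ _)⟩

lemma clip_eq {K t : ℝ} (h : |t| ≤ K) : clip K t = t := by
  rw [abs_le] at h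
  rw [clip, min_eq_right h.2, max_eq_right h.1]

lemma abs_clip_sub_le (K a b : ℝ) : |clip K a - clip K b| ≤ |a - b| := by
  unfold clip
  refine (abs_max_sub_max_le_max _ _ _ _).trans (max_le (by simp) ?_)
  exact (abs_min_sub_min_le_max _ _ _ _).trans (max_le (by simp) le_rfl)

lemma measurable_clip (K : ℝ) : Measurable (clip K) := by
  unfold clip
  fun_prop

/-- The pointwise inequality behind the energy estimate. -/
lemma coercivity_le {s₁ s n m δ ρ M : ℝ} (hn : 1 ≤ n) (hm : 1 ≤ m) (hδ : 0 < δ)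
    {Z : E N × E N → ℝ} {u : E N → ℝ} {h x₀ : E N} {z : E N × E N}
    (hZ : Z z ∈ sgnSet (u z.1 - u z.2))
    (hZ' : Z (z.1 + h, z.2 + h) ∈ sgnSet (u (z.1 + h) - u (z.2 + h)))
    (h1 : z.1 ∈ ball x₀ (ρ + δ) → |u (z.1 + h) - u z.1| ≤ M)
    (h2 : z.2 ∈ ball x₀ (ρ + δ) → |u (z.2 + h) - u z.2| ≤ M) {φ : E N → ℝ}
    (hφ : ∀ x, φ x = cutoff x₀ ρ δ x * signedPow m (clip M (u (x + h) - u x))) :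
    2 ^ (2 - (n + m)) * (ball x₀ (ρ - δ) ×ˢ ball x₀ (ρ - δ)).indicator (fun z =>
      |(u (z.1 + h) - u z.1) - (u (z.2 + h) - u z.2)| ^ (n + m) * kern s (z.1 - z.2)) z ≤
      opIncr s₁ s n Z u h z * (φ z.1 - φ z.2) +
      ((errNear s₁ s n m δ u h (ball x₀ (ρ + δ)) z + errFar s₁ s n m δ u h (ball x₀ ρ) z) +
      (errNear s₁ s n m δ u h (ball x₀ (ρ + δ)) z.swap +
        errFar s₁ s n m δ u h (ball x₀ ρ) z.swap)) := by
  obtain ⟨x, y⟩ := z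
  simp only at hZ hZ' h1 h2
  have hn0 : 0 < n := by linarith
  have hm0 : 0 < m := by linarith
  have hW := abs_opIncr_le (s₁ := s₁) (s := s) (u := u) hn0 (abs_le_one_of_mem_sgnSet hZ)
    (abs_le_one_of_mem_sgnSet hZ')
  have hw0 := weight_nonneg s₁ s n u h (x, y)
  set W := opIncr s₁ s n Z u h (x, y) with hWdef
  set w := weight s₁ s n u h (x, y) with hw
  set B := ball x₀ (ρ + δ) with hB
  have nn1 := errNear_nonneg (s₁ := s₁) (s := s) (n := n) (m := m) hδ u h B
  have nn2 := errFar_nonneg (s₁ := s₁) (s := s) (n := n) (m := m) (δ := δ) u h (ball x₀ ρ)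
  have hout : ∀ x ∉ ball x₀ ρ, φ x = 0 := fun x hx => by
    rw [hφ, cutoff_eq_zero hδ hx, zero_mul]
  -- a pair of points one of which is outside of `B`
  have hfar : ∀ x y, y ∉ B → (x ∈ B → |u (x + h) - u x| ≤ M) →
      weight s₁ s n u h (x, y) * |φ x - φ y| ≤ errFar s₁ s n m δ u h (ball x₀ ρ) (x, y) := by
    intro x y hy hx1
    rw [hout y fun h' => hy (ball_subset_ball (by linarith) h'), sub_zero]
    by_cases hx : x ∈ ball x₀ ρ
    · have hxy : δ ≤ ‖x - y‖ := by
        have h1 : ρ + δ ≤ dist y x₀ := by simpa [hB] using hy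
        have h2 := dist_triangle_left y x₀ x
        rw [dist_eq_norm x y] at h2
        linarith [mem_ball.1 hx]
      rw [errFar, indicator_of_mem (by exact hxy), indicator_of_mem (by exact hx), mul_comm, hφ,
        abs_mul, abs_of_nonneg (cutoff_nonneg _ _ _ _), abs_signedPow hm0,
        clip_eq (hx1 (ball_subset_ball (by linarith) hx))]
      gcongr
      · exact weight_nonneg _ _ _ _ _ _
      · exact mul_le_of_le_one_left (by positivity) (cutoff_le_one _ _ _ _)
    · rw [hout x hx, abs_zero, mul_zero]
      exact errFar_nonneg u h _ _
  have hneg : -(w * |φ x - φ y|) ≤ W * (φ x - φ y) := by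
    have : |W * (φ x - φ y)| ≤ w * |φ x - φ y| := by
      rw [abs_mul]; gcongr
    exact (neg_le_neg this).trans (neg_abs_le _)
  have hL0 : (x, y) ∉ B ×ˢ B → (ball x₀ (ρ - δ) ×ˢ ball x₀ (ρ - δ)).indicator (fun z =>
      |(u (z.1 + h) - u z.1) - (u (z.2 + h) - u z.2)| ^ (n + m) * kern s (z.1 - z.2)) (x, y) = 0 :=
    fun hxy => indicator_of_notMem (fun h' => hxy
      ⟨ball_subset_ball (by linarith) h'.1, ball_subset_ball (by linarith) h'.2⟩) _
  by_cases hy : y ∈ B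
  swap
  · rw [hL0 fun h' => hy h'.2]
    have := hfar x y hy h1
    rw [mul_zero]
    linarith [nn1 (x, y), nn1 (Prod.swap (x, y)), nn2 (Prod.swap (x, y))]
  by_cases hx : x ∈ B
  swap
  · rw [hL0 fun h' => hx h'.1]
    have := hfar y x hx h2
    rw [weight_swap, abs_sub_comm] at this
    rw [mul_zero]
    have e : Prod.swap (x, y) = (y, x) := rfl
    rw [e]
    linarith [nn1 (x, y), nn1 (y, x), nn2 (x, y)]
  set ηx := cutoff x₀ ρ δ x
  set ηy := cutoff x₀ ρ δ y
  set Ax := u (x + h) - u x with hAx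
  set Ay := u (y + h) - u y with hAy
  have hηx0 : 0 ≤ ηx := cutoff_nonneg _ _ _ _
  have hηy0 : 0 ≤ ηy := cutoff_nonneg _ _ _ _
  have hφx : φ x = ηx * signedPow m Ax := by rw [hφ, clip_eq (h1 hx)]
  have hφy : φ y = ηy * signedPow m Ay := by rw [hφ, clip_eq (h2 hy)]
  have hk := kern_nonneg s (x - y)
  have hk1 := kern_nonneg s₁ (x - y)
  have hid : (u (x + h) - u (y + h)) - (u x - u y) = Ax - Ay := by rw [hAx, hAy]; ring
  -- `Ax - Ay` measures how much `u x - u y` grows under the translation, so both factors have its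
  -- sign. If it is zero, `Z` may still jump, but then the second factor vanishes.
  have hsig : 0 ≤ (Z (x + h, y + h) - Z (x, y)) * (signedPow m Ax - signedPow m Ay) := by
    rcases lt_trichotomy (u x - u y) (u (x + h) - u (y + h)) with hlt | heq | hlt
    · exact mul_nonneg (sub_nonneg.2 (sgnSet_mono hlt hZ hZ'))
        (sub_nonneg.2 (signedPow_mono hm (by linarith)))
    · rw [show Ax = Ay by linarith]; simp
    · exact mul_nonneg_of_nonpos_of_nonpos (sub_nonpos.2 (sgnSet_mono hlt hZ' hZ))
        (sub_nonpos.2 (signedPow_mono hm (by linarith)))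
  have hmain : 2 ^ (2 - (n + m)) * |Ax - Ay| ^ (n + m) * kern s (x - y) ≤
      W * (signedPow m Ax - signedPow m Ay) := by
    have h3 := signedPow_mul_signedPow_ge hn hm hid
    have h4 := mul_le_mul_of_nonneg_right h3 hk
    have h5 := mul_nonneg hsig hk1
    rw [hWdef, opIncr]
    simp only
    linarith
  have hmain0 : 0 ≤ W * (signedPow m Ax - signedPow m Ay) := le_trans (by positivity) hmain
  -- The mean of the cutoff equals `1` on pairs of the inner ball; on all other pairs the coercive
  -- term is merely nonnegative.
  have hfirst : 2 ^ (2 - (n + m)) * (ball x₀ (ρ - δ) ×ˢ ball x₀ (ρ - δ)).indicator (fun z =>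
      |(u (z.1 + h) - u z.1) - (u (z.2 + h) - u z.2)| ^ (n + m) * kern s (z.1 - z.2)) (x, y) ≤
      W * (signedPow m Ax - signedPow m Ay) * ((ηx + ηy) / 2) := by
    by_cases hxy : (x, y) ∈ ball x₀ (ρ - δ) ×ˢ ball x₀ (ρ - δ)
    · rw [indicator_of_mem hxy, show ηx = 1 from cutoff_eq_one hδ hxy.1,
        show ηy = 1 from cutoff_eq_one hδ hxy.2]
      norm_num
      rw [← mul_assoc]
      exact hmain
    · rw [indicator_of_notMem hxy, mul_zero]
      positivity
  have hsecond : |W * (ηx - ηy) * ((signedPow m Ax + signedPow m Ay) / 2)| ≤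
      errNear s₁ s n m δ u h B (x, y) + errNear s₁ s n m δ u h B (y, x) := by
    rw [errNear, indicator_of_mem (by exact ⟨hx, hy⟩), indicator_of_mem (by exact ⟨hy, hx⟩),
      weight_swap s₁ s n u h x y]
    simp only
    rw [norm_sub_rev y x, ← add_mul, ← mul_add, abs_mul, abs_mul]
    have h6 : |ηx - ηy| ≤ ‖x - y‖ / δ := abs_cutoff_sub_le hδ x y
    have h7 : |(signedPow m Ax + signedPow m Ay) / 2| ≤ |Ax| ^ m + |Ay| ^ m := by
      rw [abs_div, abs_two, ← abs_signedPow hm0, ← abs_signedPow hm0]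
      have := abs_add_le (signedPow m Ax) (signedPow m Ay)
      linarith [abs_nonneg (signedPow m Ax + signedPow m Ay)]
    calc |W| * |ηx - ηy| * |(signedPow m Ax + signedPow m Ay) / 2|
        ≤ w * (‖x - y‖ / δ) * (|Ax| ^ m + |Ay| ^ m) := by gcongr
      _ = _ := by simp only [hw, hAx, hAy]; ring
  -- Symmetric discrete product rule: the mean of the cutoffs multiplies the coercive part, and the
  -- difference of the cutoffs multiplies the mean of the powers, which is an error.
  have hsplit : W * (φ x - φ y) = W * (signedPow m Ax - signedPow m Ay) * ((ηx + ηy) / 2) +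
      W * (ηx - ηy) * ((signedPow m Ax + signedPow m Ay) / 2) := by
    rw [hφx, hφy]; ring
  have e : Prod.swap (x, y) = (y, x) := rfl
  rw [e, hsplit]
  have := (abs_le.1 hsecond).1
  linarith [nn2 (x, y), nn2 (y, x)]

/-- The energy estimate for the increments of a weak solution, in terms of the cutoff errors. -/
lemma energy_le_err (hN : 1 ≤ N) {s₁ sp n m δ ρ M R : ℝ} (hs₁ : 0 < s₁) (hs₁' : s₁ < 1)
    (hsp : 0 < sp) (hsp' : sp < 1)
    (hn : 1 ≤ n) (hm : 1 ≤ m) (hδ : 0 < δ) (hρ : 0 < ρ) (hρR : ρ + 3 * δ ≤ R) (hR : R ≤ 1)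
    {Ω : Set (E N)} {u : E N → ℝ} (hum : AEStronglyMeasurable u)
    (hsol : IsWeakSolution s₁ sp (n + 1) Ω u) {x₀ : E N} (hΩ : closedBall x₀ R ⊆ Ω)
    (hM : 0 ≤ M) (huM : ∀ᵐ y, y ∈ ball x₀ R → |u y| ≤ M) {h : E N} (hh : ‖h‖ ≤ δ) :
    ENNReal.ofReal (2 ^ (2 - (n + m))) * ∫⁻ z in ball x₀ (ρ - δ) ×ˢ ball x₀ (ρ - δ),
      ENNReal.ofReal (|(u (z.1 + h) - u z.1) - (u (z.2 + h) - u z.2)| ^ (n + m) *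
        kern (sp * (n + 1)) (z.1 - z.2)) ≤
    2 * ∫⁻ z, ENNReal.ofReal (errNear s₁ (sp * (n + 1)) n m δ u h (ball x₀ (ρ + δ)) z +
      errFar s₁ (sp * (n + 1)) n m δ u h (ball x₀ ρ) z) := by
  obtain ⟨Z, hZm, hZs, heq⟩ := hsol.weak_eq
  set s := sp * (n + 1) with hs
  have hs0 : 0 < s := by positivity
  have hR0 : 0 < R := by linarith
  have hcomp : CompactlyInside (ball x₀ R) Ω := by
    have : closure (ball x₀ R) = closedBall x₀ R := closure_ball x₀ hR0.ne'
    rw [CompactlyInside, this]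
    exact ⟨isOpen_ball, isCompact_closedBall x₀ R, hΩ⟩
  have hg1 := (hsol.mem_one _ hcomp).2
  have hgp := (hsol.mem_p _ hcomp).2
  have htail : tailInt s n u x₀ R ≠ ∞ := by
    have := hsol.mem_tail.2
    rw [add_sub_cancel_right] at this
    exact tailInt_ne_top hs0 hR0 this
  set K := 2 * M with hK
  have hK0 : 0 ≤ K := by positivity
  -- Truncation makes `θ` bounded everywhere and Lipschitz in the increment. Since `|u| ≤ M` almost
  -- everywhere in `B_R`, the height `2 M` is not reached from above by the increments that matter,
  -- and the truncation is inactive there.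
  set θ : E N → ℝ := fun x => signedPow m (clip K (u (x + h) - u x)) with hθ
  have hθm : AEStronglyMeasurable θ :=
    (((measurable_signedPow m).comp (measurable_clip K)).comp_aemeasurable
      (aemeasurable_increment hum h)).aestronglyMeasurable
  set A := K ^ m with hA
  have hm0 : 0 < m := by linarith
  have hθA : ∀ x, |θ x| ≤ A := fun x => by
    rw [hθ, abs_signedPow hm0]
    exact Real.rpow_le_rpow (abs_nonneg _) (abs_clip_le hK0 _) hm0.le
  set L := 2 * m * K ^ (m - 1) with hL
  have hθL : ∀ x y, |θ x - θ y| ≤ L * (|u (x + h) - u (y + h)| + |u x - u y|) := by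
    intro x y
    refine (abs_signedPow_sub_le hm (abs_clip_le hK0 _) (abs_clip_le hK0 _)).trans ?_
    rw [← hL]
    gcongr
    refine (abs_clip_sub_le _ _ _).trans ?_
    rw [show u (x + h) - u x - (u (y + h) - u y) = (u (x + h) - u (y + h)) - (u x - u y) by ring]
    exact abs_sub _ _
  set φ : E N → ℝ := fun x => cutoff x₀ ρ δ x * θ x with hφ
  have hφm : AEStronglyMeasurable φ := (measurable_cutoff x₀ ρ δ).aestronglyMeasurable.mul hθm
  have hφA : ∀ x, |φ x| ≤ A := fun x => by
    rw [hφ, abs_mul, abs_of_nonneg (cutoff_nonneg _ _ _ _)]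
    exact (mul_le_of_le_one_left (abs_nonneg _) (cutoff_le_one _ _ _ _)).trans (hθA x)
  have hout : ∀ x ∉ ball x₀ ρ, φ x = 0 := fun x hx => by
    simp only [hφ, cutoff_eq_zero hδ hx, zero_mul]
  have hφ1 : gagliardoPow s₁ 1 univ φ < ∞ :=
    gagliardoPow_mul_lt_top hN le_rfl hs₁ hs₁' hum hδ hρ (by linarith) hR hg1 hh hθm (by positivity)
      hθA hθL
  have hφp : gagliardoPow sp (n + 1) univ φ < ∞ :=
    gagliardoPow_mul_lt_top hN (by linarith) hsp hsp' hum hδ hρ (by linarith) hR hgp hh hθm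
      (by positivity) hθA hθL
  -- The translate vanishes outside radius `ρ + δ`, and `integrable_power_term` needs a further `δ`
  -- up to radius `R`.
  set ψ : E N → ℝ := fun x => φ (x + -h) with hψ
  have hψm : AEStronglyMeasurable ψ :=
    hφm.comp_quasiMeasurePreserving (measurePreserving_add_right volume (-h)).quasiMeasurePreserving
  have hψA : ∀ x, |ψ x| ≤ A := fun x => hφA _
  have hψout : ∀ x ∉ ball x₀ (ρ + δ), ψ x = 0 := by
    intro x hx
    refine hout _ fun h' => hx ?_
    rw [mem_ball, dist_eq_norm] at h' ⊢
    calc ‖x - x₀‖ = ‖(x + -h - x₀) + h‖ := by congr 1; abel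
      _ ≤ ‖x + -h - x₀‖ + ‖h‖ := norm_add_le _ _
      _ < ρ + δ := by linarith
  have hψ1 : gagliardoPow s₁ 1 univ ψ < ∞ := by rw [hψ, gagliardoPow_translate]; exact hφ1
  have hψp : gagliardoPow sp (n + 1) univ ψ < ∞ := by rw [hψ, gagliardoPow_translate]; exact hφp
  have hφt : IsTestFunction s₁ sp (n + 1) Ω φ :=
    isTestFunction_of_bounded hφm hφA hout ((closedBall_subset_closedBall (by linarith)).trans hΩ)
      hφ1 hφp
  have hψt : IsTestFunction s₁ sp (n + 1) Ω ψ :=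
    isTestFunction_of_bounded hψm hψA hψout
      ((closedBall_subset_closedBall (by linarith)).trans hΩ) hψ1 hψp
  have hZ1 : ∀ᵐ z, |Z z| ≤ 1 := hZs.mono fun z hz => abs_le_one_of_mem_sgnSet hz
  have hZi : ∀ χ : E N → ℝ, χ = φ ∨ χ = ψ →
      Integrable fun z : E N × E N => Z z * (χ z.1 - χ z.2) * kern s₁ (z.1 - z.2) := by
    rintro χ (rfl | rfl)
    · exact integrable_sign_term hs₁ hφm hφ1 hZm.aestronglyMeasurable hZ1
    · exact integrable_sign_term hs₁ hψm hψ1 hZm.aestronglyMeasurable hZ1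
  have hui : ∀ χ : E N → ℝ, χ = φ ∨ χ = ψ →
      Integrable fun z : E N × E N => signedPow n (u z.1 - u z.2) * (χ z.1 - χ z.2) *
        kern s (z.1 - z.2) := by
    rintro χ (rfl | rfl)
    · exact integrable_power_term hsp hn hδ hM hρ.le (by linarith) hR hum huM hgp htail hφm hφA hout
        hφp
    · exact integrable_power_term hsp hn hδ hM (ρ := ρ + δ) (by linarith) (by linarith) hR hum huM
        hgp htail hψm hψA hψout hψp
  obtain ⟨hint, hint0⟩ := integral_opIncr_mul_eq_zero heq hφt hψt hZi hui
  have hBm : MeasurableSet (ball x₀ (ρ - δ)) := measurableSet_ball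
  have hZs' : ∀ᵐ z : E N × E N, Z (z.1 + h, z.2 + h) ∈ sgnSet (u (z.1 + h) - u (z.2 + h)) :=
    (measurePreserving_prod_translate h).quasiMeasurePreserving.ae hZs
  have hA1 : ∀ᵐ x, x ∈ ball x₀ (ρ + δ) → |u (x + h) - u x| ≤ K := by
    filter_upwards [huM, (measurePreserving_add_right volume h).quasiMeasurePreserving.ae huM]
      with x h1 h2 hx
    have h3 : x + h ∈ ball x₀ R := by
      rw [mem_ball, dist_eq_norm] at hx ⊢
      calc ‖x + h - x₀‖ = ‖(x - x₀) + h‖ := by congr 1; abel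
        _ ≤ ‖x - x₀‖ + ‖h‖ := norm_add_le _ _
        _ < R := by linarith
    have := abs_sub (u (x + h)) (u x)
    linarith [h1 (ball_subset_ball (by linarith) hx), h2 h3]
  have hpt : ∀ᵐ z : E N × E N, 2 ^ (2 - (n + m)) *
      (ball x₀ (ρ - δ) ×ˢ ball x₀ (ρ - δ)).indicator (fun z =>
        |(u (z.1 + h) - u z.1) - (u (z.2 + h) - u z.2)| ^ (n + m) * kern s (z.1 - z.2)) z ≤
      opIncr s₁ s n Z u h z * (φ z.1 - φ z.2) +
      ((errNear s₁ s n m δ u h (ball x₀ (ρ + δ)) z + errFar s₁ s n m δ u h (ball x₀ ρ) z) +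
      (errNear s₁ s n m δ u h (ball x₀ (ρ + δ)) z.swap +
        errFar s₁ s n m δ u h (ball x₀ ρ) z.swap)) := by
    filter_upwards [hZs, hZs', Measure.quasiMeasurePreserving_fst.ae hA1,
      Measure.quasiMeasurePreserving_snd.ae hA1] with z z1 z2 z3 z4
    exact coercivity_le hn hm hδ z1 z2 z3 z4 fun x => rfl
  have h1 := lintegral_ofReal_le_of_le_add hint hint0 (fun z => mul_nonneg (by positivity)
    (indicator_nonneg (fun z _ => mul_nonneg (by positivity) (kern_nonneg _ _)) z)) hpt
  have e1 : ENNReal.ofReal (2 ^ (2 - (n + m))) * ∫⁻ z in ball x₀ (ρ - δ) ×ˢ ball x₀ (ρ - δ),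
      ENNReal.ofReal (|(u (z.1 + h) - u z.1) - (u (z.2 + h) - u z.2)| ^ (n + m) *
        kern s (z.1 - z.2)) = ∫⁻ z, ENNReal.ofReal (2 ^ (2 - (n + m)) *
      (ball x₀ (ρ - δ) ×ˢ ball x₀ (ρ - δ)).indicator (fun z =>
        |(u (z.1 + h) - u z.1) - (u (z.2 + h) - u z.2)| ^ (n + m) * kern s (z.1 - z.2)) z) := by
    rw [← lintegral_indicator (hBm.prod hBm), ← lintegral_const_mul' _ _ ENNReal.ofReal_ne_top]
    refine lintegral_congr fun z => ?_
    rw [ENNReal.ofReal_mul (by positivity)]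
    congr 1
    by_cases hz : z ∈ ball x₀ (ρ - δ) ×ˢ ball x₀ (ρ - δ)
    · rw [indicator_of_mem hz, indicator_of_mem hz]
    · rw [indicator_of_notMem hz, indicator_of_notMem hz, ENNReal.ofReal_zero]
  rw [e1]
  refine h1.trans (lintegral_le_two_mul_of_le_add_swap ?_
    (Filter.Eventually.of_forall fun z => ENNReal.ofReal_add_le))
  exact ((aemeasurable_errNear _ _ _ _ _ hum h measurableSet_ball).add
    (aemeasurable_errFar _ _ _ _ _ hum h measurableSet_ball)).ennreal_ofReal

end DifferenceEquation

/-! ### Bounds for the cutoff errors by the gradient and the tail -/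

section EnergyEstimate

variable {N : ℕ}

lemma add_mem_ball_of_norm_le {x₀ x h : E N} {ρ δ R : ℝ} (hx : x ∈ ball x₀ ρ) (hh : ‖h‖ ≤ δ)
    (hR : ρ + δ ≤ R) : x + h ∈ ball x₀ R := by
  rw [mem_ball, dist_eq_norm] at hx ⊢
  calc ‖x + h - x₀‖ = ‖(x - x₀) + h‖ := by congr 1; abel
    _ ≤ ‖x - x₀‖ + ‖h‖ := norm_add_le _ _
    _ < R := by linarith

lemma ofReal_abs_div_rpow {q t a : ℝ} (hq : 0 ≤ q) (ht : 0 < t) :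
    ENNReal.ofReal ((|a| / t) ^ q) = ENNReal.ofReal (t ^ (-q)) * ‖a‖ₑ ^ q := by
  rw [Real.div_rpow (abs_nonneg _) ht.le, div_eq_mul_inv, ← Real.rpow_neg ht.le, mul_comm,
    ENNReal.ofReal_mul (by positivity), ← ENNReal.ofReal_rpow_of_nonneg (abs_nonneg _) hq,
    ← Real.norm_eq_abs, ofReal_norm]

lemma ofReal_rpow_neg_mul_enorm_rpow {q : ℝ} (hq : 0 ≤ q) {k : E N} (hk : k ≠ 0) :
    ENNReal.ofReal (‖k‖ ^ (-q)) * ‖k‖ₑ ^ q = 1 := by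
  have h0 : 0 < ‖k‖ := norm_pos_iff.2 hk
  rw [← ofReal_norm, ENNReal.ofReal_rpow_of_nonneg h0.le hq, ← ENNReal.ofReal_mul (by positivity),
    ← Real.rpow_add h0, neg_add_cancel, Real.rpow_zero, ENNReal.ofReal_one]

lemma lintegral_increment_le {q δ ρ R : ℝ} (hq : 1 ≤ q) (hρR : ρ + δ < R) {Ω : Set (E N)}
    {u : E N → ℝ} {G : E N → E N} (hu : LocallyIntegrable u) (hG : IsWeakGradient Ω u G) {x₀ : E N}
    (hΩ : closedBall x₀ R ⊆ Ω) {h : E N} (hh : ‖h‖ ≤ δ) (hh0 : h ≠ 0) :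
    ∫⁻ x in ball x₀ ρ, ENNReal.ofReal ((|u (x + h) - u x| / ‖h‖) ^ q) ≤
      ∫⁻ x in ball x₀ R, ‖G x‖ₑ ^ q := by
  have h0 : 0 < ‖h‖ := norm_pos_iff.2 hh0
  have h1 := lintegral_translate_le hu hG hρR hΩ hq h
  have hρδ : ρ ≤ ρ + δ := by linarith
  have hsub : ball x₀ ρ ⊆ ball x₀ (ρ + δ) ∩ {x | x + h ∈ ball x₀ (ρ + δ)} := by
    intro x hx
    have h3 : x + h ∈ ball x₀ (ρ + δ) := add_mem_ball_of_norm_le hx hh le_rfl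
    exact ⟨ball_subset_ball hρδ hx, h3⟩
  have h2 := (lintegral_mono_set (f := fun x => ‖u (x + h) - u x‖ₑ ^ q) hsub).trans h1
  have e : ∫⁻ x in ball x₀ ρ, ENNReal.ofReal ((|u (x + h) - u x| / ‖h‖) ^ q) =
      ENNReal.ofReal (‖h‖ ^ (-q)) * ∫⁻ x in ball x₀ ρ, ‖u (x + h) - u x‖ₑ ^ q := by
    rw [← lintegral_const_mul' _ _ ENNReal.ofReal_ne_top]
    exact lintegral_congr fun x => ofReal_abs_div_rpow (by linarith) h0
  rw [e]
  refine (mul_le_mul_right h2 _).trans_eq ?_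
  rw [← mul_assoc, ofReal_rpow_neg_mul_enorm_rpow (by linarith) hh0, one_mul]

/-- In the variable `k = y - x` the quotient is an ordinary difference quotient of `u`, whose `L^q`
norm is bounded by that of the gradient uniformly in `k`; the kernel `|k|^{κ - N}` remains to be
integrated. The shift by `h` only enlarges the ball by `δ`. -/
lemma setLIntegral_quotient_le {κ q δ ρ R : ℝ} (hq : 1 ≤ q)
    (hρR : ρ + δ < R) (hR : R ≤ 1) {Ω : Set (E N)}
    {u : E N → ℝ} {G : E N → E N} (hu : LocallyIntegrable u) (hG : IsWeakGradient Ω u G) {x₀ : E N}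
    (hΩ : closedBall x₀ R ⊆ Ω) {h : E N} (hh : ‖h‖ ≤ δ) :
    ∫⁻ z in ball x₀ ρ ×ˢ ball x₀ ρ,
      ENNReal.ofReal ((|u (z.1 + h) - u (z.2 + h)| / ‖z.1 - z.2‖) ^ q * kern (-κ) (z.1 - z.2)) ≤
      nearConst N κ * ∫⁻ x in ball x₀ R, ‖G x‖ₑ ^ q := by
  have hum := hu.aestronglyMeasurable
  have hρ1 : ρ ≤ 1 := by linarith [norm_nonneg h]
  refine setLIntegral_prod_le_nearConst_mul hρ1 ?_ ?_
  · have h1 : AEMeasurable fun z : E N × E N => |u (z.1 + h) - u (z.2 + h)| :=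
      measurable_norm.comp_aemeasurable ((aestronglyMeasurable_diff hum).comp_measurePreserving
        (measurePreserving_prod_translate h)).aemeasurable
    have h2 : Measurable fun z : E N × E N => ‖z.1 - z.2‖ := by fun_prop
    exact (((h1.div h2.aemeasurable).pow_const q).mul
      (by fun_prop)).ennreal_ofReal.restrict
  intro k _
  have hq0 : 0 < q := by linarith
  rcases eq_or_ne k 0 with rfl | hk
  · simp [Real.zero_rpow hq0.ne']
  have hk0 : 0 < ‖k‖ := norm_pos_iff.2 hk
  have hm1 : MeasurableSet (ball x₀ ρ ∩ {x | x + k ∈ ball x₀ ρ}) :=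
    measurableSet_ball.inter (measurable_add_const k measurableSet_ball)
  have hm2 : MeasurableSet (ball x₀ (ρ + δ) ∩ {x | x + k ∈ ball x₀ (ρ + δ)}) :=
    measurableSet_ball.inter (measurable_add_const k measurableSet_ball)
  have h1 := lintegral_translate_le hu hG hρR hΩ hq k
  have h2 := setLIntegral_comp_add_right_le hm1 hm2 (k := h) (fun x hx =>
    ⟨add_mem_ball_of_norm_le hx.1 hh le_rfl, by
      have := add_mem_ball_of_norm_le (show x + k ∈ ball x₀ ρ from hx.2) hh le_rfl
      rw [mem_ofPred_eq, add_right_comm]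
      exact this⟩) (fun x => ‖u (x + k) - u x‖ₑ ^ q)
  have e : ∀ x, ENNReal.ofReal ((|u (x + h) - u (x + k + h)| / ‖x - (x + k)‖) ^ q *
      kern (-κ) (x - (x + k))) = ENNReal.ofReal (kern (-κ) k) * (ENNReal.ofReal (‖k‖ ^ (-q)) *
        ‖u (x + h + k) - u (x + h)‖ₑ ^ q) := by
    intro x
    rw [sub_add_cancel_left, kern_neg, norm_neg, mul_comm, ENNReal.ofReal_mul (kern_nonneg _ _),
      ofReal_abs_div_rpow hq0.le hk0, add_right_comm, ← enorm_neg, neg_sub]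
  simp only [e]
  rw [lintegral_const_mul' _ _ ENNReal.ofReal_ne_top, lintegral_const_mul' _ _ ENNReal.ofReal_ne_top]
  gcongr ENNReal.ofReal _ * ?_
  calc _ ≤ ENNReal.ofReal (‖k‖ ^ (-q)) * (‖k‖ₑ ^ q * ∫⁻ x in ball x₀ R, ‖G x‖ₑ ^ q) := by
        gcongr ENNReal.ofReal _ * ?_
        exact h2.trans h1
    _ = _ := by rw [← mul_assoc, ofReal_rpow_neg_mul_enorm_rpow hq0.le hk, one_mul]

/-- The volume of the unit ball. -/
noncomputable def unitVol (N : ℕ) : ℝ≥0∞ := volume (ball (0 : E N) 1)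

lemma unitVol_ne_top : unitVol N ≠ ∞ := measure_ball_lt_top.ne

lemma volume_ball_le {x₀ : E N} {ρ : ℝ} (hρ : ρ ≤ 1) : volume (ball x₀ ρ) ≤ unitVol N := by
  rw [unitVol, ← Measure.addHaar_ball_center volume x₀ 1]
  exact measure_mono (ball_subset_ball hρ)

/-- The factor `|x - y|` comes from the cutoff: it lowers the order of the first kernel to `s₁ - 1`,
and, once `n` powers are absorbed in difference quotients over the pair, that of the second to `s -
n - 1`. Young's inequality with exponents `n` and `m` decouples these quotients from those in the
direction `h`, and `|h|^m` scales out. Writing `x + 0` and `y + 0` puts the untranslated term in the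
form required by `setLIntegral_quotient_le`. -/
lemma weight_mul_le {s₁ s n m : ℝ} (hn : 1 ≤ n) (hm : 1 ≤ m) (u : E N → ℝ) {h x y : E N}
    (hh0 : h ≠ 0) :
    weight s₁ s n u h (x, y) * |u (x + h) - u x| ^ m * ‖x - y‖ ≤ ‖h‖ ^ m *
      (2 * (1 + (|u (x + h) - u x| / ‖h‖) ^ (n + m)) * kern (-(1 - s₁)) (x - y) +
      ((|u (x + h) - u (y + h)| / ‖x - y‖) ^ (n + m) * kern (-(n + 1 - s)) (x - y) +
      ((|u (x + 0) - u (y + 0)| / ‖x - y‖) ^ (n + m) * kern (-(n + 1 - s)) (x - y) +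
        2 * (|u (x + h) - u x| / ‖h‖) ^ (n + m) * kern (-(n + 1 - s)) (x - y)))) := by
  have h0 : 0 < ‖h‖ := norm_pos_iff.2 hh0
  set t := ‖h‖
  set Y := |u (x + h) - u x| / t with hY
  have hY0 : 0 ≤ Y := by positivity
  have hA : |u (x + h) - u x| ^ m = t ^ m * Y ^ m := by
    rw [← Real.mul_rpow h0.le hY0, hY, mul_div_cancel₀ _ h0.ne']
  have k1 := kern_nonneg (-(1 - s₁)) (x - y)
  have k2 := kern_nonneg (-(n + 1 - s)) (x - y)
  rcases eq_or_ne x y with rfl | hxy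
  · rw [sub_self, norm_zero, mul_zero]
    rw [sub_self] at k1 k2
    positivity
  have hz : x - y ≠ 0 := sub_ne_zero.2 hxy
  have hr : 0 < ‖x - y‖ := norm_pos_iff.2 hz
  have e1 : ‖x - y‖ * kern s₁ (x - y) = kern (-(1 - s₁)) (x - y) := by
    have := rpow_mul_kern s₁ 1 hz
    rw [Real.rpow_one] at this
    rw [this, neg_sub]
  have e2 : ∀ b : ℝ, |b| ^ n * kern s (x - y) * ‖x - y‖ =
      (|b| / ‖x - y‖) ^ n * kern (-(n + 1 - s)) (x - y) := by
    intro b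
    rw [neg_sub, ← rpow_mul_kern s (n + 1) hz, Real.div_rpow (abs_nonneg _) hr.le,
      Real.rpow_add hr, Real.rpow_one]
    field_simp
  have y1 : Y ^ m ≤ 1 + Y ^ (n + m) := by
    have := rpow_mul_rpow_le_add zero_le_one hY0 (show 0 ≤ n by linarith) (show 0 ≤ m by linarith)
    simpa using this
  have y2 : ∀ b : ℝ, (|b| / ‖x - y‖) ^ n * Y ^ m ≤ (|b| / ‖x - y‖) ^ (n + m) + Y ^ (n + m) :=
    fun b => rpow_mul_rpow_le_add (by positivity) hY0 (by linarith) (by linarith)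
  rw [hA]
  simp only [weight, add_zero]
  calc (2 * kern s₁ (x - y) + (|u (x + h) - u (y + h)| ^ n + |u x - u y| ^ n) * kern s (x - y)) *
        (t ^ m * Y ^ m) * ‖x - y‖
      = t ^ m * (2 * Y ^ m * (‖x - y‖ * kern s₁ (x - y)) +
        ((|u (x + h) - u (y + h)| ^ n * kern s (x - y) * ‖x - y‖) * Y ^ m +
        (|u x - u y| ^ n * kern s (x - y) * ‖x - y‖) * Y ^ m)) := by ring
    _ = t ^ m * (2 * Y ^ m * kern (-(1 - s₁)) (x - y) +
        (((|u (x + h) - u (y + h)| / ‖x - y‖) ^ n * Y ^ m) * kern (-(n + 1 - s)) (x - y) +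
        ((|u x - u y| / ‖x - y‖) ^ n * Y ^ m) * kern (-(n + 1 - s)) (x - y))) := by
        rw [e1, e2, e2]; ring
    _ ≤ t ^ m * (2 * (1 + Y ^ (n + m)) * kern (-(1 - s₁)) (x - y) +
        (((|u (x + h) - u (y + h)| / ‖x - y‖) ^ (n + m) + Y ^ (n + m)) *
          kern (-(n + 1 - s)) (x - y) +
        ((|u x - u y| / ‖x - y‖) ^ (n + m) + Y ^ (n + m)) * kern (-(n + 1 - s)) (x - y))) := by
        gcongr
        · exact y2 _
        · exact y2 _
    _ = _ := by ring

lemma lintegral_errNear_le (hN : 1 ≤ N) {s₁ s n m δ ρ R : ℝ} (hs₁ : s₁ < 1) (hs : s < n + 1)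
    (hn : 1 ≤ n) (hm : 1 ≤ m) (hδ : 0 < δ) (hρR : ρ + δ < R) (hR : R ≤ 1) {Ω : Set (E N)}
    {u : E N → ℝ} {G : E N → E N} (hu : LocallyIntegrable u) (hG : IsWeakGradient Ω u G) {x₀ : E N}
    (hΩ : closedBall x₀ R ⊆ Ω) {h : E N} (hh : ‖h‖ ≤ δ) (hh0 : h ≠ 0) :
    ∫⁻ z, ENNReal.ofReal (errNear s₁ s n m δ u h (ball x₀ ρ) z) ≤
      ENNReal.ofReal (‖h‖ ^ m) * ENNReal.ofReal (δ ^ (-1 : ℝ)) *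
      ((2 * nearConst N (1 - s₁) + 4 * nearConst N (n + 1 - s)) *
        (unitVol N + ∫⁻ x in ball x₀ R, ‖G x‖ₑ ^ (n + m))) := by
  have hum := hu.aestronglyMeasurable
  have h0 : 0 < ‖h‖ := norm_pos_iff.2 hh0
  set B := ball x₀ ρ
  have hBm : MeasurableSet B := measurableSet_ball
  set q := n + m with hq
  set Λ := ∫⁻ x in ball x₀ R, ‖G x‖ₑ ^ q with hΛ
  have hY := lintegral_increment_le (q := q) (by linarith) hρR hu hG hΩ hh hh0
  set Y : E N → ℝ := fun x => |u (x + h) - u x| / ‖h‖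
  have hYm : AEMeasurable (fun x => ENNReal.ofReal (Y x ^ q)) :=
    (((measurable_norm.comp_aemeasurable (aemeasurable_increment hum h)).div_const _).pow_const
      q).ennreal_ofReal
  set f₁ : E N → ℝ≥0∞ := fun x => ENNReal.ofReal (2 * (1 + Y x ^ q))
  set f₂ : E N → ℝ≥0∞ := fun x => ENNReal.ofReal (2 * Y x ^ q)
  set g : E N → E N × E N → ℝ≥0∞ := fun h z => ENNReal.ofReal
    ((|u (z.1 + h) - u (z.2 + h)| / ‖z.1 - z.2‖) ^ q * kern (-(n + 1 - s)) (z.1 - z.2))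
  have hgm : ∀ h, AEMeasurable (g h) := by
    intro h
    have h1 : AEMeasurable fun z : E N × E N => |u (z.1 + h) - u (z.2 + h)| :=
      measurable_norm.comp_aemeasurable ((aestronglyMeasurable_diff hum).comp_measurePreserving
        (measurePreserving_prod_translate h)).aemeasurable
    have h2 : Measurable fun z : E N × E N => ‖z.1 - z.2‖ := by fun_prop
    exact (((h1.div h2.aemeasurable).pow_const q).mul (by fun_prop)).ennreal_ofReal
  have hF₁m : AEMeasurable fun z : E N × E N =>
      f₁ z.1 * ENNReal.ofReal (kern (-(1 - s₁)) (z.1 - z.2)) := by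
    have h1 : AEMeasurable f₁ :=
      ((((((measurable_norm.comp_aemeasurable (aemeasurable_increment hum h)).div_const
        _).pow_const q)).const_add 1).const_mul 2).ennreal_ofReal
    exact (h1.comp_quasiMeasurePreserving Measure.quasiMeasurePreserving_fst).mul (by fun_prop)
  have hpt : ∀ z : E N × E N, ENNReal.ofReal (errNear s₁ s n m δ u h B z) ≤
      ENNReal.ofReal (‖h‖ ^ m * δ ^ (-1 : ℝ)) * (B ×ˢ B).indicator (fun z =>
        f₁ z.1 * ENNReal.ofReal (kern (-(1 - s₁)) (z.1 - z.2)) + (g h z + (g 0 z +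
          f₂ z.1 * ENNReal.ofReal (kern (-(n + 1 - s)) (z.1 - z.2))))) z := by
    rintro ⟨x, y⟩
    by_cases hz : (x, y) ∈ B ×ˢ B
    swap
    · rw [errNear, indicator_of_notMem hz, ENNReal.ofReal_zero]; exact zero_le
    rw [errNear, indicator_of_mem hz, indicator_of_mem hz]
    have h1 := weight_mul_le (s₁ := s₁) (s := s) hn hm u (x := x) (y := y) hh0
    have k1 := kern_nonneg (-(1 - s₁)) (x - y)
    have k2 := kern_nonneg (-(n + 1 - s)) (x - y)
    have hY0 : 0 ≤ Y x := by positivity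
    simp only [f₁, f₂, g]
    rw [← ENNReal.ofReal_mul (by positivity), ← ENNReal.ofReal_mul (by positivity),
      ← ENNReal.ofReal_add (by positivity) (by positivity),
      ← ENNReal.ofReal_add (by positivity) (by positivity),
      ← ENNReal.ofReal_add (by positivity) (by positivity),
      ← ENNReal.ofReal_mul (by positivity)]
    apply ENNReal.ofReal_le_ofReal
    rw [Real.rpow_neg_one, mul_comm (‖h‖ ^ m), mul_assoc δ⁻¹, ← mul_div_assoc, div_eq_inv_mul]
    exact mul_le_mul_of_nonneg_left h1 (inv_nonneg.2 hδ.le)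
  refine (lintegral_mono hpt).trans ?_
  rw [lintegral_const_mul' _ _ ENNReal.ofReal_ne_top, lintegral_indicator (hBm.prod hBm),
    lintegral_add_left' hF₁m.restrict, lintegral_add_left' (hgm h).restrict,
    lintegral_add_left' (hgm 0).restrict, ← ENNReal.ofReal_mul (by positivity)]
  gcongr ENNReal.ofReal _ * ?_
  have hρ1 : ρ ≤ 1 := by linarith
  have b1 := setLIntegral_prod_mul_kern_near_le hN (show 0 < 1 - s₁ by linarith) (x₀ := x₀) hρ1 f₁
  have b2 := setLIntegral_quotient_le (κ := n + 1 - s) (q := q) (by linarith) hρR hR hu hG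
    hΩ hh
  have b3 := setLIntegral_quotient_le (κ := n + 1 - s) (q := q) (by linarith) hρR hR hu hG
    hΩ (h := 0) (by simpa using hδ.le)
  have b4 := setLIntegral_prod_mul_kern_near_le hN (show 0 < n + 1 - s by linarith) (x₀ := x₀) hρ1 f₂
  have c1 : ∫⁻ x in B, f₁ x ≤ 2 * (unitVol N + Λ) := by
    have e : ∀ x, f₁ x = 2 * (1 + ENNReal.ofReal (Y x ^ q)) := fun x => by
      have hY0 : 0 ≤ Y x := by positivity
      simp only [f₁]
      rw [ENNReal.ofReal_mul (by norm_num), ENNReal.ofReal_add (by norm_num) (by positivity)]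
      simp
    simp_rw [e]
    rw [lintegral_const_mul' _ _ (by simp), lintegral_add_left' aemeasurable_const,
      setLIntegral_const, one_mul]
    gcongr
    exact volume_ball_le hρ1
  have c2 : ∫⁻ x in B, f₂ x ≤ 2 * Λ := by
    have e : ∀ x, f₂ x = 2 * ENNReal.ofReal (Y x ^ q) := fun x => by
      simp only [f₂]
      rw [ENNReal.ofReal_mul (by norm_num)]
      simp
    simp_rw [e]
    rw [lintegral_const_mul' _ _ (by simp)]
    gcongr
  calc _ ≤ nearConst N (1 - s₁) * (2 * (unitVol N + Λ)) + (nearConst N (n + 1 - s) * Λ +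
        (nearConst N (n + 1 - s) * Λ + nearConst N (n + 1 - s) * (2 * Λ))) :=
        add_le_add (b1.trans (by gcongr)) (add_le_add b2 (add_le_add b3 (b4.trans (by gcongr))))
    -- The last term is added to let the sum factor; the `4` counts the two quotient integrals and
    -- the doubled one in the direction `h`.
    _ ≤ nearConst N (1 - s₁) * (2 * (unitVol N + Λ)) + (nearConst N (n + 1 - s) * Λ +
        (nearConst N (n + 1 - s) * Λ + nearConst N (n + 1 - s) * (2 * Λ))) +
        4 * nearConst N (n + 1 - s) * unitVol N := le_self_add
    _ = _ := by ring

lemma ennreal_rpow_mul_rpow_le_add (X Y : ℝ≥0∞) {m n : ℝ} (hm : 0 ≤ m) (hn : 0 ≤ n) :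
    X ^ m * Y ^ n ≤ X ^ (m + n) + Y ^ (m + n) := by
  rcases le_total X Y with h | h
  · calc X ^ m * Y ^ n ≤ Y ^ m * Y ^ n := by gcongr
      _ = Y ^ (m + n) := (ENNReal.rpow_add_of_nonneg m n hm hn).symm
      _ ≤ _ := le_add_self
  · calc X ^ m * Y ^ n ≤ X ^ m * X ^ n := by gcongr
      _ = X ^ (m + n) := (ENNReal.rpow_add_of_nonneg m n hm hn).symm
      _ ≤ _ := le_self_add

/-- Off the diagonal nothing is singular: integrating out `y` leaves a constant or `tailBound`,
times the integral of `|u(x + h) - u(x)|^m`, which is `|h|^m` times that of a difference quotient.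
As `hT` turns `tailBound` into a multiple of `T ^ n`, Young's inequality raises both `T` and the
quotient to the power `n + m`, where the gradient bound applies. -/
lemma lintegral_errFar_le {s₁ s n m δ M ρ R : ℝ} (hs₁ : 0 < s₁) (hs : 0 < s)
    (hn : 1 ≤ n) (hm : 1 ≤ m) (hδ : 0 < δ) (hM : 0 ≤ M) (hρ : 0 < ρ) (hρR : ρ + 2 * δ ≤ R)
    (hR : R ≤ 1) {Ω : Set (E N)}
    {u : E N → ℝ} {G : E N → E N} (hu : LocallyIntegrable u) (hG : IsWeakGradient Ω u G) {x₀ : E N}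
    (hΩ : closedBall x₀ R ⊆ Ω) (huM : ∀ᵐ y, y ∈ ball x₀ R → |u y| ≤ M) {T : ℝ≥0∞}
    (hT : ENNReal.ofReal (M ^ n) + tailInt s n u x₀ R ≤ 2 * ENNReal.ofReal (δ ^ (-s)) * T ^ n)
    {h : E N} (hh : ‖h‖ ≤ δ) (hh0 : h ≠ 0) :
    ∫⁻ z, ENNReal.ofReal (errFar s₁ s n m δ u h (ball x₀ ρ) z) ≤
      ENNReal.ofReal (‖h‖ ^ m) *
      (2 * ENNReal.ofReal (2 ^ ((N : ℝ) + s₁)) * farConst N s₁ *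
        ENNReal.ofReal (δ ^ (-((N : ℝ) + s₁))) *
        (unitVol N + ∫⁻ x in ball x₀ R, ‖G x‖ₑ ^ (n + m)) +
      4 * tailConst N s n * ENNReal.ofReal (δ ^ (-((N : ℝ) + 2 * s))) *
        (T ^ (n + m) * unitVol N + ∫⁻ x in ball x₀ R, ‖G x‖ₑ ^ (n + m))) := by
  have hum := hu.aestronglyMeasurable
  have h0 : 0 < ‖h‖ := norm_pos_iff.2 hh0
  have hρ1 : ρ ≤ 1 := by linarith
  have hn0 : 0 ≤ n := by linarith
  have hm0 : 0 ≤ m := by linarith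
  set B := ball x₀ ρ with hB
  have hBm : MeasurableSet B := measurableSet_ball
  set q := n + m with hq
  set Λ := ∫⁻ x in ball x₀ R, ‖G x‖ₑ ^ q with hΛ
  have hY := lintegral_increment_le (q := q) (ρ := ρ) (δ := δ) (R := R) (by linarith) (by linarith)
    hu hG hΩ hh hh0
  set Y : E N → ℝ := fun x => |u (x + h) - u x| / ‖h‖ with hYdef
  have hY0 : ∀ x, 0 ≤ Y x := fun x => by positivity
  set F : E N → ℝ≥0∞ := B.indicator fun x => ENNReal.ofReal (|u (x + h) - u x| ^ m) with hF
  have hFm : AEMeasurable F := (aemeasurable_abs_increment hum h m).ennreal_ofReal.indicator hBm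
  set D := {z : E N × E N | δ ≤ ‖z.1 - z.2‖} with hD
  have hDm : MeasurableSet D := measurableSet_far δ
  set g : E N → E N × E N → ℝ≥0∞ := fun h => D.indicator fun z => F z.1 *
    ENNReal.ofReal (|u (z.1 + h) - u (z.2 + h)| ^ n * kern s (z.1 - z.2))
  set g₁ : E N × E N → ℝ≥0∞ := D.indicator fun z => F z.1 * ENNReal.ofReal (kern s₁ (z.1 - z.2))
  have hF1 : AEMeasurable fun z : E N × E N => F z.1 :=
    hFm.comp_quasiMeasurePreserving Measure.quasiMeasurePreserving_fst
  have hg₁m : AEMeasurable g₁ := (hF1.mul (by fun_prop)).indicator hDm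
  have hgm : ∀ h, AEMeasurable (g h) := by
    intro h
    refine (hF1.mul ?_).indicator hDm
    simpa using aemeasurable_diff_rpow_kern hum 1 n s h
  have hpt : ∀ z : E N × E N, ENNReal.ofReal (errFar s₁ s n m δ u h B z) ≤
      2 * g₁ z + (g h z + g 0 z) := by
    rintro ⟨x, y⟩
    by_cases hz : (x, y) ∈ D
    swap
    · rw [errFar, indicator_of_notMem hz, ENNReal.ofReal_zero]; exact zero_le
    simp only [g, g₁]
    rw [errFar, indicator_of_mem hz, indicator_of_mem hz, indicator_of_mem hz, indicator_of_mem hz]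
    by_cases hx : x ∈ B
    swap
    · simp [hx]
    have k1 := kern_nonneg s₁ (x - y)
    have k2 := kern_nonneg s (x - y)
    simp only [hF]
    rw [indicator_of_mem hx, indicator_of_mem hx, ENNReal.ofReal_mul (by positivity), weight,
      ENNReal.ofReal_add (by positivity) (by positivity), ENNReal.ofReal_mul (by norm_num), add_mul,
      ENNReal.ofReal_add (by positivity) (by positivity)]
    simp only [add_zero, ENNReal.ofReal_ofNat]
    apply le_of_eq
    ring
  refine (lintegral_mono hpt).trans ?_
  rw [lintegral_add_left' (hg₁m.const_mul 2), lintegral_add_left' (hgm h),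
    lintegral_const_mul' _ _ (by simp)]
  have b1 := setLIntegral_mul_kern_far_le hs₁ hδ (by linarith) F
  rw [← lintegral_indicator hDm] at b1
  have hFB : ∀ x, F x ≠ 0 → x ∈ B := fun x hx => by
    by_contra h'
    exact hx (indicator_of_notMem h' _)
  have b2 := lintegral_far_diff_le (ρ := ρ + δ) hs hn hδ hM (by linarith)
    (by linarith) hR hum huM h hFm (fun x hx => add_mem_ball_of_norm_le (hFB x hx) hh le_rfl)
  have b3 := lintegral_far_diff_le (ρ := ρ + δ) hs hn hδ hM (by linarith)
    (by linarith) hR hum huM 0 hFm (fun x hx =>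
      add_mem_ball_of_norm_le (hFB x hx) (by simpa using hδ.le) le_rfl)
  have hYm : AEMeasurable fun x => ENNReal.ofReal (Y x) :=
    ((measurable_norm.comp_aemeasurable (aemeasurable_increment hum h)).div_const _).ennreal_ofReal
  have eF : ∫⁻ x, F x = ENNReal.ofReal (‖h‖ ^ m) * ∫⁻ x in B, ENNReal.ofReal (Y x) ^ m := by
    rw [hF, lintegral_indicator hBm, ← lintegral_const_mul' _ _ ENNReal.ofReal_ne_top]
    refine lintegral_congr fun x => ?_
    rw [ENNReal.ofReal_rpow_of_nonneg (hY0 x) hm0, ← ENNReal.ofReal_mul (by positivity),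
      ← Real.mul_rpow h0.le (hY0 x), hYdef, mul_div_cancel₀ _ h0.ne']
  have hYq : ∫⁻ x in B, ENNReal.ofReal (Y x) ^ q ≤ Λ := by
    refine le_trans (le_of_eq (lintegral_congr fun x => ?_)) hY
    rw [ENNReal.ofReal_rpow_of_nonneg (hY0 x) (by linarith)]
  have young : ∀ S : ℝ≥0∞, S ^ n * ∫⁻ x in B, ENNReal.ofReal (Y x) ^ m ≤
      S ^ q * unitVol N + Λ := by
    intro S
    rw [← lintegral_const_mul'' _ (hYm.pow_const m).restrict]
    refine (lintegral_mono fun x => ennreal_rpow_mul_rpow_le_add S (ENNReal.ofReal (Y x)) hn0 hm0).trans ?_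
    rw [lintegral_add_left' aemeasurable_const, setLIntegral_const]
    gcongr
    exact volume_ball_le hρ1
  have y1 : ∫⁻ x in B, ENNReal.ofReal (Y x) ^ m ≤ unitVol N + Λ := by
    simpa using young 1
  have y2 := young T
  set I := ∫⁻ x in B, ENNReal.ofReal (Y x) ^ m
  rw [half_rpow_kern_exponent hδ, ENNReal.ofReal_mul (by positivity), eF] at b1
  rw [eF] at b2 b3
  have htb : tailBound s n δ M u x₀ R ≤ 2 * tailConst N s n *
      ENNReal.ofReal (δ ^ (-((N : ℝ) + 2 * s))) * T ^ n := by
    calc tailBound s n δ M u x₀ R ≤ ENNReal.ofReal (δ ^ (-((N : ℝ) + s))) * tailConst N s n *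
          (2 * ENNReal.ofReal (δ ^ (-s)) * T ^ n) := by unfold tailBound; gcongr
      _ = 2 * tailConst N s n * (ENNReal.ofReal (δ ^ (-((N : ℝ) + s))) *
          ENNReal.ofReal (δ ^ (-s))) * T ^ n := by ring
      _ = _ := by
        rw [← ENNReal.ofReal_mul (by positivity), ← Real.rpow_add hδ]
        congr 4
        ring
  set c := ENNReal.ofReal (‖h‖ ^ m)
  set d₁ := ENNReal.ofReal (δ ^ (-((N : ℝ) + s₁)))
  set d₂ := ENNReal.ofReal (δ ^ (-((N : ℝ) + 2 * s)))
  have b23 : tailBound s n δ M u x₀ R * (c * I) ≤ c * (2 * tailConst N s n * d₂ *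
      (T ^ q * unitVol N + Λ)) := by
    calc _ ≤ 2 * tailConst N s n * d₂ * T ^ n * (c * I) := by gcongr
      _ = c * (2 * tailConst N s n * d₂ * (T ^ n * I)) := by ring
      _ ≤ _ := by gcongr
  calc _ ≤ 2 * (ENNReal.ofReal (2 ^ ((N : ℝ) + s₁)) * d₁ * farConst N s₁ * (c * I)) +
        (c * (2 * tailConst N s n * d₂ * (T ^ q * unitVol N + Λ)) +
        c * (2 * tailConst N s n * d₂ * (T ^ q * unitVol N + Λ))) :=
        add_le_add (by gcongr) (add_le_add (b2.trans b23) (b3.trans b23))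
    _ ≤ 2 * (ENNReal.ofReal (2 ^ ((N : ℝ) + s₁)) * d₁ * farConst N s₁ * (c * (unitVol N + Λ))) +
        (c * (2 * tailConst N s n * d₂ * (T ^ q * unitVol N + Λ)) +
        c * (2 * tailConst N s n * d₂ * (T ^ q * unitVol N + Λ))) := by gcongr
    _ = _ := by ring

/-- The constant in the energy estimate. -/
noncomputable def energyConst (N : ℕ) (s₁ s n m : ℝ) : ℝ≥0∞ :=
  ENNReal.ofReal (2 ^ ((n + m) - 2)) * 2 * ((2 * nearConst N (1 - s₁) + 4 * nearConst N (n + 1 - s)) +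
    2 * ENNReal.ofReal (2 ^ ((N : ℝ) + s₁)) * farConst N s₁ + 4 * tailConst N s n) * (unitVol N + 1)

lemma energyConst_ne_top (hN : 1 ≤ N) {s₁ s n m : ℝ} (hs₁ : 0 < s₁) (hs₁' : s₁ < 1) (hs : 0 < s)
    (hs' : s < n + 1) : energyConst N s₁ s n m ≠ ∞ := by
  have h1 := nearConst_ne_top hN (show 0 < 1 - s₁ by linarith)
  have h2 := nearConst_ne_top hN (show 0 < n + 1 - s by linarith)
  have h3 := farConst_ne_top (N := N) hs₁
  have h4 := tailConst_ne_top (N := N) n hs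
  have h5 := unitVol_ne_top (N := N)
  unfold energyConst
  finiteness

/-- The energy estimate for the increments of a weak solution. -/
lemma energy_le (hN : 1 ≤ N) {s₁ sp n m δ ρ M R : ℝ} (hs₁ : 0 < s₁) (hs₁' : s₁ < 1)
    (hsp : 0 < sp) (hsp' : sp < 1)
    (hn : 1 ≤ n) (hm : 1 ≤ m) (hδ : 0 < δ) (hρ : 0 < ρ) (hρR : ρ + 3 * δ ≤ R) (hR : R ≤ 1)
    {Ω : Set (E N)} {u : E N → ℝ} {G : E N → E N} (hu : LocallyIntegrable u)
    (hG : IsWeakGradient Ω u G)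
    (hsol : IsWeakSolution s₁ sp (n + 1) Ω u) {x₀ : E N} (hΩ : closedBall x₀ R ⊆ Ω)
    (hM : 0 ≤ M) (huM : ∀ᵐ y, y ∈ ball x₀ R → |u y| ≤ M) {T : ℝ≥0∞}
    (hT : ENNReal.ofReal (M ^ n) + tailInt (sp * (n + 1)) n u x₀ R ≤
      2 * ENNReal.ofReal (δ ^ (-(sp * (n + 1)))) * T ^ n) {h : E N} (hh : ‖h‖ ≤ δ) :
    ∫⁻ z in ball x₀ (ρ - δ) ×ˢ ball x₀ (ρ - δ),
      ENNReal.ofReal (|(u (z.1 + h) - u z.1) - (u (z.2 + h) - u z.2)| ^ (n + m) *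
        kern (sp * (n + 1)) (z.1 - z.2)) ≤
    energyConst N s₁ (sp * (n + 1)) n m * ENNReal.ofReal (‖h‖ ^ m) *
      (ENNReal.ofReal (δ ^ (-((N : ℝ) + 2 * (n + m)))) *
      (1 + T ^ (n + m) + ∫⁻ x in ball x₀ R, ‖G x‖ₑ ^ (n + m))) := by
  have hN0 : (0 : ℝ) ≤ N := Nat.cast_nonneg N
  -- The bounds for the errors divide by `|h|`; for `h = 0` the left side is zero.
  rcases eq_or_ne h 0 with rfl | hh0
  · have : n + m ≠ 0 := by linarith
    simp [Real.zero_rpow this]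
  set s := sp * (n + 1) with hs
  have hs0 : 0 < s := by positivity
  have hs' : s < n + 1 := by rw [hs]; nlinarith
  have h1 := energy_le_err hN hs₁ hs₁' hsp hsp' hn hm hδ hρ hρR hR hu.aestronglyMeasurable hsol hΩ
    hM huM hh
  have h2 := lintegral_errNear_le hN hs₁' hs' hn hm hδ (ρ := ρ + δ) (by linarith) hR hu hG hΩ hh hh0
  have h3 := lintegral_errFar_le (s₁ := s₁) hs₁ hs0 hn hm hδ hM hρ (by linarith) hR hu hG hΩ huM hT
    hh hh0
  set Λ := ∫⁻ x in ball x₀ R, ‖G x‖ₑ ^ (n + m) with hΛ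
  set d := ENNReal.ofReal (δ ^ (-((N : ℝ) + 2 * (n + m)))) with hd
  have hδ1 : δ ≤ 1 := by linarith
  -- As `δ ≤ 1`, all its negative powers are absorbed in the one with the largest exponent; `2 s ≤ 2
  -- (n + m)` because `s < n + 1 ≤ n + m`.
  have d1 : ENNReal.ofReal (δ ^ (-1 : ℝ)) ≤ d :=
    ENNReal.ofReal_le_ofReal (Real.rpow_le_rpow_of_exponent_ge hδ hδ1 (by linarith))
  have d2 : ENNReal.ofReal (δ ^ (-((N : ℝ) + s₁))) ≤ d :=
    ENNReal.ofReal_le_ofReal (Real.rpow_le_rpow_of_exponent_ge hδ hδ1 (by linarith))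
  have d3 : ENNReal.ofReal (δ ^ (-((N : ℝ) + 2 * s))) ≤ d :=
    ENNReal.ofReal_le_ofReal (Real.rpow_le_rpow_of_exponent_ge hδ hδ1 (by linarith))
  set V := unitVol N
  set Θ := 1 + T ^ (n + m) + Λ with hΘ
  have v1 : V + Λ ≤ (V + 1) * Θ := by
    calc V + Λ ≤ V + Λ + (V * T ^ (n + m) + V * Λ + 1 + T ^ (n + m)) := le_self_add
      _ = _ := by rw [hΘ]; ring
  have v2 : T ^ (n + m) * V + Λ ≤ (V + 1) * Θ := by
    calc T ^ (n + m) * V + Λ ≤ T ^ (n + m) * V + Λ + (V + V * Λ + 1 + T ^ (n + m)) := le_self_add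
      _ = _ := by rw [hΘ]; ring
  set c := ENNReal.ofReal (‖h‖ ^ m)
  set a := ENNReal.ofReal (2 ^ ((N : ℝ) + s₁))
  rw [energyConst]
  set A := 2 * nearConst N (1 - s₁) + 4 * nearConst N (n + 1 - s)
  set e := ENNReal.ofReal (2 ^ (2 - (n + m))) with he
  set e' := ENNReal.ofReal (2 ^ ((n + m) - 2)) with he'
  have hee : e' * e = 1 := by
    rw [he, he', ← ENNReal.ofReal_mul (by positivity), ← Real.rpow_add (by norm_num)]
    simp
  have hsum : ∫⁻ z, ENNReal.ofReal (errNear s₁ s n m δ u h (ball x₀ (ρ + δ)) z +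
      errFar s₁ s n m δ u h (ball x₀ ρ) z) ≤
      c * d * (A * ((V + 1) * Θ)) + c * (2 * a * farConst N s₁ * d * ((V + 1) * Θ) +
        4 * tailConst N s n * d * ((V + 1) * Θ)) := by
    refine (lintegral_mono fun z => ENNReal.ofReal_add_le).trans ?_
    rw [lintegral_add_left' (aemeasurable_errNear _ _ _ _ _ hu.aestronglyMeasurable h
      measurableSet_ball).ennreal_ofReal]
    refine add_le_add (h2.trans ?_) (h3.trans ?_)
    · gcongr
    · gcongr
  calc _ = e' * (e * ∫⁻ z in ball x₀ (ρ - δ) ×ˢ ball x₀ (ρ - δ),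
      ENNReal.ofReal (|(u (z.1 + h) - u z.1) - (u (z.2 + h) - u z.2)| ^ (n + m) *
        kern s (z.1 - z.2))) := by rw [← mul_assoc, hee, one_mul]
    _ ≤ e' * (2 * (c * d * (A * ((V + 1) * Θ)) + c * (2 * a * farConst N s₁ * d * ((V + 1) * Θ) +
        4 * tailConst N s n * d * ((V + 1) * Θ)))) := by
      gcongr e' * ?_
      exact h1.trans (by gcongr)
    _ = _ := by ring

end EnergyEstimate

/-! ### Second differences and the first order Taylor remainder -/

section SecondDifferences

variable {N : ℕ}

/-- The constant in the estimate of increments by the Gagliardo seminorm. -/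
noncomputable def incrConst (N : ℕ) (q s : ℝ) : ℝ≥0∞ :=
  (unitVol N)⁻¹ * ENNReal.ofReal (2 ^ (q + N + s))

lemma unitVol_ne_zero : unitVol N ≠ 0 := (measure_ball_pos volume (0 : E N) one_pos).ne'

lemma incrConst_ne_top (q s : ℝ) : incrConst N q s ≠ ∞ := by
  have := unitVol_ne_zero (N := N)
  unfold incrConst
  finiteness

/-- Increments are controlled by the fractional seminorm. -/
lemma lintegral_increment_le_gagliardo {q s δ ρ : ℝ} (hq : 1 ≤ q) (hs : 0 < s) {w : E N → ℝ}
    (hw : AEStronglyMeasurable w) {x₀ : E N} {k : E N} (hk : ‖k‖ ≤ δ) :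
    ∫⁻ x in ball x₀ (ρ - δ), ‖w (x + k) - w x‖ₑ ^ q ≤
      incrConst N q s * ENNReal.ofReal (‖k‖ ^ s) *
        ∫⁻ z in ball x₀ ρ ×ˢ ball x₀ ρ,
          ENNReal.ofReal (|w z.1 - w z.2| ^ q * kern s (z.1 - z.2)) := by
  have hN : (0 : ℝ) ≤ N := Nat.cast_nonneg N
  have hq0 : 0 < q := by linarith
  rcases eq_or_ne k 0 with rfl | hk0
  · simp [hq0]
  set t := ‖k‖ with ht
  have ht0 : 0 < t := norm_pos_iff.2 hk0
  set B := ball x₀ ρ with hB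
  have hBm : MeasurableSet B := measurableSet_ball
  set H : E N → E N → ℝ≥0∞ := fun x y => ENNReal.ofReal (|w x - w y| ^ q * kern s (x - y)) with hH
  set P : E N → ℝ≥0∞ := fun x => ∫⁻ y in B, H x y with hP
  have hHm : AEMeasurable (fun z : E N × E N => H z.1 z.2) := by
    simpa using aemeasurable_diff_rpow_kern hw 1 q s 0
  have hHm' : AEMeasurable (fun z : E N × E N => H z.1 z.2)
      ((volume.restrict B).prod (volume.restrict B)) := by
    rw [Measure.prod_restrict]
    exact hHm.restrict
  have hPm : AEMeasurable P (volume.restrict B) := hHm'.lintegral_prod_right'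
  have hPint : ∫⁻ x in B, P x = ∫⁻ z in B ×ˢ B, H z.1 z.2 := by
    rw [Measure.volume_eq_prod, ← Measure.prod_restrict, lintegral_prod _ hHm']
  set c := ENNReal.ofReal (2 ^ (q - 1) * (2 * t) ^ ((N : ℝ) + s)) with hc
  have hHle : ∀ x y : E N, ‖x - y‖ ≤ 2 * t →
      ENNReal.ofReal (2 ^ (q - 1) * |w x - w y| ^ q) ≤ c * H x y := by
    intro x y hxy
    rw [hc, hH, ← ENNReal.ofReal_mul (by positivity)]
    apply ENNReal.ofReal_le_ofReal
    rw [mul_assoc]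
    gcongr
    rcases eq_or_ne x y with rfl | hne
    · simp [hq0.ne']
    have h0 : 0 < ‖x - y‖ := norm_pos_iff.2 (sub_ne_zero.2 hne)
    have h1 : 1 ≤ (2 * t) ^ ((N : ℝ) + s) * kern s (x - y) := by
      rw [kern, Real.rpow_neg h0.le, ← div_eq_mul_inv, one_le_div (by positivity)]
      exact Real.rpow_le_rpow h0.le hxy (by positivity)
    calc |w x - w y| ^ q = |w x - w y| ^ q * 1 := (mul_one _).symm
      _ ≤ |w x - w y| ^ q * ((2 * t) ^ ((N : ℝ) + s) * kern s (x - y)) := by gcongr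
      _ = _ := by ring
  -- `w (x + k)` and `w x` are compared through `w y`, with `y` ranging over `B_t(x)`. Such `y` are
  -- within `2 t` of both points, so the kernel is at least `(2 t)^{-N-s}`; dividing by the volume
  -- of the ball leaves the gain `t ^ s`.
  have hx : ∀ x ∈ ball x₀ (ρ - δ), ENNReal.ofReal (t ^ (N : ℝ)) * unitVol N *
      ‖w (x + k) - w x‖ₑ ^ q ≤ c * (P (x + k) + P x) := by
    intro x hx
    have hvol : volume (ball x t) = ENNReal.ofReal (t ^ (N : ℝ)) * unitVol N := by
      rw [Measure.addHaar_ball_of_pos volume x ht0, unitVol, finrank_euclideanSpace, Fintype.card_fin,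
        Real.rpow_natCast]
    have hsub : ball x t ⊆ B := by
      apply ball_subset_ball'
      linarith [mem_ball.1 hx]
    have hmeas : AEMeasurable (fun y => c * H x y) := by
      have h1 : AEMeasurable fun y => |w x - w y| :=
        measurable_norm.comp_aemeasurable (aemeasurable_const.sub hw.aemeasurable)
      exact (((h1.pow_const q).mul (by fun_prop)).ennreal_ofReal).const_mul c
    calc _ = ∫⁻ y in ball x t, ‖w (x + k) - w x‖ₑ ^ q := by
          rw [setLIntegral_const, hvol, mul_comm]
      _ ≤ ∫⁻ y in ball x t, (c * H (x + k) y + c * H x y) := by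
          refine setLIntegral_mono' measurableSet_ball fun y hy => ?_
          have hy' : ‖x - y‖ < t := by rw [← dist_eq_norm, dist_comm]; exact hy
          have h1 := hHle (x + k) y (by
            calc ‖x + k - y‖ = ‖(x - y) + k‖ := by congr 1; abel
              _ ≤ ‖x - y‖ + ‖k‖ := norm_add_le _ _
              _ ≤ 2 * t := by linarith)
          have h2 := hHle x y (by linarith)
          refine le_trans ?_ (add_le_add h1 h2)
          rw [← ENNReal.ofReal_add (by positivity) (by positivity), ← ofReal_norm,
            ENNReal.ofReal_rpow_of_nonneg (norm_nonneg _) hq0.le, ← mul_add]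
          apply ENNReal.ofReal_le_ofReal
          have h3 := abs_sub_rpow_le (a := w (x + k) - w y) (b := w x - w y) hq
          simpa using h3
      _ ≤ ∫⁻ y in B, (c * H (x + k) y + c * H x y) := lintegral_mono_set hsub
      _ = _ := by
          rw [lintegral_add_right' _ hmeas.restrict, lintegral_const_mul' _ _ ENNReal.ofReal_ne_top,
            lintegral_const_mul' _ _ ENNReal.ofReal_ne_top, mul_add]
  have hδ0 : 0 ≤ δ := (norm_nonneg k).trans hk
  have hsubB : ball x₀ (ρ - δ) ⊆ B := ball_subset_ball (by linarith)
  have hint : ENNReal.ofReal (t ^ (N : ℝ)) * unitVol N *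
      ∫⁻ x in ball x₀ (ρ - δ), ‖w (x + k) - w x‖ₑ ^ q ≤
      c * (2 * ∫⁻ z in B ×ˢ B, H z.1 z.2) := by
    rw [← lintegral_const_mul' _ _ (by have := unitVol_ne_top (N := N); finiteness)]
    refine (setLIntegral_mono' measurableSet_ball hx).trans ?_
    rw [lintegral_const_mul' _ _ ENNReal.ofReal_ne_top,
      lintegral_add_right' _ (hPm.mono_measure (Measure.restrict_mono hsubB le_rfl)),
      two_mul (∫⁻ z in B ×ˢ B, H z.1 z.2),
      ← hPint]
    gcongr c * (?_ + ?_)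
    · exact setLIntegral_comp_add_right_le measurableSet_ball hBm
        (fun x hx => add_mem_ball_of_norm_le hx hk (by linarith)) P
    · exact lintegral_mono_set hsubB
  set I := ∫⁻ x in ball x₀ (ρ - δ), ‖w (x + k) - w x‖ₑ ^ q
  have hv0 := unitVol_ne_zero (N := N)
  have hv1 := unitVol_ne_top (N := N)
  have e1 : ENNReal.ofReal (t ^ (-(N : ℝ))) * ENNReal.ofReal (t ^ (N : ℝ)) = 1 := by
    rw [← ENNReal.ofReal_mul (by positivity), ← Real.rpow_add ht0, neg_add_cancel, Real.rpow_zero,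
      ENNReal.ofReal_one]
  calc I = (unitVol N)⁻¹ * ENNReal.ofReal (t ^ (-(N : ℝ))) *
        (ENNReal.ofReal (t ^ (N : ℝ)) * unitVol N * I) := by
        rw [show (unitVol N)⁻¹ * ENNReal.ofReal (t ^ (-(N : ℝ))) *
          (ENNReal.ofReal (t ^ (N : ℝ)) * unitVol N * I) = ((unitVol N)⁻¹ * unitVol N) *
          (ENNReal.ofReal (t ^ (-(N : ℝ))) * ENNReal.ofReal (t ^ (N : ℝ))) * I by ring, e1,
          ENNReal.inv_mul_cancel hv0 hv1, one_mul, one_mul]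
    _ ≤ (unitVol N)⁻¹ * ENNReal.ofReal (t ^ (-(N : ℝ))) *
        (c * (2 * ∫⁻ z in B ×ˢ B, H z.1 z.2)) := by gcongr
    _ = (unitVol N)⁻¹ * (ENNReal.ofReal (t ^ (-(N : ℝ))) * c * 2) *
        ∫⁻ z in B ×ˢ B, H z.1 z.2 := by ring
    _ = _ := by
        have e2 : ENNReal.ofReal (t ^ (-(N : ℝ))) * c * 2 =
            ENNReal.ofReal (2 ^ (q + N + s)) * ENNReal.ofReal (t ^ s) := by
          rw [hc, show (2 : ℝ≥0∞) = ENNReal.ofReal 2 by simp, ← ENNReal.ofReal_mul (by positivity),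
            ← ENNReal.ofReal_mul (by positivity), ← ENNReal.ofReal_mul (by positivity)]
          congr 1
          rw [Real.mul_rpow (by norm_num) ht0.le, Real.rpow_add ht0, Real.rpow_neg ht0.le,
            Real.rpow_sub_one (by norm_num), Real.rpow_add (by norm_num),
            Real.rpow_add (by norm_num), Real.rpow_add (by norm_num)]
          field_simp
        rw [e2, incrConst]
        ring

/-- The mixed second difference. -/
def secondDiff (u : E N → ℝ) (h k x : E N) : ℝ := (u (x + k + h) - u (x + k)) - (u (x + h) - u x)

lemma moll_comp_add (φ : ContDiffBump (0 : E N)) (u : E N → ℝ) (a x : E N) :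
    moll φ (fun y => u (y + a)) x = moll φ u (x + a) := by
  simp only [moll]
  congr 1 with t
  rw [sub_add_eq_add_sub]

lemma moll_sub (φ : ContDiffBump (0 : E N)) {f g : E N → ℝ} (hf : LocallyIntegrable f)
    (hg : LocallyIntegrable g) (x : E N) :
    moll φ (fun y => f y - g y) x = moll φ f x - moll φ g x := by
  simp only [moll, smul_sub]
  exact integral_sub (integrable_normed_smul φ hf x) (integrable_normed_smul φ hg x)

lemma LocallyIntegrable.comp_add {u : E N → ℝ} (hu : LocallyIntegrable u) (a : E N) :
    LocallyIntegrable fun x => u (x + a) := by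
  intro x
  obtain ⟨s, hs, hi⟩ := hu (x + a)
  refine ⟨(fun y => y + a) ⁻¹' s, (continuous_add_const a).continuousAt.preimage_mem_nhds hs, ?_⟩
  exact ((measurePreserving_add_right volume a).integrableOn_comp_preimage
    (MeasurableEquiv.addRight a).measurableEmbedding).2 hi

lemma secondDiff_moll (φ : ContDiffBump (0 : E N)) {u : E N → ℝ} (hu : LocallyIntegrable u)
    (h k x : E N) : secondDiff (moll φ u) h k x = moll φ (secondDiff u h k) x := by
  have e : secondDiff u h k = fun y => (u (y + (k + h)) - u (y + k)) - (u (y + h) - u y) := by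
    ext y
    rw [secondDiff, add_assoc]
  have i1 := LocallyIntegrable.comp_add hu (k + h)
  have i2 := LocallyIntegrable.comp_add hu k
  have i3 := LocallyIntegrable.comp_add hu h
  rw [e, moll_sub φ (f := fun y => u (y + (k + h)) - u (y + k)) (g := fun y => u (y + h) - u y)
    (i1.sub i2) (i3.sub hu), moll_sub φ i1 i2, moll_sub φ i3 hu,
    moll_comp_add, moll_comp_add, moll_comp_add, secondDiff, add_assoc]

lemma aestronglyMeasurable_secondDiff {u : E N → ℝ} (hu : AEStronglyMeasurable u) (h k : E N) :
    AEStronglyMeasurable (secondDiff u h k) := by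
  have h1 := (aemeasurable_increment hu h)
  have h2 := h1.comp_quasiMeasurePreserving
    (measurePreserving_add_right volume k).quasiMeasurePreserving
  exact (h2.sub h1).aestronglyMeasurable

/-- The constant in the first order Taylor expansion. -/
noncomputable def taylorConst (β : ℝ) : ℝ≥0∞ := (1 - ENNReal.ofReal (2 ^ (-β)))⁻¹

lemma taylorConst_ne_top {β : ℝ} (hβ : 0 < β) : taylorConst β ≠ ∞ := by
  rw [taylorConst, ENNReal.inv_ne_top]
  have : ENNReal.ofReal (2 ^ (-β)) < 1 := by
    rw [ENNReal.ofReal_lt_one]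
    exact Real.rpow_lt_one_of_one_lt_of_neg (by norm_num) (by linarith)
  exact (tsub_pos_of_lt this).ne'

/-- Second differences control the error in the first order Taylor expansion. -/
lemma eLpNorm_taylor_le {p : ℝ≥0∞} (hp : 1 ≤ p) {β δ : ℝ} (hβ : 0 < β) {U : E N → ℝ}
    (hU : Continuous U) {H : E N → E N} {S : Set (E N)} (hS : MeasurableSet S)
    (hUH : ∀ x ∈ S, HasFDerivAt U (innerSL ℝ (H x)) x) {κ : ℝ≥0∞}
    (h2 : ∀ h : E N, ‖h‖ ≤ δ → eLpNorm (secondDiff U h h) p (volume.restrict S) ≤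
      κ * ENNReal.ofReal (‖h‖ ^ (1 + β))) {h : E N} (hh : ‖h‖ ≤ δ) :
    eLpNorm (fun x => U (x + h) - U x - inner ℝ (H x) h) p (volume.restrict S) ≤
      κ * ENNReal.ofReal (‖h‖ ^ (1 + β)) * taylorConst β := by
  -- These quotients interpolate between `U (x + h) - U x` at `n = 0` and the directional derivative
  -- in the limit; consecutive ones differ by a rescaled second difference.
  set D : ℕ → E N → ℝ := fun n x => (2 : ℝ) ^ n * (U (x + ((2 : ℝ) ^ n)⁻¹ • h) - U x) with hD
  have hDc : ∀ n, Continuous (D n) := fun n => by fun_prop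
  have hstep : ∀ j, D j - D (j + 1) =
      ((2 : ℝ) ^ j) • secondDiff U (((2 : ℝ) ^ (j + 1))⁻¹ • h) (((2 : ℝ) ^ (j + 1))⁻¹ • h) := by
    intro j
    ext x
    have e : x + ((2 : ℝ) ^ (j + 1))⁻¹ • h + ((2 : ℝ) ^ (j + 1))⁻¹ • h =
        x + ((2 : ℝ) ^ j)⁻¹ • h := by
      rw [add_assoc, ← add_smul]
      congr 2
      rw [pow_succ]; field_simp; norm_num
    simp only [hD, Pi.sub_apply, Pi.smul_apply, smul_eq_mul, secondDiff, e]
    rw [pow_succ]; ring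
  have hstep_le : ∀ j, eLpNorm (D j - D (j + 1)) p (volume.restrict S) ≤
      κ * ENNReal.ofReal (‖h‖ ^ (1 + β)) * ENNReal.ofReal (2 ^ (-β)) ^ j := by
    intro j
    have h2j : (0 : ℝ) < 2 ^ (j + 1) := by positivity
    have hn : ‖((2 : ℝ) ^ (j + 1))⁻¹ • h‖ = ((2 : ℝ) ^ (j + 1))⁻¹ * ‖h‖ := by
      rw [norm_smul, Real.norm_of_nonneg (by positivity)]
    have h1le : ((2 : ℝ) ^ (j + 1))⁻¹ ≤ 1 := inv_le_one_of_one_le₀ (one_le_pow₀ (by norm_num))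
    rw [hstep, eLpNorm_const_smul]
    have := h2 (((2 : ℝ) ^ (j + 1))⁻¹ • h) (by
      rw [hn]; exact (mul_le_of_le_one_left (norm_nonneg _) h1le).trans hh)
    refine (mul_le_mul_right this _).trans ?_
    rw [hn, Real.enorm_of_nonneg (by positivity), ← ENNReal.ofReal_pow (by positivity),
      mul_left_comm, mul_assoc, ← ENNReal.ofReal_mul (by positivity),
      ← ENNReal.ofReal_mul (by positivity)]
    gcongr κ * ?_
    apply ENNReal.ofReal_le_ofReal
    rw [Real.mul_rpow (by positivity) (norm_nonneg _)]
    -- The rescaling costs `2 ^ j`, but the order `1 + β` of the second differences exceeds `1`, so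
    -- the telescoping sum is dominated by a geometric series of ratio `2 ^ (-β)`.
    have e3 : (2 : ℝ) ^ j * ((2 : ℝ) ^ (j + 1))⁻¹ ^ (1 + β) ≤ (2 ^ (-β)) ^ j := by
      have a1 : (2 : ℝ) ^ j = 2 ^ (j : ℝ) := (Real.rpow_natCast 2 j).symm
      have a2 : ((2 : ℝ) ^ (j + 1))⁻¹ = 2 ^ (-((j : ℝ) + 1)) := by
        rw [Real.rpow_neg (by norm_num), ← Real.rpow_natCast]
        push_cast
        rfl
      rw [a1, a2, ← Real.rpow_natCast, ← Real.rpow_mul (by norm_num), ← Real.rpow_mul (by norm_num),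
        ← Real.rpow_add (by norm_num)]
      apply Real.rpow_le_rpow_of_exponent_le (by norm_num)
      nlinarith
    calc _ = ‖h‖ ^ (1 + β) * ((2 : ℝ) ^ j * ((2 : ℝ) ^ (j + 1))⁻¹ ^ (1 + β)) := by ring
      _ ≤ _ := by gcongr
  have hn : ∀ n, eLpNorm (fun x => D 0 x - D n x) p (volume.restrict S) ≤
      κ * ENNReal.ofReal (‖h‖ ^ (1 + β)) * taylorConst β := by
    intro n
    have e : (fun x => D 0 x - D n x) = ∑ j ∈ Finset.range n, (D j - D (j + 1)) := by
      rw [Finset.sum_range_sub']; rfl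
    rw [e]
    refine (eLpNorm_sum_le (fun j _ =>
      ((hDc j).sub (hDc (j + 1))).aestronglyMeasurable) hp).trans ?_
    refine (Finset.sum_le_sum fun j _ => hstep_le j).trans ?_
    rw [← Finset.mul_sum, taylorConst, ← ENNReal.tsum_geometric]
    gcongr
    exact ENNReal.sum_le_tsum _
  have hlim : ∀ᵐ x ∂(volume.restrict S), Tendsto (fun n => D 0 x - D n x) atTop
      (𝓝 (U (x + h) - U x - inner ℝ (H x) h)) := by
    filter_upwards [ae_restrict_mem hS] with x hx
    have e0 : D 0 x = U (x + h) - U x := by simp [hD]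
    rw [e0]
    apply Tendsto.const_sub
    have hc : Tendsto (fun n : ℕ => ‖(2 : ℝ) ^ n‖) atTop atTop := by
      simpa using tendsto_pow_atTop_atTop_of_one_lt (one_lt_two : (1 : ℝ) < 2)
    have := (hUH x hx).lim h hc
    rw [innerSL_apply_apply] at this
    exact this
  refine (Lp.eLpNorm_lim_le_liminf_eLpNorm (fun n =>
    ((hDc 0).sub (hDc n)).aestronglyMeasurable) _ hlim).trans ?_
  exact (liminf_le_liminf (Eventually.of_forall hn)).trans_eq (liminf_const _)

end SecondDifferences

/-! ### From second differences to increments of the gradient -/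

section GradientIncrements

variable {N : ℕ}

lemma eLpNorm_ofReal_eq {X F : Type*} [MeasurableSpace X] [NormedAddCommGroup F] {μ : Measure X}
    {q : ℝ} (hq : 0 < q) (f : X → F) :
    eLpNorm f (ENNReal.ofReal q) μ = (∫⁻ x, ‖f x‖ₑ ^ q ∂μ) ^ (1 / q) := by
  rw [eLpNorm_eq_lintegral_rpow_enorm_toReal (by simpa using hq) ENNReal.ofReal_ne_top,
    ENNReal.toReal_ofReal hq.le]

lemma eLpNorm_ofReal_rpow {X F : Type*} [MeasurableSpace X] [NormedAddCommGroup F] {μ : Measure X}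
    {q : ℝ} (hq : 0 < q) (f : X → F) :
    eLpNorm f (ENNReal.ofReal q) μ ^ q = ∫⁻ x, ‖f x‖ₑ ^ q ∂μ := by
  rw [eLpNorm_ofReal_eq hq, ← ENNReal.rpow_mul, one_div_mul_cancel hq.ne', ENNReal.rpow_one]

lemma eLpNorm_comp_add_le {F : Type*} [NormedAddCommGroup F] {q : ℝ} (hq : 0 < q)
    {S S' : Set (E N)} (hS : MeasurableSet S) (hS' : MeasurableSet S') {k : E N}
    (h : ∀ x ∈ S, x + k ∈ S') (f : E N → F) :
    eLpNorm (fun x => f (x + k)) (ENNReal.ofReal q) (volume.restrict S) ≤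
      eLpNorm f (ENNReal.ofReal q) (volume.restrict S') := by
  rw [eLpNorm_ofReal_eq hq, eLpNorm_ofReal_eq hq]
  exact ENNReal.rpow_le_rpow (setLIntegral_comp_add_right_le hS hS' h fun x => ‖f x‖ₑ ^ q)
    (by positivity)

/-- Second differences control the increments of the gradient. -/
lemma eLpNorm_gradient_increment_le {q β δ : ℝ} (hq : 1 ≤ q) (hβ : 0 < β) {U : E N → ℝ}
    (hU : Continuous U) {H : E N → E N} (hH : Continuous H) {S S₀ : Set (E N)}
    (hS : MeasurableSet S) (hS₀ : MeasurableSet S₀) (hSS : S₀ ⊆ S)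
    (hUH : ∀ x ∈ S, HasFDerivAt U (innerSL ℝ (H x)) x) {κ : ℝ≥0∞}
    (h2 : ∀ h k : E N, ‖h‖ ≤ δ → ‖k‖ = ‖h‖ →
      eLpNorm (secondDiff U h k) (ENNReal.ofReal q) (volume.restrict S) ≤
        κ * ENNReal.ofReal (‖h‖ ^ (1 + β))) {k : E N} (hk : ‖k‖ ≤ δ)
    (hSk : ∀ x ∈ S₀, x + k ∈ S) :
    eLpNorm (fun x => H (x + k) - H x) (ENNReal.ofReal q) (volume.restrict S₀) ≤
      N * (1 + 2 * taylorConst β) * κ * ENNReal.ofReal (‖k‖ ^ β) := by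
  have hq0 : 0 < q := by linarith
  have hp : 1 ≤ ENNReal.ofReal q := by simpa using hq
  rcases eq_or_ne k 0 with rfl | hk0
  · have : (fun x => H (x + 0) - H x) = fun _ => (0 : E N) := by ext; simp
    rw [this]
    simp
  set t := ‖k‖ with ht
  have ht0 : 0 < t := norm_pos_iff.2 hk0
  have hmono : ∀ f : E N → ℝ, eLpNorm f (ENNReal.ofReal q) (volume.restrict S₀) ≤
      eLpNorm f (ENNReal.ofReal q) (volume.restrict S) := fun f =>
    eLpNorm_mono_measure f (Measure.restrict_mono hSS le_rfl)
  have hcomp : ∀ i : Fin N, eLpNorm (fun x => (H (x + k) - H x) i) (ENNReal.ofReal q)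
      (volume.restrict S₀) ≤ (1 + 2 * taylorConst β) * κ * ENNReal.ofReal (t ^ β) := by
    intro i
    -- A step in the `i`-th direction with the length of `k`: the bound on mixed differences
    -- applies, and the linear part of the expansion is `t` times the `i`-th component of the
    -- gradient.
    set h : E N := t • EuclideanSpace.single i (1 : ℝ) with hh
    have hnh : ‖h‖ = t := by
      rw [hh, norm_smul, Real.norm_of_nonneg ht0.le]; simp
    set Rm : E N → ℝ := fun x => U (x + h) - U x - inner ℝ (H x) h with hRm
    have hRc : Continuous Rm := by fun_prop
    have hin : ∀ v : E N, inner ℝ v h = t * v i := by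
      intro v
      rw [hh, real_inner_smul_right, EuclideanSpace.inner_single_right]
      simp
    -- Subtracting the Taylor expansions at `x + k` and at `x`: the increments of `U` combine to the
    -- mixed second difference, and the linear parts to `t` times the increment of the component.
    have e : (fun x => (H (x + k) - H x) i) = (t⁻¹ : ℝ) • fun x =>
        (secondDiff U h k x - Rm (x + k)) + Rm x := by
      ext x
      simp only [Pi.smul_apply, smul_eq_mul, hRm, secondDiff, hin, PiLp.sub_apply]
      field_simp
      ring
    have hT := eLpNorm_taylor_le hp hβ hU hS hUH (κ := κ) (δ := δ) (fun h' hh' => h2 h' h' hh' rfl)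
      (h := h) (by rw [hnh]; exact hk)
    have hsc : Continuous (secondDiff U h k) := by unfold secondDiff; fun_prop
    rw [hnh] at hT
    have b1 := (hmono _).trans (h2 h k (by rw [hnh]; exact hk) (by rw [hnh]))
    rw [hnh] at b1
    have b2 := (eLpNorm_comp_add_le hq0 hS₀ hS hSk Rm).trans hT
    have b3 := (hmono Rm).trans hT
    have hRc' : Continuous fun x => Rm (x + k) := by fun_prop
    rw [e, eLpNorm_const_smul]
    have htri : eLpNorm (fun x => (secondDiff U h k x - Rm (x + k)) + Rm x) (ENNReal.ofReal q)
        (volume.restrict S₀) ≤ κ * ENNReal.ofReal (t ^ (1 + β)) +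
        κ * ENNReal.ofReal (t ^ (1 + β)) * taylorConst β +
        κ * ENNReal.ofReal (t ^ (1 + β)) * taylorConst β := by
      refine (eLpNorm_add_le (hsc.sub hRc').aestronglyMeasurable hRc.aestronglyMeasurable hp).trans ?_
      gcongr
      refine (eLpNorm_sub_le hsc.aestronglyMeasurable hRc'.aestronglyMeasurable hp).trans ?_
      gcongr
    have et : ‖t⁻¹‖ₑ * ENNReal.ofReal (t ^ (1 + β)) = ENNReal.ofReal (t ^ β) := by
      rw [Real.enorm_of_nonneg (by positivity), ← ENNReal.ofReal_mul (by positivity),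
        Real.rpow_add ht0, Real.rpow_one, inv_mul_cancel_left₀ ht0.ne']
    calc _ ≤ ‖t⁻¹‖ₑ * (κ * ENNReal.ofReal (t ^ (1 + β)) +
        κ * ENNReal.ofReal (t ^ (1 + β)) * taylorConst β +
        κ * ENNReal.ofReal (t ^ (1 + β)) * taylorConst β) := by gcongr
      _ = (1 + 2 * taylorConst β) * κ * (‖t⁻¹‖ₑ * ENNReal.ofReal (t ^ (1 + β))) := by ring
      _ = _ := by rw [et]
  have hsum : (fun x => H (x + k) - H x) = ∑ i : Fin N, fun x =>
      (H (x + k) - H x) i • EuclideanSpace.single i (1 : ℝ) := by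
    ext x j
    simp [Finset.sum_apply, Pi.single_apply]
  rw [hsum]
  refine (eLpNorm_sum_le (fun i _ => ?_) hp).trans ?_
  · have : Continuous fun x => (H (x + k) - H x) i • EuclideanSpace.single i (1 : ℝ) := by fun_prop
    exact this.aestronglyMeasurable
  · calc _ ≤ ∑ i : Fin N, (1 + 2 * taylorConst β) * κ * ENNReal.ofReal (t ^ β) := by
          refine Finset.sum_le_sum fun i _ => le_trans (eLpNorm_mono fun x => ?_) (hcomp i)
          rw [norm_smul]; simp
      _ = _ := by simp [mul_assoc]

/-- The constant in the estimate of the increments of the gradient. -/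
noncomputable def gradConst (N : ℕ) (q s σ : ℝ) : ℝ≥0∞ :=
  (N * (1 + 2 * taylorConst (σ / q))) ^ q * incrConst N q s

lemma gradConst_ne_top {q s σ : ℝ} (hq : 0 < q) (hσ : 0 < σ) : gradConst N q s σ ≠ ∞ := by
  have h1 := taylorConst_ne_top (div_pos hσ hq)
  have h2 := incrConst_ne_top (N := N) q s
  unfold gradConst
  refine ENNReal.mul_ne_top (ENNReal.rpow_ne_top_of_nonneg hq.le ?_) h2
  finiteness

/-- The energy estimate for the increments of a function controls the increments of its weak
gradient. -/
lemma lintegral_weakGradient_increment_le {q s m σ δ r R : ℝ} (hq : 1 ≤ q) (hs : 0 < s)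
    (hσ : 0 < σ) (hsm : s + m = q + σ) (hδ : 0 < δ) (hrR : r + 3 * δ ≤ R) {Ω : Set (E N)}
    {u : E N → ℝ} {G : E N → E N} (hu : LocallyIntegrable u) (hG : IsWeakGradient Ω u G) {x₀ : E N}
    (hΩ : closedBall x₀ R ⊆ Ω) {K : ℝ≥0∞}
    (hen : ∀ h : E N, ‖h‖ ≤ δ → ∫⁻ z in ball x₀ (r + 3 * δ) ×ˢ ball x₀ (r + 3 * δ),
      ENNReal.ofReal (|(u (z.1 + h) - u z.1) - (u (z.2 + h) - u z.2)| ^ q *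
        kern s (z.1 - z.2)) ≤ K * ENNReal.ofReal (‖h‖ ^ m)) {k : E N} (hk : ‖k‖ ≤ δ) :
    ∫⁻ x in ball x₀ r, ‖G (x + k) - G x‖ₑ ^ q ≤
      gradConst N q s σ * K * ENNReal.ofReal (‖k‖ ^ σ) := by
  have hq0 : 0 < q := by linarith
  set β := σ / q with hβ
  have hβ0 : 0 < β := div_pos hσ hq0
  set κ := (incrConst N q s * K) ^ (1 / q) with hκ
  set Kc := closedBall x₀ R with hKc
  have hKcc : IsCompact Kc := isCompact_closedBall x₀ R
  have hGK : LocallyIntegrable (Kc.indicator G) :=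
    ((hG.2.1.integrableOn_compact_subset hΩ hKcc).integrable_indicator
      hKcc.measurableSet).locallyIntegrable
  set φ := bumpSeq N δ hδ
  have hφ : ∀ n, (φ n).rOut ≤ δ := bumpSeq_rOut_le hδ
  -- The energy contributes `|h|^m` and the passage to increments contributes `|k|^s`; for steps of
  -- equal length they multiply to `|h|^{q + σ}`, more than the power `q` that a gradient alone
  -- would give.
  have hsd : ∀ h k : E N, ‖h‖ ≤ δ → ‖k‖ = ‖h‖ →
      ∫⁻ x in ball x₀ (r + 2 * δ), ‖secondDiff u h k x‖ₑ ^ q ≤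
      incrConst N q s * K * ENNReal.ofReal (‖h‖ ^ (q + σ)) := by
    intro h k hh hkh
    have h1 := lintegral_increment_le_gagliardo (ρ := r + 3 * δ) (δ := δ) (k := k) hq hs
      (aemeasurable_increment hu.aestronglyMeasurable h).aestronglyMeasurable (x₀ := x₀)
      (by rw [hkh]; exact hh)
    rw [show r + 3 * δ - δ = r + 2 * δ by ring] at h1
    calc _ ≤ _ := h1
      _ ≤ incrConst N q s * ENNReal.ofReal (‖k‖ ^ s) * (K * ENNReal.ofReal (‖h‖ ^ m)) := by
          gcongr
          exact hen h hh
      _ = incrConst N q s * K * (ENNReal.ofReal (‖k‖ ^ s) * ENNReal.ofReal (‖h‖ ^ m)) := by ring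
      _ = _ := by
          rcases eq_or_ne h 0 with rfl | hh0
          · have hk0 : ‖k‖ = 0 := by simpa using hkh
            rw [hk0, norm_zero, Real.zero_rpow hs.ne',
              Real.zero_rpow (show q + σ ≠ 0 by positivity)]
            simp
          · have h0 : 0 < ‖h‖ := norm_pos_iff.2 hh0
            rw [hkh, ← ENNReal.ofReal_mul (by positivity), ← Real.rpow_add h0, hsm]
  have hn : ∀ n, eLpNorm (fun x => moll (φ n) (Kc.indicator G) (x + k) -
      moll (φ n) (Kc.indicator G) x) (ENNReal.ofReal q) (volume.restrict (ball x₀ r)) ≤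
      N * (1 + 2 * taylorConst β) * κ * ENNReal.ofReal (‖k‖ ^ β) := by
    intro n
    refine eLpNorm_gradient_increment_le (S := ball x₀ (r + δ)) (δ := δ) hq hβ0
      (continuous_moll (φ n) hu) (continuous_moll (φ n) hGK) measurableSet_ball measurableSet_ball
      (ball_subset_ball (by linarith)) (fun x hx => hasFDerivAt_moll hu hG hKcc hΩ (φ n) ?_)
      ?_ hk (fun x hx => add_mem_ball_of_norm_le hx hk le_rfl)
    · apply closedBall_subset_closedBall'
      linarith [hφ n, mem_ball.1 hx]
    -- Second differences commute with mollification, which does not increase the `L^q` norm up to a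
    -- loss of `δ` in the radius; the bound is thus uniform in `n`.
    · intro h k hh hkh
      have e : secondDiff (moll (φ n) u) h k = moll (φ n) (secondDiff u h k) :=
        funext fun x => secondDiff_moll (φ n) hu h k x
      have h1 := (lintegral_moll_rpow_le (φ n)
        (aestronglyMeasurable_secondDiff hu.aestronglyMeasurable h k) hq
        (measurableSet_ball (x := x₀) (ε := r + δ)) (measurableSet_ball (x := x₀) (ε := r + 2 * δ))
        (fun x hx t ht => by
          rw [sub_eq_add_neg]
          exact add_mem_ball_of_norm_le hx (δ := δ) (by rw [norm_neg]; linarith [hφ n])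
            (by linarith))).trans (hsd h k hh hkh)
      rw [e, eLpNorm_ofReal_eq hq0]
      refine (ENNReal.rpow_le_rpow h1 (by positivity)).trans_eq ?_
      rw [ENNReal.mul_rpow_of_nonneg _ _ (by positivity),
        ENNReal.ofReal_rpow_of_nonneg (by positivity) (by positivity),
        ← Real.rpow_mul (norm_nonneg _)]
      congr 3
      rw [hβ]; field_simp
  have hlim := tendsto_moll_bumpSeq hδ hGK
  have hlimk : ∀ᵐ x, Tendsto (fun n => moll (φ n) (Kc.indicator G) (x + k)) atTop
      (𝓝 (Kc.indicator G (x + k))) :=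
    (measurePreserving_add_right volume k).quasiMeasurePreserving.ae hlim
  have hfin : eLpNorm (fun x => G (x + k) - G x) (ENNReal.ofReal q) (volume.restrict (ball x₀ r)) ≤
      N * (1 + 2 * taylorConst β) * κ * ENNReal.ofReal (‖k‖ ^ β) := by
    refine (Lp.eLpNorm_lim_le_liminf_eLpNorm (f := fun n x => moll (φ n) (Kc.indicator G) (x + k) -
      moll (φ n) (Kc.indicator G) x) (fun n => ?_) _ ?_).trans
      ((liminf_le_liminf (Eventually.of_forall hn)).trans_eq (liminf_const _))
    · have := continuous_moll (φ n) hGK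
      have h3 : Continuous fun x => moll (φ n) (Kc.indicator G) (x + k) -
        moll (φ n) (Kc.indicator G) x := by fun_prop
      exact h3.aestronglyMeasurable
    · filter_upwards [ae_restrict_of_ae hlim, ae_restrict_of_ae hlimk,
        ae_restrict_mem measurableSet_ball] with x h1 h2 hx
      have hx1 : x ∈ Kc := ball_subset_closedBall (ball_subset_ball (by linarith) hx)
      have hx2 : x + k ∈ Kc :=
        ball_subset_closedBall (add_mem_ball_of_norm_le hx hk (by linarith))
      rw [indicator_of_mem hx1] at h1
      rw [indicator_of_mem hx2] at h2
      exact h2.sub h1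
  rw [← eLpNorm_ofReal_rpow hq0]
  refine (ENNReal.rpow_le_rpow hfin hq0.le).trans_eq ?_
  rw [ENNReal.mul_rpow_of_nonneg _ _ hq0.le, ENNReal.mul_rpow_of_nonneg _ _ hq0.le, hκ,
    ← ENNReal.rpow_mul, one_div_mul_cancel hq0.ne', ENNReal.rpow_one,
    ENNReal.ofReal_rpow_of_nonneg (by positivity) hq0.le, ← Real.rpow_mul (norm_nonneg _), hβ,
    div_mul_cancel₀ _ hq0.ne', gradConst]
  ring

end GradientIncrements

/-! ### Gagliardo seminorms: estimates from increments and localization -/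

section Gagliardo

variable {N : ℕ} {F : Type*} [NormedAddCommGroup F]

lemma gagliardoPow_congr {γ q : ℝ} {V : Set (E N)} (hV : MeasurableSet V) {f g : E N → F}
    (h : ∀ x ∈ V, f x = g x) : gagliardoPow γ q V f = gagliardoPow γ q V g := by
  refine setLIntegral_congr_fun hV fun x hx => setLIntegral_congr_fun hV fun y hy => ?_
  rw [h x hx, h y hy]

/-- The part of the Gagliardo seminorm that comes from points at a distance. -/
lemma setLIntegral_far_kern_le {q a δ : ℝ} (hq : 1 ≤ q) (ha : 0 < a) (hδ : 0 < δ) {V : Set (E N)}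
    (hV : MeasurableSet V) {f : E N → F} (hf : AEStronglyMeasurable f) :
    ∫⁻ z in (V ×ˢ V) ∩ {z | δ ≤ ‖z.1 - z.2‖},
      ENNReal.ofReal (‖f z.1 - f z.2‖ ^ q * kern a (z.1 - z.2)) ≤
      ENNReal.ofReal (δ ^ (-((N : ℝ) + a))) * ENNReal.ofReal (2 ^ q) *
        (volume V * ∫⁻ x in V, ‖f x‖ₑ ^ q) := by
  have hN : (0 : ℝ) ≤ N := Nat.cast_nonneg N
  have hq0 : 0 < q := by linarith
  have hfm : AEMeasurable (fun x => ‖f x‖ₑ ^ q) := hf.enorm.pow_const q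
  have h1 : AEMeasurable (fun z : E N × E N => ‖f z.1‖ₑ ^ q) :=
    hfm.comp_quasiMeasurePreserving Measure.quasiMeasurePreserving_fst
  have hle : ∀ z ∈ (V ×ˢ V) ∩ {z | δ ≤ ‖z.1 - z.2‖},
      ENNReal.ofReal (‖f z.1 - f z.2‖ ^ q * kern a (z.1 - z.2)) ≤
      ENNReal.ofReal (δ ^ (-((N : ℝ) + a)) * 2 ^ (q - 1)) * (‖f z.1‖ₑ ^ q + ‖f z.2‖ₑ ^ q) := by
    rintro z ⟨-, hz⟩
    have hz' : δ ≤ ‖z.1 - z.2‖ := hz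
    rw [← ofReal_norm, ← ofReal_norm, ENNReal.ofReal_rpow_of_nonneg (norm_nonneg _) hq0.le,
      ENNReal.ofReal_rpow_of_nonneg (norm_nonneg _) hq0.le,
      ← ENNReal.ofReal_add (by positivity) (by positivity), ← ENNReal.ofReal_mul (by positivity)]
    apply ENNReal.ofReal_le_ofReal
    have hk : kern a (z.1 - z.2) ≤ δ ^ (-((N : ℝ) + a)) :=
      Real.rpow_le_rpow_of_nonpos hδ hz' (by linarith)
    have hd : ‖f z.1 - f z.2‖ ^ q ≤ 2 ^ (q - 1) * (‖f z.1‖ ^ q + ‖f z.2‖ ^ q) :=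
      (Real.rpow_le_rpow (norm_nonneg _) (norm_sub_le _ _) hq0.le).trans
        (rpow_add_le_two_mul hq (norm_nonneg _) (norm_nonneg _))
    have hk0 := kern_nonneg a (z.1 - z.2)
    calc _ ≤ (2 ^ (q - 1) * (‖f z.1‖ ^ q + ‖f z.2‖ ^ q)) * δ ^ (-((N : ℝ) + a)) := by gcongr
      _ = _ := by ring
  have hfst : ∫⁻ z in V ×ˢ V, ‖f z.1‖ₑ ^ q ≤ volume V * ∫⁻ x in V, ‖f x‖ₑ ^ q := by
    rw [Measure.volume_eq_prod, ← Measure.prod_restrict]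
    refine (lintegral_prod_le _).trans_eq ?_
    simp only [lintegral_const, Measure.restrict_apply_univ]
    rw [lintegral_mul_const'' _ hfm.restrict, mul_comm]
  have hsnd : ∫⁻ z in V ×ˢ V, ‖f z.2‖ₑ ^ q ≤ volume V * ∫⁻ x in V, ‖f x‖ₑ ^ q := by
    refine le_of_eq_of_le ?_ hfst
    exact setLIntegral_prod_swap (B := V) (fun z => ‖f z.1‖ₑ ^ q)
  have hms : MeasurableSet ((V ×ˢ V) ∩ {z : E N × E N | δ ≤ ‖z.1 - z.2‖}) :=
    (hV.prod hV).inter (measurableSet_far δ)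
  refine (setLIntegral_mono' hms hle).trans ((lintegral_mono_set inter_subset_left).trans ?_)
  rw [lintegral_const_mul' _ _ ENNReal.ofReal_ne_top, lintegral_add_left' h1.restrict]
  calc _ ≤ ENNReal.ofReal (δ ^ (-((N : ℝ) + a)) * 2 ^ (q - 1)) *
        (volume V * (∫⁻ x in V, ‖f x‖ₑ ^ q) + volume V * ∫⁻ x in V, ‖f x‖ₑ ^ q) := by
        gcongr ENNReal.ofReal _ * ?_
        exact add_le_add hfst hsnd
    _ = ENNReal.ofReal (δ ^ (-((N : ℝ) + a)) * 2 ^ (q - 1)) * 2 *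
        (volume V * ∫⁻ x in V, ‖f x‖ₑ ^ q) := by ring
    _ = _ := by
        have h2 : ENNReal.ofReal (2 ^ (q - 1)) * 2 = ENNReal.ofReal (2 ^ q) := by
          rw [← ENNReal.ofReal_ofNat 2, ← ENNReal.ofReal_mul (by positivity),
            Real.rpow_sub_one (by norm_num), div_mul_cancel₀ _ (by norm_num)]
        rw [ENNReal.ofReal_mul (by positivity), mul_assoc (ENNReal.ofReal _), h2]

/-- Bounds for increments give bounds for the Gagliardo seminorm. -/
lemma gagliardoPow_le_of_increment {q α σ δ r : ℝ} (hq : 1 ≤ q) (hα : 0 < α)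
    (hδ : 0 < δ) (hr : r ≤ 1) {x₀ : E N} {f : E N → F} (hf : AEStronglyMeasurable f) {D : ℝ≥0∞}
    (h : ∀ k : E N, ‖k‖ ≤ δ → ∫⁻ x in ball x₀ r, ‖f (x + k) - f x‖ₑ ^ q ≤
      D * ENNReal.ofReal (‖k‖ ^ σ)) :
    gagliardoPow α q (ball x₀ r) f ≤ nearConst N (σ - α * q) * D +
      ENNReal.ofReal (δ ^ (-((N : ℝ) + α * q))) * ENNReal.ofReal (2 ^ q) *
        (unitVol N * ∫⁻ x in ball x₀ r, ‖f x‖ₑ ^ q) := by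
  have hq0 : 0 < q := by linarith
  set B := ball x₀ r with hB
  have hBm : MeasurableSet B := measurableSet_ball
  rw [gagliardoPow_eq hq0 hα hf]
  set Φ : E N × E N → ℝ≥0∞ := fun z =>
    ENNReal.ofReal (‖f z.1 - f z.2‖ ^ q * kern (α * q) (z.1 - z.2)) with hΦ
  have hΦm : AEMeasurable Φ :=
    (((aestronglyMeasurable_diff hf).norm.aemeasurable.pow_const q).mul (by fun_prop)).ennreal_ofReal
  set S := {z : E N × E N | δ ≤ ‖z.1 - z.2‖} with hS
  have hSm : MeasurableSet S := measurableSet_far δ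
  -- Close pairs are integrated over their difference `k`, where the increment bound leaves the
  -- kernel `|k|^{σ - αq - N}`; pairs at distance at least `δ` see no singularity.
  have hsplit : ∫⁻ z in B ×ˢ B, Φ z ≤ (∫⁻ z in B ×ˢ B, Sᶜ.indicator Φ z) +
      ∫⁻ z in (B ×ˢ B) ∩ S, Φ z := by
    rw [lintegral_indicator hSm.compl, Measure.restrict_restrict hSm.compl, inter_comm Sᶜ]
    refine le_trans (lintegral_mono_set ?_) (lintegral_union_le _ _ _)
    rw [← inter_union_distrib_left]
    simp
  refine hsplit.trans (add_le_add ?_ ?_)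
  · refine setLIntegral_prod_le_nearConst_mul hr (hΦm.indicator hSm.compl).restrict ?_
    intro k _
    by_cases hk : ‖k‖ < δ
    · rcases eq_or_ne k 0 with rfl | hk0
      · simp [hΦ, Real.zero_rpow hq0.ne', indicator]
      have e : ∀ x, Sᶜ.indicator Φ (x, x + k) =
          ENNReal.ofReal (kern (α * q) k) * ‖f (x + k) - f x‖ₑ ^ q := by
        intro x
        have : (x, x + k) ∈ Sᶜ := by simpa [hS] using hk
        rw [indicator_of_mem this, hΦ]
        simp only [sub_add_cancel_left, kern_neg]
        rw [mul_comm, ENNReal.ofReal_mul (kern_nonneg _ _), norm_sub_rev,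
          ← ENNReal.ofReal_rpow_of_nonneg (norm_nonneg _) hq0.le, ofReal_norm]
      simp_rw [e]
      rw [lintegral_const_mul' _ _ ENNReal.ofReal_ne_top]
      calc _ ≤ ENNReal.ofReal (kern (α * q) k) * (D * ENNReal.ofReal (‖k‖ ^ σ)) := by
            gcongr ENNReal.ofReal _ * ?_
            exact (lintegral_mono_set inter_subset_left).trans (h k hk.le)
        _ = ENNReal.ofReal (‖k‖ ^ σ * kern (α * q) k) * D := by
            rw [ENNReal.ofReal_mul (by positivity)]; ring
        _ = _ := by rw [rpow_mul_kern _ _ hk0, neg_sub]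
    · have e : ∀ x, Sᶜ.indicator Φ (x, x + k) = 0 := by
        intro x
        apply indicator_of_notMem
        simpa [hS] using hk
      simp_rw [e]
      simp
  · refine (setLIntegral_far_kern_le hq (by positivity) hδ hBm hf).trans ?_
    gcongr
    exact volume_ball_le hr

/-- Local finiteness of the Gagliardo seminorm. -/
lemma gagliardoPow_lt_top_of_locally {q α : ℝ} (hq : 1 ≤ q) (hα : 0 < α) {V : Set (E N)}
    (hV : IsOpen V) (hVc : IsCompact (closure V)) {f : E N → F} (hf : AEStronglyMeasurable f)
    (hfV : ∫⁻ x in V, ‖f x‖ₑ ^ q < ∞)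
    (h : ∀ x ∈ closure V, ∃ ρ > 0, gagliardoPow α q (ball x ρ) f < ∞) :
    gagliardoPow α q V f < ∞ := by
  have hq0 : 0 < q := by linarith
  choose! ρ hρ0 hρ using h
  obtain ⟨t, ht, hcov⟩ := hVc.elim_nhds_subcover (fun x => ball x (ρ x))
    fun x hx => ball_mem_nhds x (hρ0 x hx)
  -- With a Lebesgue number of the finite cover, two points of `V` closer than `δ` share one of the
  -- balls, and the remaining pairs are away from the diagonal.
  obtain ⟨δ, hδ, hleb⟩ := lebesgue_number_lemma_of_metric (ι := t) (c := fun i => ball i.1 (ρ i.1))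
    hVc (fun i => isOpen_ball) (by simpa [iUnion_subtype] using hcov)
  rw [gagliardoPow_eq hq0 hα hf]
  set Φ : E N × E N → ℝ≥0∞ := fun z =>
    ENNReal.ofReal (‖f z.1 - f z.2‖ ^ q * kern (α * q) (z.1 - z.2)) with hΦ
  have hsub : V ×ˢ V ⊆ (⋃ i : t, ball i.1 (ρ i.1) ×ˢ ball i.1 (ρ i.1)) ∪
      ((V ×ˢ V) ∩ {z | δ ≤ ‖z.1 - z.2‖}) := by
    rintro ⟨x, y⟩ hxy
    rcases lt_or_ge ‖x - y‖ δ with hlt | hge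
    · left
      obtain ⟨i, hi⟩ := hleb x (subset_closure hxy.1)
      refine mem_iUnion.2 ⟨i, hi (mem_ball_self hδ), hi ?_⟩
      rw [mem_ball, dist_comm, dist_eq_norm]
      exact hlt
    · right
      exact ⟨hxy, hge⟩
  refine (lintegral_mono_set hsub).trans_lt ((lintegral_union_le _ _ _).trans_lt
    (ENNReal.add_lt_top.2 ⟨?_, ?_⟩))
  · refine (lintegral_iUnion_le _ _).trans_lt ?_
    rw [tsum_fintype, ENNReal.sum_lt_top]
    intro i _
    have := hρ i.1 (ht i.1 i.2)
    rwa [gagliardoPow_eq hq0 hα hf] at this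
  · refine (setLIntegral_far_kern_le hq (by positivity) hδ hV.measurableSet hf).trans_lt ?_
    have hvol : volume V < ∞ := (measure_mono subset_closure).trans_lt hVc.measure_lt_top
    exact ENNReal.mul_lt_top (ENNReal.mul_lt_top ENNReal.ofReal_lt_top ENNReal.ofReal_lt_top)
      (ENNReal.mul_lt_top hvol hfV)

end Gagliardo

/-! ### Assembling the estimate for weak solutions -/

section Regularity

variable {N : ℕ}

lemma compactlyInside_ball {Ω : Set (E N)} {x₀ : E N} {R : ℝ} (hΩ : closedBall x₀ R ⊆ Ω) :
    CompactlyInside (ball x₀ R) Ω :=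
  ⟨isOpen_ball, (isCompact_closedBall x₀ R).of_isClosed_subset isClosed_closure
    closure_ball_subset_closedBall, closure_ball_subset_closedBall.trans hΩ⟩

lemma MemTailSpace.locallyIntegrable {n s : ℝ} (hn : 1 ≤ n) {u : E N → ℝ}
    (hu : MemTailSpace n s u) : LocallyIntegrable u := by
  refine locallyIntegrable_iff.2 fun K hK => ?_
  have : IsFiniteMeasure (volume.restrict K) := isFiniteMeasure_restrict.2 hK.measure_lt_top.ne
  exact MemLp.integrable (q := ENNReal.ofReal n) (by simpa using hn) (hu.1 K hK)

lemma tail_rpow_eq {s n : ℝ} (hn : 0 < n) (u : E N → ℝ) (x₀ : E N) (R : ℝ) :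
    tail s (n + 1) u x₀ R ^ n =
      ENNReal.ofReal (R ^ (s * (n + 1))) * tailInt (s * (n + 1)) n u x₀ R := by
  rw [tail, ← ENNReal.rpow_mul, add_sub_cancel_right, one_div_mul_cancel hn.ne', ENNReal.rpow_one,
    tailInt]

lemma bigT_ne_top {s n R : ℝ} (hs : 0 < s) (hn : 0 < n) (hR : 0 < R) {Ω : Set (E N)} {u : E N → ℝ}
    (hu : MemTailSpace n (s * (n + 1)) u) (hb : LocallyBounded Ω u) {x₀ : E N}
    (hΩ : closedBall x₀ R ⊆ Ω) : bigT s (n + 1) u x₀ R ≠ ∞ := by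
  refine ENNReal.add_ne_top.2 ⟨(hb _ (compactlyInside_ball hΩ)).ne, fun h => ?_⟩
  have h1 := tail_rpow_eq (s := s) hn u x₀ R
  rw [h, ENNReal.top_rpow_of_pos hn] at h1
  exact ENNReal.mul_ne_top ENNReal.ofReal_ne_top
    (tailInt_ne_top (s := s * (n + 1)) (by positivity) hR hu.2) h1.symm

/-- Undoing the normalization of the tail costs `R ^ (-(s (n + 1)))`, which is at most the same
power of `δ` since `δ ≤ R`. -/
lemma tailInt_le_bigT {s n δ R : ℝ} (hs : 0 < s) (hn : 0 < n) (hδ : 0 < δ) (hδR : δ ≤ R)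
    (u : E N → ℝ) (x₀ : E N) :
    tailInt (s * (n + 1)) n u x₀ R ≤
      ENNReal.ofReal (δ ^ (-(s * (n + 1)))) * bigT s (n + 1) u x₀ R ^ n := by
  have hR : 0 < R := hδ.trans_le hδR
  have e : tailInt (s * (n + 1)) n u x₀ R =
      ENNReal.ofReal (R ^ (-(s * (n + 1)))) * tail s (n + 1) u x₀ R ^ n := by
    rw [tail_rpow_eq hn, ← mul_assoc, ← ENNReal.ofReal_mul (by positivity), ← Real.rpow_add hR]
    simp
  rw [e]
  refine mul_le_mul' (ENNReal.ofReal_le_ofReal ?_) (ENNReal.rpow_le_rpow le_add_self hn.le)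
  exact Real.rpow_le_rpow_of_nonpos hδ hδR (by simp only [Left.neg_nonpos_iff]; positivity)

/-- The constant in the estimate of the fractional seminorm of the gradient. -/
noncomputable def regularityConst (N : ℕ) (s₁ s n m α : ℝ) : ℝ≥0∞ :=
  (nearConst N (s - n - α * (n + m)) * gradConst N (n + m) s (s - n) * energyConst N s₁ s n m +
    ENNReal.ofReal (2 ^ (n + m)) * unitVol N) * ENNReal.ofReal (8 ^ ((N : ℝ) + 2 * (n + m))) * 3

lemma regularityConst_ne_top (hN : 1 ≤ N) {s₁ s n m α : ℝ} (hs₁ : 0 < s₁) (hs₁' : s₁ < 1)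
    (hn : 1 ≤ n) (hm : 1 ≤ m) (hsn : n < s) (hs' : s < n + 1) (hα : α * (n + m) < s - n) :
    regularityConst N s₁ s n m α ≠ ∞ := by
  have h1 := nearConst_ne_top hN (show 0 < s - n - α * (n + m) by linarith)
  have h2 := gradConst_ne_top (N := N) (s := s) (show 0 < n + m by linarith)
    (show 0 < s - n by linarith)
  have h3 := energyConst_ne_top hN (m := m) hs₁ hs₁' (show 0 < s by linarith) hs'
  have h4 := unitVol_ne_top (N := N)
  unfold regularityConst
  finiteness

lemma one_add_rpow_add_rpow_le {q : ℝ} (hq : 0 ≤ q) (T L : ℝ≥0∞) :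
    1 + T ^ q + L ^ q ≤ 3 * (T + L + 1) ^ q := by
  have h1 : 1 ≤ (T + L + 1) ^ q := by
    simpa using ENNReal.rpow_le_rpow (show 1 ≤ T + L + 1 from le_add_self) hq
  have h2 : T ^ q ≤ (T + L + 1) ^ q :=
    ENNReal.rpow_le_rpow (le_add_right le_self_add) hq
  have h3 : L ^ q ≤ (T + L + 1) ^ q :=
    ENNReal.rpow_le_rpow (le_add_right le_add_self) hq
  calc _ ≤ (T + L + 1) ^ q + (T + L + 1) ^ q + (T + L + 1) ^ q := by gcongr
    _ = _ := by ring

/-- The estimate of the fractional seminorm of the gradient of a weak solution. -/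
lemma gagliardoPow_weakGradient_le (hN : 1 ≤ N) {s₁ sp n m α : ℝ} (hs₁ : 0 < s₁) (hs₁' : s₁ < 1)
    (hn : 1 ≤ n) (hm : 1 ≤ m) (hsp : n < sp * (n + 1)) (hsp' : sp < 1) (hα : 0 < α)
    (hα' : α * (n + m) < sp * (n + 1) - n)
    {Ω : Set (E N)} (hΩo : IsOpen Ω) {u : E N → ℝ} (hsol : IsWeakSolution s₁ sp (n + 1) Ω u)
    (hb : LocallyBounded Ω u) {G : E N → E N} (hG : IsWeakGradient Ω u G) {x₀ : E N} {r R : ℝ}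
    (hr : 0 < r) (hrR : r < R) (hR : R < 1) (hΩ : closedBall x₀ R ⊆ Ω) :
    gagliardoPow α (n + m) (ball x₀ r) (Ω.indicator G) ≤
      regularityConst N s₁ (sp * (n + 1)) n m α *
        ENNReal.ofReal ((R - r) ^ (-((N : ℝ) + 2 * (n + m) + 2))) *
        (bigT sp (n + 1) u x₀ R + eLpNorm G (ENNReal.ofReal (n + m)) (volume.restrict (ball x₀ R)) +
          1) ^ (n + m) := by
  have hN0 : (0 : ℝ) ≤ N := Nat.cast_nonneg N
  set q := n + m with hq
  set s := sp * (n + 1) with hs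
  have hq1 : 1 ≤ q := by linarith
  have hq0 : 0 < q := by linarith
  have hs0 : 0 < s := by linarith
  have hsp0 : 0 < sp := by
    by_contra! h
    nlinarith
  -- The increments of the gradient on `B_r` need the energy on radius `r + 3 δ`, hence `ρ = r + 4
  -- δ` in `energy_le`, which in turn requires `ρ + 3 δ = r + 7 δ ≤ R`.
  set δ := (R - r) / 8 with hδd
  have hδ : 0 < δ := by rw [hδd]; linarith
  have hδ1 : δ ≤ 1 := by rw [hδd]; linarith
  have hu : LocallyIntegrable u := by
    have := hsol.mem_tail
    rw [add_sub_cancel_right] at this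
    exact this.locallyIntegrable hn
  have hfin := hb _ (compactlyInside_ball hΩ)
  set M := (eLpNorm u ∞ (volume.restrict (ball x₀ R))).toReal with hM
  have huM : ∀ᵐ y, y ∈ ball x₀ R → |u y| ≤ M := by
    have h1 := ae_le_eLpNormEssSup (f := u) (μ := volume.restrict (ball x₀ R))
    rw [ae_restrict_iff' measurableSet_ball] at h1
    filter_upwards [h1] with y hy hyR
    have := ENNReal.toReal_mono hfin.ne ((hy hyR).trans_eq eLpNorm_exponent_top.symm)
    rwa [toReal_enorm, Real.norm_eq_abs] at this
  set T := bigT sp (n + 1) u x₀ R with hT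
  have hMT : ENNReal.ofReal (M ^ n) ≤ T ^ n := by
    rw [← ENNReal.ofReal_rpow_of_nonneg ENNReal.toReal_nonneg (by linarith),
      ENNReal.ofReal_toReal hfin.ne]
    exact ENNReal.rpow_le_rpow le_self_add (by linarith)
  have hδs : 1 ≤ ENNReal.ofReal (δ ^ (-s)) := by
    rw [← ENNReal.ofReal_one]
    exact ENNReal.ofReal_le_ofReal (Real.one_le_rpow_of_pos_of_le_one_of_nonpos hδ hδ1 (by linarith))
  have hTb : ENNReal.ofReal (M ^ n) + tailInt s n u x₀ R ≤
      2 * ENNReal.ofReal (δ ^ (-s)) * T ^ n := by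
    calc _ ≤ ENNReal.ofReal (δ ^ (-s)) * T ^ n + ENNReal.ofReal (δ ^ (-s)) * T ^ n :=
          add_le_add (hMT.trans (le_mul_of_one_le_left' hδs))
            (tailInt_le_bigT hsp0 (by linarith) hδ (by rw [hδd]; linarith) u x₀)
      _ = _ := by ring
  set Λ := ∫⁻ x in ball x₀ R, ‖G x‖ₑ ^ q with hΛ
  set A := energyConst N s₁ s n m
  set Δ := ENNReal.ofReal (δ ^ (-((N : ℝ) + 2 * q))) with hΔ
  set Θ := 1 + T ^ q + Λ with hΘ
  have hen : ∀ h : E N, ‖h‖ ≤ δ → ∫⁻ z in ball x₀ (r + 3 * δ) ×ˢ ball x₀ (r + 3 * δ),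
      ENNReal.ofReal (|(u (z.1 + h) - u z.1) - (u (z.2 + h) - u z.2)| ^ q * kern s (z.1 - z.2)) ≤
      A * (Δ * Θ) * ENNReal.ofReal (‖h‖ ^ m) := by
    intro h hh
    have h1 := energy_le hN hs₁ hs₁' hsp0 hsp' hn hm hδ (ρ := r + 4 * δ) (by positivity)
      (by rw [hδd]; linarith) hR.le hu hG hsol hΩ ENNReal.toReal_nonneg huM hTb hh
    rw [show r + 4 * δ - δ = r + 3 * δ by ring] at h1
    exact h1.trans_eq (by ring)
  set D := gradConst N q s (s - n) * (A * (Δ * Θ))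
  have hmemΩ : ∀ {x}, x ∈ ball x₀ R → x ∈ Ω := fun hx => hΩ (ball_subset_closedBall hx)
  have hincr : ∀ k : E N, ‖k‖ ≤ δ →
      ∫⁻ x in ball x₀ r, ‖Ω.indicator G (x + k) - Ω.indicator G x‖ₑ ^ q ≤
      D * ENNReal.ofReal (‖k‖ ^ (s - n)) := by
    intro k hk
    refine le_of_eq_of_le ?_ (lintegral_weakGradient_increment_le hq1 hs0 (σ := s - n) (m := m)
      (by linarith) (by rw [hq]; ring) hδ (by rw [hδd]; linarith) hu hG hΩ hen hk)
    refine setLIntegral_congr_fun measurableSet_ball fun x hx => ?_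
    rw [indicator_of_mem (hmemΩ (ball_subset_ball hrR.le hx)),
      indicator_of_mem (hmemΩ (add_mem_ball_of_norm_le hx hk (by rw [hδd]; linarith)))]
  -- Only the values of `G` in `Ω` are controlled; its extension by zero is measurable on the whole
  -- space and equals `G` on every ball in use.
  have hGm : AEStronglyMeasurable (Ω.indicator G) :=
    (aestronglyMeasurable_indicator_iff hΩo.measurableSet).2 hG.2.1.aestronglyMeasurable
  have hmain := gagliardoPow_le_of_increment hq1 hα hδ (by linarith) hGm hincr
  have hΛ' : ∫⁻ x in ball x₀ r, ‖Ω.indicator G x‖ₑ ^ q ≤ Θ := by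
    refine le_trans ((setLIntegral_congr_fun measurableSet_ball fun x hx => ?_).trans_le
      (lintegral_mono_set (ball_subset_ball hrR.le))) (le_add_self : Λ ≤ Θ)
    rw [indicator_of_mem (hmemΩ (ball_subset_ball hrR.le hx))]
  have hΔ' : ENNReal.ofReal (δ ^ (-((N : ℝ) + α * q))) ≤ Δ := by
    apply ENNReal.ofReal_le_ofReal
    refine Real.rpow_le_rpow_of_exponent_ge hδ hδ1 ?_
    have : s < n + 1 := by rw [hs]; nlinarith
    nlinarith
  -- The argument yields the exponent `N + 2 q`; the stated one is larger by `2`, which is weaker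
  -- because `R - r < 1`.
  have hΔ8 : Δ ≤ ENNReal.ofReal (8 ^ ((N : ℝ) + 2 * q)) *
      ENNReal.ofReal ((R - r) ^ (-((N : ℝ) + 2 * q + 2))) := by
    rw [← ENNReal.ofReal_mul (by positivity)]
    apply ENNReal.ofReal_le_ofReal
    have h0 : 0 < R - r := by linarith
    rw [hδd, Real.div_rpow h0.le (by norm_num), Real.rpow_neg (by norm_num : (0 : ℝ) ≤ 8),
      div_inv_eq_mul, mul_comm]
    gcongr 8 ^ _ * ?_
    exact Real.rpow_le_rpow_of_exponent_ge h0 (by linarith) (by linarith)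
  have hΘ' := one_add_rpow_add_rpow_le hq0.le T
    (eLpNorm G (ENNReal.ofReal q) (volume.restrict (ball x₀ R)))
  rw [eLpNorm_ofReal_rpow hq0 G] at hΘ'
  refine hmain.trans ?_
  set X := (T + eLpNorm G (ENNReal.ofReal q) (volume.restrict (ball x₀ R)) + 1) ^ q
  calc _ ≤ nearConst N (s - n - α * q) * D +
        Δ * ENNReal.ofReal (2 ^ q) * (unitVol N * Θ) := by gcongr
    _ = (nearConst N (s - n - α * q) * gradConst N q s (s - n) * A +
        ENNReal.ofReal (2 ^ q) * unitVol N) * (Δ * Θ) := by ring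
    _ ≤ (nearConst N (s - n - α * q) * gradConst N q s (s - n) * A +
        ENNReal.ofReal (2 ^ q) * unitVol N) * ((ENNReal.ofReal (8 ^ ((N : ℝ) + 2 * q)) *
          ENNReal.ofReal ((R - r) ^ (-((N : ℝ) + 2 * q + 2)))) * (3 * X)) := by gcongr
    _ = _ := by rw [regularityConst]; ring

/-- A function with a locally `q`-integrable weak gradient whose fractional seminorms are finite on
small balls belongs to the local fractional Sobolev space. -/
lemma memSobolevOneAddLoc_of_locally {α q : ℝ} (hq : 1 ≤ q) (hα : 0 < α) {Ω : Set (E N)}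
    (hΩo : IsOpen Ω) {u : E N → ℝ} {G : E N → E N} (hG : IsWeakGradient Ω u G)
    (huG : ∀ V : Set (E N), CompactlyInside V Ω → MemLq q V u ∧ MemLq q V G)
    (h : ∀ x ∈ Ω, ∃ ρ > 0, gagliardoPow α q (ball x ρ) (Ω.indicator G) < ∞) :
    MemSobolevOneAddLoc α q Ω u := by
  have hq0 : 0 < q := by linarith
  have hGm : AEStronglyMeasurable (Ω.indicator G) :=
    (aestronglyMeasurable_indicator_iff hΩo.measurableSet).2 hG.2.1.aestronglyMeasurable
  refine ⟨G, hG, fun V hV => (huG V hV).1, fun V hV => ⟨(huG V hV).2, ?_⟩⟩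
  have hVΩ : ∀ x ∈ V, Ω.indicator G x = G x := fun x hx =>
    indicator_of_mem (hV.2.2 (subset_closure hx)) G
  rw [← gagliardoPow_congr hV.1.measurableSet hVΩ]
  refine gagliardoPow_lt_top_of_locally hq hα hV.1 hV.2.1 hGm ?_ fun x hx => h x (hV.2.2 hx)
  rw [← eLpNorm_ofReal_rpow hq0]
  refine ENNReal.rpow_lt_top_of_nonneg hq0.le (ne_of_eq_of_ne ?_ (huG V hV).2.2.ne)
  refine eLpNorm_congr_ae ?_
  filter_upwards [ae_restrict_mem hV.1.measurableSet] with x hx using hVΩ x hx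

end Regularity
end NonlocalOneP

/-! ### Conclusion -/

theorem lemma5p6 (N : ℕ) (hN : 2 ≤ N) (p q s₁ sp α : ℝ)
    (hp : 2 ≤ p) (hq : p ≤ q)
    (hs₁ : 0 < s₁) (hs₁' : s₁ < 1) (hsp : (p - 1) / p < sp) (hsp' : sp < 1)
    (hα : 0 < α) (hα' : α < (sp * p - (p - 1)) / q) :
    ∃ C : ℝ, 0 < C ∧
      ∀ (Ω : Set (E N)), IsOpen Ω → IsConnected Ω → Bornology.IsBounded Ω →
      ∀ u : E N → ℝ, IsWeakSolution s₁ sp p Ω u → LocallyBounded Ω u →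
        MemSobolevOneLoc q Ω u →
        MemSobolevOneAddLoc α q Ω u ∧
        ∀ G : E N → E N, IsWeakGradient Ω u G →
          ∀ (x₀ : E N) (R r : ℝ), 0 < r → r < R → R < 1 → Metric.closedBall x₀ R ⊆ Ω →
            gagliardoPow α q (Metric.ball x₀ r) G ≤
              ENNReal.ofReal (C / (R - r) ^ ((N : ℝ) + 2 * q + 2)) *
                (bigT sp p u x₀ R +
                  MeasureTheory.eLpNorm G (ENNReal.ofReal q)
                    (MeasureTheory.volume.restrict (Metric.ball x₀ R)) + 1) ^ q := by
  -- From here on `n = p - 1` is the homogeneity of the operator and `m = q - p + 1` the power used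
  -- in the test function; both are at least `1`.
  obtain ⟨n, rfl⟩ : ∃ n, p = n + 1 := ⟨p - 1, by ring⟩
  obtain ⟨m, rfl⟩ : ∃ m, q = n + m := ⟨q - n, by ring⟩
  rw [add_sub_cancel_right, div_lt_iff₀ (by linarith)] at hsp
  rw [add_sub_cancel_right, lt_div_iff₀ (by linarith)] at hα'
  have hn : 1 ≤ n := by linarith
  have hm : 1 ≤ m := by linarith
  have hN1 : 1 ≤ N := by omega
  have hsp0 : 0 < sp := by
    by_contra! h
    nlinarith
  have hc := regularityConst_ne_top hN1 hs₁ hs₁' hn hm hsp (by nlinarith) hα'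
  set c := regularityConst N s₁ (sp * (n + 1)) n m α with hcd
  -- The summand `1` only ensures that the constant is positive.
  refine ⟨c.toReal + 1, by positivity, fun Ω hΩo _ _ u hsol hb hW => ⟨?_, ?_⟩⟩
  · obtain ⟨G, hG, huG⟩ := hW
    refine memSobolevOneAddLoc_of_locally (by linarith) hα hΩo hG huG fun x hx => ?_
    obtain ⟨ε, hε, hball⟩ := Metric.isOpen_iff.1 hΩo x hx
    set R := min (ε / 2) (1 / 2) with hR
    have hR0 : 0 < R := by positivity
    have hRε : R < ε := (min_le_left _ _).trans_lt (by linarith)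
    have hR1 : R < 1 := (min_le_right _ _).trans_lt (by norm_num)
    have hΩ : closedBall x R ⊆ Ω := (closedBall_subset_ball hRε).trans hball
    refine ⟨R / 2, by positivity, (gagliardoPow_weakGradient_le hN1 hs₁ hs₁' hn hm hsp hsp' hα hα'
      hΩo hsol hb hG (by positivity) (by linarith) hR1 hΩ).trans_lt ?_⟩
    have ht := hsol.mem_tail
    rw [add_sub_cancel_right] at ht
    have h1 := bigT_ne_top hsp0 (by linarith) hR0 ht hb hΩ
    have h2 := (huG _ (compactlyInside_ball hΩ)).2.2.ne
    refine ENNReal.mul_lt_top (ENNReal.mul_lt_top hc.lt_top ENNReal.ofReal_lt_top)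
      (ENNReal.rpow_lt_top_of_nonneg (by linarith) ?_)
    exact ENNReal.add_ne_top.2 ⟨ENNReal.add_ne_top.2 ⟨h1, h2⟩, ENNReal.one_ne_top⟩
  · intro G hG x₀ R r hr hrR hR hΩ
    have h := gagliardoPow_weakGradient_le hN1 hs₁ hs₁' hn hm hsp hsp' hα hα' hΩo hsol hb hG hr hrR
      hR hΩ
    rw [gagliardoPow_congr measurableSet_ball fun x hx => indicator_of_mem
      (hΩ (ball_subset_closedBall (ball_subset_ball hrR.le hx))) G] at h
    refine h.trans (mul_le_mul' ?_ le_rfl)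
    have h0 : 0 < R - r := by linarith
    rw [div_eq_mul_inv, ← Real.rpow_neg h0.le, ENNReal.ofReal_mul (by positivity)]
    refine mul_le_mul' ?_ le_rfl
    exact (ENNReal.le_ofReal_iff_toReal_le hc (by positivity)).2 (by linarith)
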